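/- Let $M$ be a complex manifold (finite dimensional, Hausdorff, paracompact, without boundary), let $L$ and $E$ be holomorphic vector bundles of finite rank over $M$ with sheaves of holomorphic sections $\mathcal L$ and $\mathscr E$, and let $\mathcal L$ be a holomorphic Lie algebroid: $L$ carries a holomorphic bundle map $\rho\colon L\to TM$ (the anchor) and $\mathcal L$ carries a sheaf of $\mathbb C$-bilinear Lie brackets such that $\rho$ is a morphism of sheaves of Lie algebras and $[l,fm]=f[l,m]+\rho(l)(f)\,m$. Write $\Gamma$ for $C^\infty$ sections. A matched sum $A\bowtie B$ is a Lie algebroid structure on $A\oplus B$ for which $A\oplus 0$ and $0\oplus B$ are Lie subalgebroids; its Bott connection of $A$ on $B$ is $D_ab=\mathrm{pr}_B[a,b]$. A (matched-type) Lie triad $(A\bowtie B,A,E)$ is a matched sum together with a flat $A$-connection $\overline\nabla$ on $E$. An extending connection is an $A\bowtie B$-connection $\nabla$ on $E$ with $\nabla_a=\overline\nabla_a$ for $a\in\Gamma(A)$; its Atiyah cocycle is $R^\nabla(a,b)=\nabla_a\nabla_b-\nabla_b\nabla_a-\nabla_{[a,b]}\in\operatorname{End}(E)$, a closed $1$-form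 in the Chevalley–Eilenberg complex of $A$ with coefficients in $B^\vee\otimes\operatorname{End}(E)$ (with the $A$-connection induced by $D$ and $\overline\nabla$). For an open set $U$ let $\mathfrak D_{\mathcal L}(\mathscr E)(U)$ be the $\mathcal O(U)$-module of pairs $(l,\delta)$ with $l\in\mathcal L(U)$ and $\delta\colon\mathscr E|_U\to\mathscr E|_U$ a $\mathbb C$-linear morphism of sheaves with $\delta(fe)=f\delta(e)+\rho(l)(f)\,e$; it has the symbol map $\sigma(l,\delta)=l$, the anchor $\rho\circ\sigma$ and the bracket $[(l,\delta),(l',\delta')]=([l,l'],\delta\delta'-\delta'\delta)$. A global holomorphic $\mathcal L$-connection on $\mathscr E$ is a family of $\mathbb C$-bilinear maps $\nabla\colon\mathcal L(U)\times\mathscr E(U)\to\mathscr E(U)$, for all open $U\subseteq M$, compatible with restrictions, with $\nabla_{fl}e=f\nabla_le$ and $\nabla_l(fe)=f\nabla_le+\rho(l)(f)\,e$ for $f\in\mathcal O(U)$; it is flat if $\nabla_l\nabla_m-\nabla_m\nabla_l=\nabla_{[l,m]}$ for all $U$ and all $l,m\in\mathcal L(U)$. Then: 1. There is exactly one Lie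 triad $(T^{0,1}M\bowtie L,\;T^{0,1}M,\;E)$ such that the anchor of $T^{0,1}M\bowtie L$ is the inclusion on $T^{0,1}M$ and is $\rho$ followed by $TM\cong T^{1,0}M$ on $L$; the Bott connection of $T^{0,1}M$ on $L$ is $D_Xl=\bar\partial_Xl$; the bracket of sections of $L$ agrees, on every open set, with that of $\mathcal L$ on holomorphic sections; and the flat $T^{0,1}M$-connection on $E$ is $\bar\partial$. 2. For this triad extending connections exist, and the classes in $H^1_{\mathrm{CE}}\big(T^{0,1}M,\,L^\vee\otimes\operatorname{End}(E)\big)$ of their Atiyah cocycles are all equal to one class $\alpha$, the Atiyah class. A global holomorphic $\mathcal L$-connection on $\mathscr E$ exists if and only if $\alpha=0$. 3. The sequence of sheaves of $\mathcal O_M$-modules $$0\to\operatorname{End}(\mathscr E)\xrightarrow{\ \iota\ }\mathfrak D_{\mathcal L}(\mathscr E)\xrightarrow{\ \sigma\ }\mathcal L\to0,\qquad \iota(\varphi)=(0,\varphi),$$ is exact. 4. The formula $s(l)=(l,\nabla_l)$, where $\nabla_l$ acts on $e\in\mathscr E(V)$, $V\subseteq U$, by $\nabla_{l|_V}e$, is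 a bijection from the global holomorphic $\mathcal L$-connections $\nabla$ on $\mathscr E$ to the holomorphic right splittings $s\colon\mathcal L\to\mathfrak D_{\mathcal L}(\mathscr E)$ of this sequence (the $\mathcal O_M$-linear morphisms of sheaves with $\sigma\circ s=\mathrm{id}$). Every such $s$ is injective, and $\nabla$ is flat if and only if $s$ is a morphism of holomorphic Lie algebroids, i.e. preserves anchors and brackets (and so makes $\mathcal L$ a holomorphic Lie subalgebroid of $\mathfrak D_{\mathcal L}(\mathscr E)$). -/

import Mathlib

open scoped Manifold ContDiff TensorProduct Topology
open Bundle TopologicalSpace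
set_option linter.unusedSectionVars false

/-- A complex Lie algebroid, presented on the module `G` of its sections over the ring `R` of
complex valued smooth functions: a `ℂ`-bilinear Lie bracket on sections and an `R`-linear anchor
with values in the complex vector fields (the derivations of `R`), which is a homomorphism of Lie
algebras and satisfies the Leibniz rule. -/
@[ext]
structure LieAlgebroid (R G : Type*) [CommRing R] [Algebra ℂ R] [AddCommGroup G] [Module ℂ G]
    [Module R G] where
  bracket : G →ₗ[ℂ] G →ₗ[ℂ] G
  anchor : G →ₗ[R] Derivation ℂ R R
  bracket_self : ∀ x, bracket x x = 0
  jacobi : ∀ x y z,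
    bracket x (bracket y z) = bracket (bracket x y) z + bracket y (bracket x z)
  anchor_bracket : ∀ x y, anchor (bracket x y) = ⁅anchor x, anchor y⁆
  leibniz : ∀ x (f : R) y, bracket x (f • y) = anchor x f • y + f • bracket x y

namespace LieAlgebroid

section General

variable {R G W : Type*} [CommRing R] [Algebra ℂ R]
  [AddCommGroup G] [Module ℂ G] [Module R G]
  [AddCommGroup W] [Module ℂ W] [Module R W] [IsScalarTower ℂ R W]

theorem bracket_swap (𝒢 : LieAlgebroid R G) (x y : G) :
    𝒢.bracket x y = -𝒢.bracket y x := by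
  have h := 𝒢.bracket_self (x + y)
  simp only [map_add, LinearMap.add_apply, 𝒢.bracket_self, zero_add, add_zero] at h
  exact eq_neg_of_add_eq_zero_right h

theorem leibniz_left (𝒢 : LieAlgebroid R G) (f : R) (x y : G) :
    𝒢.bracket (f • x) y = f • 𝒢.bracket x y - 𝒢.anchor y f • x := by
  rw [𝒢.bracket_swap, 𝒢.leibniz, 𝒢.bracket_swap y x]
  simp only [smul_neg]
  abel

variable (W) in
/-- A connection of a Lie algebroid on the bundle with module of sections `W`. -/
structure Connection (𝒢 : LieAlgebroid R G) where
  cov : G →ₗ[R] W →ₗ[ℂ] W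
  leibniz : ∀ x (f : R) w, cov x (f • w) = f • cov x w + 𝒢.anchor x f • w

variable {𝒢 : LieAlgebroid R G}

namespace Connection

/-- The curvature `R(x, y) = ∇_x ∇_y - ∇_y ∇_x - ∇_[x,y]`. -/
def curvature (C : Connection W 𝒢) (x y : G) : W →ₗ[ℂ] W :=
  C.cov x ∘ₗ C.cov y - C.cov y ∘ₗ C.cov x - C.cov (𝒢.bracket x y)

/-- A connection is flat if its curvature vanishes; a bundle with a flat connection is a
representation. -/
def IsFlat (C : Connection W 𝒢) : Prop := ∀ x y, C.curvature x y = 0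

theorem curvature_apply (C : Connection W 𝒢) (x y : G) (w : W) : C.curvature x y w =
    C.cov x (C.cov y w) - C.cov y (C.cov x w) - C.cov (𝒢.bracket x y) w := rfl

theorem curvature_smul_left (C : Connection W 𝒢) (f : R) (x y : G) (w : W) :
    C.curvature (f • x) y w = f • C.curvature x y w := by
  simp only [curvature_apply, 𝒢.leibniz_left, map_smul, map_sub, LinearMap.smul_apply,
    LinearMap.sub_apply, C.leibniz, smul_sub]
  abel

theorem curvature_smul_right (C : Connection W 𝒢) (f : R) (x y : G) (w : W) :
    C.curvature x (f • y) w = f • C.curvature x y w := by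
  simp only [curvature_apply, 𝒢.leibniz, map_smul, map_add, LinearMap.smul_apply,
    LinearMap.add_apply, C.leibniz, smul_sub]
  abel

theorem curvature_apply_smul (C : Connection W 𝒢) (f : R) (x y : G) (w : W) :
    C.curvature x y (f • w) = f • C.curvature x y w := by
  simp only [curvature_apply, 𝒢.anchor_bracket, map_add, Derivation.commutator_apply,
    C.leibniz, smul_sub, sub_smul]
  abel

/-- The Chevalley-Eilenberg differential `Ω⁰ = W → Ω¹ = Hom_R(G, W)`. -/
def d0 (C : Connection W 𝒢) : W →ₗ[ℂ] (G →ₗ[R] W) where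
  toFun w := { toFun := fun x => C.cov x w, map_add' := by simp, map_smul' := by simp }
  map_add' := by intros; ext; simp
  map_smul' := by intros; ext; simp

/-- The Chevalley-Eilenberg differential `Ω¹ = Hom_R(G, W) → Ω²`, where two-forms are recorded as
functions of two sections:
`(dφ)(x, y) = ∇_x (φ y) - ∇_y (φ x) - φ [x, y]`. -/
def d1 (C : Connection W 𝒢) : (G →ₗ[R] W) →ₗ[ℂ] (G → G → W) where
  toFun φ := fun x y => C.cov x (φ y) - C.cov y (φ x) - φ (𝒢.bracket x y)
  map_add' := by intros; ext; simp; abel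
  map_smul' := by intros; ext; simp [smul_sub]

theorem d1_d0 (C : Connection W 𝒢) (h : C.IsFlat) (w : W) : C.d1 (C.d0 w) = 0 := by
  ext x y
  simpa [curvature, d1, d0] using LinearMap.congr_fun (h x y) w

/-- The first Chevalley-Eilenberg cohomology group `H¹_CE(G, W)`: closed one-forms modulo exact
ones (by flatness, every exact one-form is closed). -/
def H1 (C : Connection W 𝒢) : Type _ :=
  LinearMap.ker C.d1 ⧸ (LinearMap.range C.d0).submoduleOf (LinearMap.ker C.d1)

noncomputable instance (C : Connection W 𝒢) : AddCommGroup C.H1 :=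
  inferInstanceAs (AddCommGroup (_ ⧸ (LinearMap.range C.d0).submoduleOf (LinearMap.ker C.d1)))

noncomputable instance (C : Connection W 𝒢) : Module ℂ C.H1 :=
  inferInstanceAs (Module ℂ (_ ⧸ (LinearMap.range C.d0).submoduleOf (LinearMap.ker C.d1)))

/-- The cohomology class of a closed one-form. -/
def H1.mk (C : Connection W 𝒢) : LinearMap.ker C.d1 →ₗ[ℂ] C.H1 :=
  Submodule.mkQ _

end Connection

end General

section Matched

variable {R A B E : Type*} [CommRing R] [Algebra ℂ R]
  [AddCommGroup A] [Module ℂ A] [Module R A] [IsScalarTower ℂ R A]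
  [AddCommGroup B] [Module ℂ B] [Module R B] [IsScalarTower ℂ R B]
  [AddCommGroup E] [Module ℂ E] [Module R E] [IsScalarTower ℂ R E]

/-- A Lie algebroid structure on `A ⊕ B` is a matched sum `A ⋈ B` if `A ⊕ 0` and `0 ⊕ B` are Lie
subalgebroids. -/
structure IsMatchedSum (𝒢 : LieAlgebroid R (A × B)) : Prop where
  left : ∀ a a' : A, (𝒢.bracket (a, 0) (a', 0)).2 = 0
  right : ∀ b b' : B, (𝒢.bracket (0, b) (0, b')).1 = 0

namespace IsMatchedSum

variable {𝒢 : LieAlgebroid R (A × B)}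

/-- The Lie algebroid `A` of a matched sum `A ⋈ B`. -/
def leftAlgebroid (h : IsMatchedSum 𝒢) : LieAlgebroid R A where
  bracket := LinearMap.compr₂ (𝒢.bracket.compl₁₂ (LinearMap.inl ℂ A B) (LinearMap.inl ℂ A B))
    (LinearMap.fst ℂ A B)
  anchor := 𝒢.anchor ∘ₗ LinearMap.inl R A B
  bracket_self x := by simp [𝒢.bracket_self]
  jacobi x y z := by
    have key : ∀ a a' : A, ((𝒢.bracket (a, 0) (a', 0)).1, (0 : B)) = 𝒢.bracket (a, 0) (a', 0) :=
      fun a a' => Prod.ext rfl (h.left a a').symm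
    simpa [key] using congrArg Prod.fst (𝒢.jacobi (x, 0) (y, 0) (z, 0))
  anchor_bracket x y := by
    have key : ∀ a a' : A, ((𝒢.bracket (a, 0) (a', 0)).1, (0 : B)) = 𝒢.bracket (a, 0) (a', 0) :=
      fun a a' => Prod.ext rfl (h.left a a').symm
    simpa [key] using 𝒢.anchor_bracket (x, 0) (y, 0)
  leibniz x f y := by
    simpa using congrArg Prod.fst (𝒢.leibniz (x, 0) f (y, 0))

/-- The Bott connection of `A` on `B` in a matched sum `A ⋈ B`: `D_a b = pr_B [a, b]`. -/
def bott (h : IsMatchedSum 𝒢) : Connection B h.leftAlgebroid where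
  cov :=
    { toFun := fun a => LinearMap.snd ℂ A B ∘ₗ 𝒢.bracket (a, 0) ∘ₗ LinearMap.inr ℂ A B
      map_add' := fun a a' => by
        ext b
        have e : ((a + a', (0 : B)) : A × B) = (a, 0) + (a', 0) := by simp
        rw [e, map_add]
        rfl
      map_smul' := fun f a => by
        ext b
        simpa using congrArg Prod.snd (𝒢.leibniz_left f (a, (0 : B)) (0, b)) }
  leibniz a f b := by
    simpa [leftAlgebroid, add_comm] using congrArg Prod.snd (𝒢.leibniz (a, (0 : B)) f (0, b))

end IsMatchedSum

variable (R A B E) in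
/-- A Lie triad `(A ⋈ B, A, E)` of matched type: a matched sum and a flat `A`-connection on `E`. -/
structure MatchedTriad where
  alg : LieAlgebroid R (A × B)
  matched : IsMatchedSum alg
  conn : Connection E matched.leftAlgebroid
  flat : conn.IsFlat

namespace MatchedTriad

variable (T : MatchedTriad R A B E)

/-- The endomorphism `∇_a (φ(b) e) - φ(b) (∇_a e) - φ(D_a b) e` of `E`, for a bundle map `φ` from
`B` to `End E`, where `D` is the Bott connection. -/
def homCov (a : A) (φ : B →ₗ[R] Module.End R E) (b : B) : Module.End R E where
  toFun e := T.conn.cov a (φ b e) - φ b (T.conn.cov a e) - φ (T.matched.bott.cov a b) e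
  map_add' e e' := by simp only [map_add]; abel
  map_smul' f e := by
    simp only [map_smul, T.conn.leibniz, map_add, smul_sub, RingHom.id_apply]
    abel

theorem homCov_apply (a : A) (φ : B →ₗ[R] Module.End R E) (b : B) (e : E) : T.homCov a φ b e =
    T.conn.cov a (φ b e) - φ b (T.conn.cov a e) - φ (T.matched.bott.cov a b) e := rfl

/-- The map `homCov`, as a bundle map from `B` to `End E`. -/
def homCovHom (a : A) (φ : B →ₗ[R] Module.End R E) : B →ₗ[R] Module.End R E where
  toFun b := T.homCov a φ b
  map_add' b b' := by
    ext e
    simp only [homCov_apply, map_add, LinearMap.add_apply]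
    abel
  map_smul' f b := by
    ext e
    simp only [homCov_apply, map_smul, map_add, T.conn.leibniz, T.matched.bott.leibniz, smul_sub,
      LinearMap.smul_apply, LinearMap.add_apply, RingHom.id_apply]
    abel

theorem homCovHom_apply (a : A) (φ : B →ₗ[R] Module.End R E) (b : B) (e : E) :
    T.homCovHom a φ b e =
      T.conn.cov a (φ b e) - φ b (T.conn.cov a e) - φ (T.matched.bott.cov a b) e := rfl

/-- The map `homCovHom`, as a `ℂ`-linear operator on bundle maps from `B` to `End E`. -/
def homCovOp (a : A) : (B →ₗ[R] Module.End R E) →ₗ[ℂ] (B →ₗ[R] Module.End R E) where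
  toFun φ := T.homCovHom a φ
  map_add' φ ψ := by
    ext b e
    simp only [homCovHom_apply, map_add, LinearMap.add_apply]
    abel
  map_smul' c φ := by
    ext b e
    simp only [homCovHom_apply, map_smul, LinearMap.smul_apply, smul_sub, RingHom.id_apply]

theorem homCovOp_apply (a : A) (φ : B →ₗ[R] Module.End R E) (b : B) (e : E) :
    T.homCovOp a φ b e =
      T.conn.cov a (φ b e) - φ b (T.conn.cov a e) - φ (T.matched.bott.cov a b) e := rfl

/-- The `A`-connection on `B^∨ ⊗ End E` (bundle maps from `B` to `End E`) induced by the Bott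
connection on `B` and the given connection on `E`:
`(∇_a φ)(b) e = ∇_a (φ(b) e) - φ(b) (∇_a e) - φ(D_a b) e`. -/
def homConn : Connection (B →ₗ[R] Module.End R E) T.matched.leftAlgebroid where
  cov :=
    { toFun := T.homCovOp
      map_add' := fun a a' => by
        ext φ b e
        simp only [homCovOp_apply, map_add, LinearMap.add_apply]
        abel
      map_smul' := fun f a => by
        ext φ b e
        simp only [homCovOp_apply, map_smul, LinearMap.smul_apply, smul_sub, RingHom.id_apply] }
  leibniz a f φ := by
    ext b e
    simp only [LinearMap.coe_mk, AddHom.coe_mk, homCovOp_apply, LinearMap.smul_apply,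
      LinearMap.add_apply, T.conn.leibniz, smul_sub]
    abel

/-- An extending connection: an `A ⋈ B`-connection on `E` that restricts to the given flat
`A`-connection. -/
structure ExtendingConnection extends Connection E T.alg where
  extends_conn : ∀ a : A, cov (a, 0) = T.conn.cov a

variable {T}

/-- The Atiyah cocycle of an extending connection, as an element of `Ω¹_A(B^∨ ⊗ End E)`: the part
`R(a, b) = ∇_a ∇_b - ∇_b ∇_a - ∇_[a,b]` of the curvature with `a` in `A` and `b` in `B`. -/
def ExtendingConnection.atiyahForm (C : T.ExtendingConnection) :
    A →ₗ[R] B →ₗ[R] Module.End R E where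
  toFun a :=
    { toFun := fun b =>
        { toFun := fun e => C.curvature (a, 0) (0, b) e
          map_add' := by simp
          map_smul' := fun f e => C.curvature_apply_smul f _ _ e }
      map_add' := fun b b' => by
        have h : ((0 : A), b + b') = (0, b) + (0, b') := by simp
        ext e
        simp only [h, Connection.curvature_apply, map_add, LinearMap.add_apply, LinearMap.coe_mk,
          AddHom.coe_mk]
        abel
      map_smul' := fun f b => by
        have h : ((0 : A), f • b) = f • (0, b) := by simp
        ext e
        simp only [h, Connection.curvature_smul_right, LinearMap.smul_apply, LinearMap.coe_mk,
          AddHom.coe_mk, RingHom.id_apply] }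
  map_add' a a' := by
    have h : (a + a', (0 : B)) = (a, 0) + (a', 0) := by simp
    ext b e
    simp only [h, Connection.curvature_apply, map_add, LinearMap.add_apply, LinearMap.coe_mk,
      AddHom.coe_mk]
    abel
  map_smul' f a := by
    have h : (f • a, (0 : B)) = f • (a, 0) := by simp
    ext b e
    simp only [h, Connection.curvature_smul_left, LinearMap.smul_apply, LinearMap.coe_mk,
      AddHom.coe_mk, RingHom.id_apply]

theorem ExtendingConnection.atiyahForm_apply (C : T.ExtendingConnection) (a : A) (b : B) (e : E) :
    C.atiyahForm a b e = C.curvature (a, 0) (0, b) e := rfl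

/-- The Atiyah cocycle is closed. -/
theorem ExtendingConnection.d1_atiyahForm (C : T.ExtendingConnection) :
    T.homConn.d1 C.atiyahForm = 0 := by
  have hA : ∀ (a a' : A) (e : E), C.curvature (a, 0) (a', 0) e = 0 := fun a a' e => by
    have h : T.alg.bracket (a, 0) (a', 0) = (T.matched.leftAlgebroid.bracket a a', 0) :=
      Prod.ext rfl (T.matched.left a a')
    rw [Connection.curvature_apply, h, C.extends_conn, C.extends_conn, C.extends_conn]
    exact LinearMap.congr_fun (T.flat a a') e
  have hD : ∀ (a a' : A) (b : B) (e : E), C.curvature (a, 0) (0, T.matched.bott.cov a' b) e =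
      C.curvature (a, 0) (T.alg.bracket (a', 0) (0, b)) e := fun a a' b e => by
    have h : T.alg.bracket (a', 0) (0, b) =
        ((T.alg.bracket (a', 0) (0, b)).1, 0) + (0, T.matched.bott.cov a' b) := by
      simp [IsMatchedSum.bott]
    have h' := hA a (T.alg.bracket (a', 0) (0, b)).1 e
    rw [h]
    simp only [Connection.curvature_apply, map_add, LinearMap.add_apply] at h' ⊢
    rw [eq_comm, ← sub_eq_zero, ← h']
    abel
  ext a a' b e
  have hb : ((T.matched.leftAlgebroid.bracket a a', (0 : B)) : A × B) =
      T.alg.bracket (a, 0) (a', 0) := Prod.ext rfl (T.matched.left a a').symm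
  have hR : ∀ w : E, C.cov (T.alg.bracket (a, 0) (a', 0)) w =
      C.cov (a, 0) (C.cov (a', 0) w) - C.cov (a', 0) (C.cov (a, 0) w) := fun w => by
    rw [eq_comm, ← sub_eq_zero]
    exact hA a a' w
  have hJ := T.alg.jacobi (a, 0) (a', 0) (0, b)
  change T.conn.cov a (C.atiyahForm a' b e) - C.atiyahForm a' b (T.conn.cov a e)
      - C.atiyahForm a' (T.matched.bott.cov a b) e
    - (T.conn.cov a' (C.atiyahForm a b e) - C.atiyahForm a b (T.conn.cov a' e)
      - C.atiyahForm a (T.matched.bott.cov a' b) e)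
    - C.atiyahForm (T.matched.leftAlgebroid.bracket a a') b e = 0
  simp only [C.atiyahForm_apply, hD, hb, ← C.extends_conn]
  simp only [Connection.curvature_apply, hJ, map_add, map_sub, LinearMap.add_apply, hR]
  abel

variable (T) in
/-- The cohomology group `H¹_CE(A, B^∨ ⊗ End E)` of a triad. -/
def H1 : Type _ := T.homConn.H1

noncomputable instance : AddCommGroup T.H1 := inferInstanceAs (AddCommGroup T.homConn.H1)

noncomputable instance : Module ℂ T.H1 := inferInstanceAs (Module ℂ T.homConn.H1)

/-- The Atiyah class in `H¹_CE(A, B^∨ ⊗ End E)` represented by the Atiyah cocycle. -/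
noncomputable def ExtendingConnection.atiyahClass (C : T.ExtendingConnection) : T.H1 :=
  Connection.H1.mk T.homConn ⟨C.atiyahForm, C.d1_atiyahForm⟩

end MatchedTriad
end Matched
end LieAlgebroid

noncomputable section
section Geometry

variable {EM : Type*} [NormedAddCommGroup EM] [NormedSpace ℂ EM]
  {M : Type*} [TopologicalSpace M] [ChartedSpace EM M]

/-- A complex manifold is in particular a smooth real manifold. -/
instance instIsManifoldReal [h : IsManifold 𝓘(ℂ, EM) ∞ M] : IsManifold 𝓘(ℝ, EM) ∞ M := by
  refine isManifold_of_contDiffOn 𝓘(ℝ, EM) ∞ M fun e e' he he' => ?_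
  have := (contDiffGroupoid ∞ 𝓘(ℂ, EM)).compatible he he'
  rw [contDiffGroupoid, mem_groupoid_of_pregroupoid] at this
  exact this.1.restrict_scalars ℝ

variable (EM M) in
/-- The algebra `C^∞(M, ℂ)` of complex valued smooth functions. -/
def smoothFunAlg : Subalgebra ℂ (M → ℂ) where
  carrier := {f | ContMDiff 𝓘(ℝ, EM) 𝓘(ℝ, ℂ) ∞ f}
  mul_mem' hf hg := (contDiff_mul (𝕜 := ℝ) (𝔸 := ℂ)).contMDiff.comp (hf.prodMk_space hg)
  add_mem' hf hg := ContMDiff.add hf hg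
  algebraMap_mem' _ := contMDiff_const

variable (EM) in
/-- The algebra `𝒪(U)` of holomorphic functions on an open set. -/
def holFunAlg (U : Opens M) : Subalgebra ℂ (U → ℂ) where
  carrier := {f | ContMDiff 𝓘(ℂ, EM) 𝓘(ℂ, ℂ) ∞ f}
  mul_mem' hf hg := ContMDiff.mul hf hg
  add_mem' hf hg := ContMDiff.add hf hg
  algebraMap_mem' _ := contMDiff_const

variable (EM M) in
/-- The type `C^∞(M, ℂ)`. -/
def SmoothFun : Type _ := smoothFunAlg EM M

instance : CommRing (SmoothFun EM M) := inferInstanceAs (CommRing (smoothFunAlg EM M))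
instance : Algebra ℂ (SmoothFun EM M) := inferInstanceAs (Algebra ℂ (smoothFunAlg EM M))

variable (EM) in
/-- The type `𝒪(U)`. -/
def HolFun (U : Opens M) : Type _ := holFunAlg EM U

instance (U : Opens M) : CommRing (HolFun EM U) := inferInstanceAs (CommRing (holFunAlg EM U))
instance (U : Opens M) : Algebra ℂ (HolFun EM U) := inferInstanceAs (Algebra ℂ (holFunAlg EM U))

section Bundle
variable (F : Type*) [NormedAddCommGroup F] [NormedSpace ℂ F]
  (E : M → Type*) [TopologicalSpace (TotalSpace F E)] [∀ x, AddCommGroup (E x)]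
  [∀ x, Module ℂ (E x)] [∀ x, TopologicalSpace (E x)] [FiberBundle F E] [VectorBundle ℂ F E]

section along
variable {F E}
variable {𝕜 : Type*} [NontriviallyNormedField 𝕜] [NormedAlgebra 𝕜 ℂ] [NormedSpace 𝕜 EM]
  [NormedSpace 𝕜 F] [IsScalarTower 𝕜 ℂ F] {N : Type*} [TopologicalSpace N] [ChartedSpace EM N]
  {g : N → M}

theorem contMDiffAt_along_iff (hg : ContMDiff 𝓘(𝕜, EM) 𝓘(𝕜, EM) ∞ g) {s : ∀ y, E (g y)} (y₀ : N) :
    ContMDiffAt 𝓘(𝕜, EM) (𝓘(𝕜, EM).prod 𝓘(𝕜, F)) ∞ (fun y => TotalSpace.mk' F (g y) (s y)) y₀ ↔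
      ContMDiffAt 𝓘(𝕜, EM) 𝓘(𝕜, F) ∞
        (fun y => (trivializationAt F E (g y₀) ⟨g y, s y⟩).2) y₀ := by
  rw [contMDiffAt_totalSpace]
  exact and_iff_right (hg y₀)

theorem eventually_mem_baseSet_along (hg : ContMDiff 𝓘(𝕜, EM) 𝓘(𝕜, EM) ∞ g) (y₀ : N) :
    ∀ᶠ y in 𝓝 y₀, g y ∈ (trivializationAt F E (g y₀)).baseSet :=
  hg.continuous.continuousAt.eventually_mem
    ((trivializationAt F E (g y₀)).open_baseSet.mem_nhds (mem_baseSet_trivializationAt F E _))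

theorem ContMDiff.add_along (hg : ContMDiff 𝓘(𝕜, EM) 𝓘(𝕜, EM) ∞ g) {s t : ∀ y, E (g y)}
    (hs : ContMDiff 𝓘(𝕜, EM) (𝓘(𝕜, EM).prod 𝓘(𝕜, F)) ∞ (fun y => TotalSpace.mk' F (g y) (s y)))
    (ht : ContMDiff 𝓘(𝕜, EM) (𝓘(𝕜, EM).prod 𝓘(𝕜, F)) ∞ (fun y => TotalSpace.mk' F (g y) (t y))) :
    ContMDiff 𝓘(𝕜, EM) (𝓘(𝕜, EM).prod 𝓘(𝕜, F)) ∞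
      (fun y => TotalSpace.mk' F (g y) (s y + t y)) := by
  intro y₀
  have hs' := (contMDiffAt_along_iff hg y₀).1 (hs y₀)
  have ht' := (contMDiffAt_along_iff hg y₀).1 (ht y₀)
  refine (contMDiffAt_along_iff hg y₀).2 ((hs'.add ht').congr_of_eventuallyEq ?_)
  filter_upwards [eventually_mem_baseSet_along (F := F) (E := E) hg y₀] with y hy
  exact ((trivializationAt F E (g y₀)).linear ℂ hy).map_add _ _

theorem ContMDiff.smul_along (hg : ContMDiff 𝓘(𝕜, EM) 𝓘(𝕜, EM) ∞ g) {f : N → ℂ} {s : ∀ y, E (g y)}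
    (hf : ContMDiff 𝓘(𝕜, EM) 𝓘(𝕜, ℂ) ∞ f)
    (hs : ContMDiff 𝓘(𝕜, EM) (𝓘(𝕜, EM).prod 𝓘(𝕜, F)) ∞ (fun y => TotalSpace.mk' F (g y) (s y))) :
    ContMDiff 𝓘(𝕜, EM) (𝓘(𝕜, EM).prod 𝓘(𝕜, F)) ∞
      (fun y => TotalSpace.mk' F (g y) (f y • s y)) := by
  intro y₀
  have hs' := (contMDiffAt_along_iff hg y₀).1 (hs y₀)
  have hsm : ContMDiffAt 𝓘(𝕜, EM) 𝓘(𝕜, F) ∞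
      (fun y => f y • (trivializationAt F E (g y₀) ⟨g y, s y⟩).2) y₀ := by
    have hb : ContDiff 𝕜 ∞ (fun p : ℂ × F => p.1 • p.2) := contDiff_fst.smul contDiff_snd
    exact ContMDiffAt.comp y₀ (hb.contMDiff _) ((hf y₀).prodMk_space hs')
  refine (contMDiffAt_along_iff hg y₀).2 (hsm.congr_of_eventuallyEq ?_)
  filter_upwards [eventually_mem_baseSet_along (F := F) (E := E) hg y₀] with y hy
  exact ((trivializationAt F E (g y₀)).linear ℂ hy).map_smul _ _

theorem ContMDiff.zero_along (hg : ContMDiff 𝓘(𝕜, EM) 𝓘(𝕜, EM) ∞ g) :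
    ContMDiff 𝓘(𝕜, EM) (𝓘(𝕜, EM).prod 𝓘(𝕜, F)) ∞
      (fun y => TotalSpace.mk' F (g y) (0 : E (g y))) := by
  intro y₀
  refine (contMDiffAt_along_iff hg y₀).2 ((contMDiffAt_const (c := 0)).congr_of_eventuallyEq ?_)
  filter_upwards [eventually_mem_baseSet_along (F := F) (E := E) hg y₀] with y hy
  exact ((trivializationAt F E (g y₀)).linear ℂ hy).map_zero

end along

variable (EM) in
/-- The module `Γ(E)` of smooth sections. -/
def smoothSecSub : Submodule (smoothFunAlg EM M) (Π x, E x) where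
  carrier := {s | ContMDiff 𝓘(ℝ, EM) (𝓘(ℝ, EM).prod 𝓘(ℝ, F)) ∞ (fun x => TotalSpace.mk' F x (s x))}
  add_mem' hs ht := ContMDiff.add_along (g := id) contMDiff_id hs ht
  zero_mem' := ContMDiff.zero_along (g := id) contMDiff_id
  smul_mem' f _ hs := ContMDiff.smul_along (g := id) contMDiff_id f.2 hs

variable (EM) in
/-- The module `ℰ(U)` of holomorphic sections over an open set `U`. -/
def holSecSub (U : Opens M) : Submodule (holFunAlg EM U) (Π x : U, E x) where
  carrier := {s | ContMDiff 𝓘(ℂ, EM) (𝓘(ℂ, EM).prod 𝓘(ℂ, F)) ∞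
    (fun x : U => TotalSpace.mk' F (x : M) (s x))}
  add_mem' hs ht := ContMDiff.add_along contMDiff_subtype_val hs ht
  zero_mem' := ContMDiff.zero_along contMDiff_subtype_val
  smul_mem' f _ hs := ContMDiff.smul_along contMDiff_subtype_val f.2 hs

variable (EM) in
/-- The type `Γ(E)`. -/
def SmoothSec : Type _ := smoothSecSub EM F E

instance : AddCommGroup (SmoothSec EM F E) := inferInstanceAs (AddCommGroup (smoothSecSub EM F E))
instance : Module (SmoothFun EM M) (SmoothSec EM F E) := inferInstanceAs (Module (smoothFunAlg EM M) (smoothSecSub EM F E))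
instance : Module ℂ (SmoothSec EM F E) := Module.compHom (SmoothSec EM F E) (algebraMap ℂ (SmoothFun EM M))
instance : IsScalarTower ℂ (SmoothFun EM M) (SmoothSec EM F E) :=
  IsScalarTower.of_algebraMap_smul fun _ _ => rfl
instance : SMulCommClass ℂ (SmoothFun EM M) (SmoothSec EM F E) := IsScalarTower.to_smulCommClass

variable (EM) in
/-- The type `ℰ(U)`. -/
def HolSec (U : Opens M) : Type _ := holSecSub EM F E U

instance (U : Opens M) : AddCommGroup (HolSec EM F E U) := inferInstanceAs (AddCommGroup (holSecSub EM F E U))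
instance (U : Opens M) : Module (HolFun EM U) (HolSec EM F E U) := inferInstanceAs (Module (holFunAlg EM U) (holSecSub EM F E U))
instance (U : Opens M) : Module ℂ (HolSec EM F E U) := Module.compHom (HolSec EM F E U) (algebraMap ℂ (HolFun EM U))
instance (U : Opens M) : IsScalarTower ℂ (HolFun EM U) (HolSec EM F E U) :=
  IsScalarTower.of_algebraMap_smul fun _ _ => rfl
instance (U : Opens M) : SMulCommClass ℂ (HolFun EM U) (HolSec EM F E U) := IsScalarTower.to_smulCommClass

end Bundle

/-- The complex structure `J` on the tangent space at `x`: multiplication by `i` in the preferred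
chart at `x` (in which `TangentSpace` is defined; the transition maps being holomorphic, any other
chart gives the same map). -/
def tangentJ (x : M) : TangentSpace 𝓘(ℝ, EM) x →ₗ[ℝ] TangentSpace 𝓘(ℝ, EM) x :=
  show EM →ₗ[ℝ] EM from DistribSMul.toLinearMap ℝ EM Complex.I

variable (EM) in
/-- The complexified tangent space. -/
abbrev CTangent (x : M) : Type _ := ℂ ⊗[ℝ] TangentSpace 𝓘(ℝ, EM) x

variable (EM M) in
/-- The module `Γ(T_ℂ M)` of smooth complex vector fields `X + i Y`. -/
def complexFields [IsManifold 𝓘(ℂ, EM) ∞ M] :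
    Submodule (smoothFunAlg EM M) (Π x : M, CTangent EM x) where
  carrier := {Z | ∃ X Y : Π x : M, TangentSpace 𝓘(ℝ, EM) x,
    ContMDiff 𝓘(ℝ, EM) 𝓘(ℝ, EM).tangent ∞ (fun x => (⟨x, X x⟩ : TangentBundle 𝓘(ℝ, EM) M)) ∧
    ContMDiff 𝓘(ℝ, EM) 𝓘(ℝ, EM).tangent ∞ (fun x => (⟨x, Y x⟩ : TangentBundle 𝓘(ℝ, EM) M)) ∧
    ∀ x, Z x = 1 ⊗ₜ X x + Complex.I ⊗ₜ Y x}
  add_mem' := by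
    rintro Z Z' ⟨X, Y, hX, hY, h⟩ ⟨X', Y', hX', hY', h'⟩
    refine ⟨X + X', Y + Y', hX.add_section hX', hY.add_section hY', fun x => ?_⟩
    simp only [Pi.add_apply, h, h', TensorProduct.tmul_add]
    abel
  zero_mem' := ⟨0, 0, contMDiff_zeroSection ℝ _, contMDiff_zeroSection ℝ _, fun x => by simp⟩
  smul_mem' := by
    rintro f Z ⟨X, Y, hX, hY, h⟩
    have hre : ContMDiff 𝓘(ℝ, EM) 𝓘(ℝ, ℝ) ∞ (fun x => (f.1 x).re) :=
      Complex.reCLM.contDiff.contMDiff.comp f.2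
    have him : ContMDiff 𝓘(ℝ, EM) 𝓘(ℝ, ℝ) ∞ (fun x => (f.1 x).im) :=
      Complex.imCLM.contDiff.contMDiff.comp f.2
    refine ⟨(fun x => (f.1 x).re) • X - (fun x => (f.1 x).im) • Y,
      (fun x => (f.1 x).re) • Y + (fun x => (f.1 x).im) • X,
      (hre.smul_section hX).sub_section (him.smul_section hY),
      (hre.smul_section hY).add_section (him.smul_section hX), fun x => ?_⟩
    change f.1 x • Z x = 1 ⊗ₜ ((f.1 x).re • X x - (f.1 x).im • Y x)
      + Complex.I ⊗ₜ ((f.1 x).re • Y x + (f.1 x).im • X x)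
    rw [h]
    conv_lhs => rw [← Complex.re_add_im (f.1 x)]
    simp only [TensorProduct.tmul_add, TensorProduct.tmul_sub, TensorProduct.tmul_smul, smul_add,
      add_smul, TensorProduct.smul_tmul', smul_eq_mul, mul_one, mul_assoc, Complex.I_mul_I,
      Complex.real_smul, mul_neg, TensorProduct.neg_tmul]
    abel

/-- `Z` is a tangent vector of type `(0, 1)` if `J Z = -i Z`. -/
def IsAntiholVec {x : M} (Z : CTangent EM x) : Prop :=
  (tangentJ x).lTensor ℂ Z = -(Complex.I • Z)

variable (EM M) in
/-- The module `Γ(T^{0,1} M)` of smooth complex vector fields of type `(0, 1)`. -/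
def antiholFieldsSub [IsManifold 𝓘(ℂ, EM) ∞ M] : Submodule (smoothFunAlg EM M) (Π x : M, CTangent EM x) where
  carrier := {Z | Z ∈ complexFields EM M ∧ ∀ x, IsAntiholVec (Z x)}
  add_mem' := by
    rintro Z Z' ⟨h, h0⟩ ⟨h', h0'⟩
    refine ⟨add_mem h h', fun x => ?_⟩
    change (tangentJ x).lTensor ℂ (Z x + Z' x) = -(Complex.I • (Z x + Z' x))
    rw [map_add, h0 x, h0' x, smul_add, neg_add]
  zero_mem' := ⟨zero_mem _, fun x => by simp [IsAntiholVec]⟩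
  smul_mem' := by
    rintro f Z ⟨h, h0⟩
    refine ⟨Submodule.smul_mem _ f h, fun x => ?_⟩
    change (tangentJ x).lTensor ℂ (f.1 x • Z x) = -(Complex.I • (f.1 x • Z x))
    have e : (tangentJ x).lTensor ℂ (f.1 x • Z x) = f.1 x • (tangentJ x).lTensor ℂ (Z x) :=
      ((tangentJ x).baseChange ℂ).map_smul (f.1 x) (Z x)
    rw [e, h0 x, smul_neg, smul_comm]

/-- The `(1, 0)` vector `½ (v - i J v)` corresponding to a holomorphic tangent vector `v`. -/
def holToComplex (x : M) (v : TangentSpace 𝓘(ℂ, EM) x) : CTangent EM x :=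
  (1 / 2 : ℂ) • ((1 : ℂ) ⊗ₜ[ℝ] (show TangentSpace 𝓘(ℝ, EM) x from v)
    - Complex.I ⊗ₜ[ℝ] tangentJ x (show TangentSpace 𝓘(ℝ, EM) x from v))

/-- The differential of a function with values in a complex vector space, extended `ℂ`-linearly to
complex tangent vectors. -/
def cderiv {W : Type*} [NormedAddCommGroup W] [NormedSpace ℂ W] (u : M → W) (x : M) :
    CTangent EM x →ₗ[ℂ] W :=
  LinearMap.liftBaseChange ℂ (mvfderiv 𝓘(ℝ, EM) u x : TangentSpace 𝓘(ℝ, EM) x →ₗ[ℝ] W)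

section AntiholFields

variable [IsManifold 𝓘(ℂ, EM) ∞ M]

variable (EM M) in
/-- The type `Γ(T^{0,1} M)`. -/
def AntiholFields : Type _ := antiholFieldsSub EM M

instance : AddCommGroup (AntiholFields EM M) := inferInstanceAs (AddCommGroup (antiholFieldsSub EM M))
instance : Module (SmoothFun EM M) (AntiholFields EM M) := inferInstanceAs (Module (smoothFunAlg EM M) (antiholFieldsSub EM M))
instance : Module ℂ (AntiholFields EM M) := Module.compHom (AntiholFields EM M) (algebraMap ℂ (SmoothFun EM M))
instance : IsScalarTower ℂ (SmoothFun EM M) (AntiholFields EM M) :=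
  IsScalarTower.of_algebraMap_smul fun _ _ => rfl
instance : SMulCommClass ℂ (SmoothFun EM M) (AntiholFields EM M) := IsScalarTower.to_smulCommClass

end AntiholFields

section Bundle
variable (F : Type*) [NormedAddCommGroup F] [NormedSpace ℂ F]
  (E : M → Type*) [TopologicalSpace (TotalSpace F E)] [∀ x, AddCommGroup (E x)]
  [∀ x, Module ℂ (E x)] [∀ x, TopologicalSpace (E x)] [FiberBundle F E] [VectorBundle ℂ F E]

variable {F E} {U V W : Opens M}

/-- Restriction of holomorphic functions. -/
def HolFun.res (h : V ≤ U) : HolFun EM U →ₐ[ℂ] HolFun EM V where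
  toFun f := ⟨fun x => f.1 ⟨x, h x.2⟩, f.2.comp (contMDiff_inclusion h)⟩
  map_one' := rfl
  map_mul' _ _ := rfl
  map_zero' := rfl
  map_add' _ _ := rfl
  commutes' _ := rfl

/-- Restriction of holomorphic sections. -/
def HolSec.res (h : V ≤ U) : HolSec EM F E U →ₗ[ℂ] HolSec EM F E V where
  toFun s := ⟨fun x => s.1 ⟨x, h x.2⟩, s.2.comp (contMDiff_inclusion h)⟩
  map_add' _ _ := rfl
  map_smul' _ _ := rfl

theorem HolSec.res_smul (h : V ≤ U) (f : HolFun EM U) (s : HolSec EM F E U) :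
    HolSec.res h (f • s) = HolFun.res h f • HolSec.res h s := rfl

/-- The Cauchy-Riemann operator at `x`: `∂̄_Z e` is computed in a holomorphic trivialization of `E`
around `x`, and applied to vectors `Z` of type `(0, 1)` it does not depend on the trivialization. -/
def dbarAt (e : Π x, E x) (x : M) : CTangent EM x →ₗ[ℂ] E x :=
  (trivializationAt F E x).symmₗ ℂ x ∘ₗ cderiv (fun y => (trivializationAt F E x ⟨y, e y⟩).2) x

end Bundle

variable {U V W : Opens M}

variable (EM) in
/-- The holomorphic vector fields `𝒯M(U)` on an open set. -/
abbrev holFields [IsManifold 𝓘(ℂ, EM) ∞ M] (U : Opens M) :=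
  HolSec EM EM (TangentSpace 𝓘(ℂ, EM) : M → Type _) U

/-- The differential of a function on an open set at a point of this set (the function is extended
by zero outside of the open set, which does not matter for the differential). -/
def holDerivAt (f : U → ℂ) (x : U) : TangentSpace 𝓘(ℂ, EM) (x : M) →L[ℂ] ℂ :=
  mvfderiv 𝓘(ℂ, EM) (Function.extend Subtype.val f 0) (x : M)

theorem contMDiffOn_extend (f : HolFun EM U) :
    ContMDiffOn 𝓘(ℂ, EM) 𝓘(ℂ, ℂ) ∞ (Function.extend Subtype.val f.1 (0 : M → ℂ)) U := by
  intro x hx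
  refine ContMDiffAt.contMDiffWithinAt ?_
  refine (contMDiffAt_subtype_iff (I := 𝓘(ℂ, EM)) (U := U) (x := ⟨x, hx⟩)).1 ?_
  have h : (fun y : U => Function.extend Subtype.val f.1 (0 : M → ℂ) y) = f.1 := by
    ext y
    exact Subtype.val_injective.extend_apply _ _ _
  rw [h]
  exact f.2 _

/-- The derivative `X(f)` of a holomorphic function along a holomorphic vector field. -/
def holDeriv [IsManifold 𝓘(ℂ, EM) ∞ M] (X : holFields EM U) (f : HolFun EM U) : HolFun EM U :=
  ⟨fun x => holDerivAt f.1 x (X.1 x), by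
    have : IsManifold 𝓘(ℂ, EM) 1 M := IsManifold.of_le (n := ∞) (by simp)
    have h1 := (contMDiffOn_extend f).contMDiffOn_tangentMapWithin (m := ∞) (by simp)
      U.isOpen.uniqueMDiffOn
    have h2 : ContMDiff 𝓘(ℂ, EM) 𝓘(ℂ, EM).tangent ∞
      (fun x : U => (⟨x, X.1 x⟩ : TangentBundle 𝓘(ℂ, EM) M)) := X.2
    have h3 := (contMDiff_snd_tangentBundle_modelSpace (n := ∞) ℂ 𝓘(ℂ, ℂ)).comp
      (h1.comp_contMDiff h2 fun x => x.2)
    refine h3.congr fun x => ?_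
    simp only [Function.comp, tangentMapWithin]
    rw [mfderivWithin_of_isOpen U.isOpen x.2]
    rfl⟩


variable (EM) in
/-- A holomorphic bundle map `ρ : L → TM`. -/
structure HolAnchor [IsManifold 𝓘(ℂ, EM) ∞ M] (F : Type*) [NormedAddCommGroup F]
    [NormedSpace ℂ F] (L : M → Type*) [TopologicalSpace (TotalSpace F L)]
    [∀ x, AddCommGroup (L x)] [∀ x, Module ℂ (L x)] [∀ x, TopologicalSpace (L x)]
    [FiberBundle F L] [VectorBundle ℂ F L] where
  anchor : ∀ x, L x →ₗ[ℂ] TangentSpace 𝓘(ℂ, EM) x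
  contMDiff_anchor : ContMDiff (𝓘(ℂ, EM).prod 𝓘(ℂ, F)) 𝓘(ℂ, EM).tangent ∞
    (fun p : TotalSpace F L => (⟨p.1, anchor p.1 p.2⟩ : TangentBundle 𝓘(ℂ, EM) M))

/-- The derivative `ρ(l)(f)` of a holomorphic function `f` along a holomorphic section `l`. -/
def HolAnchor.act [IsManifold 𝓘(ℂ, EM) ∞ M] {F : Type*} [NormedAddCommGroup F]
    [NormedSpace ℂ F] {L : M → Type*} [TopologicalSpace (TotalSpace F L)]
    [∀ x, AddCommGroup (L x)] [∀ x, Module ℂ (L x)] [∀ x, TopologicalSpace (L x)]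
    [FiberBundle F L] [VectorBundle ℂ F L] (ρ : HolAnchor EM F L) (l : HolSec EM F L U)
    (f : HolFun EM U) : HolFun EM U :=
  holDeriv ⟨fun x => ρ.anchor x (l.1 x), ρ.contMDiff_anchor.comp l.2⟩ f

variable (EM) in
/-- A holomorphic Lie algebroid: a holomorphic vector bundle `L` with a holomorphic bundle map
`ρ : L → TM`, the anchor, and a sheaf of Lie brackets on the holomorphic sections, such that `ρ`
is a morphism of sheaves of Lie algebras (the bracket of holomorphic vector fields being the
commutator of the corresponding derivations) and the Leibniz rule holds. -/
structure HolLieAlgebroid [IsManifold 𝓘(ℂ, EM) ∞ M] (F : Type*) [NormedAddCommGroup F]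
    [NormedSpace ℂ F] (L : M → Type*) [TopologicalSpace (TotalSpace F L)]
    [∀ x, AddCommGroup (L x)] [∀ x, Module ℂ (L x)] [∀ x, TopologicalSpace (L x)]
    [FiberBundle F L] [VectorBundle ℂ F L] extends HolAnchor EM F L where
  bracket : ∀ U : Opens M, HolSec EM F L U →ₗ[ℂ] HolSec EM F L U →ₗ[ℂ] HolSec EM F L U
  bracket_self : ∀ U l, bracket U l l = 0
  jacobi : ∀ U l m n, bracket U l (bracket U m n) =
    bracket U (bracket U l m) n + bracket U m (bracket U l n)
  bracket_res : ∀ {U V} (h : V ≤ U) l m,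
    bracket V (HolSec.res h l) (HolSec.res h m) = HolSec.res h (bracket U l m)
  act_bracket : ∀ U l m (f : HolFun EM U), toHolAnchor.act (bracket U l m) f =
    toHolAnchor.act l (toHolAnchor.act m f) - toHolAnchor.act m (toHolAnchor.act l f)
  leibniz : ∀ U l (f : HolFun EM U) m,
    bracket U l (f • m) = f • bracket U l m + toHolAnchor.act l f • m

namespace HolLieAlgebroid

variable [IsManifold 𝓘(ℂ, EM) ∞ M]
  {FL : Type*} [NormedAddCommGroup FL] [NormedSpace ℂ FL] {L : M → Type*}
  [TopologicalSpace (TotalSpace FL L)] [∀ x, AddCommGroup (L x)] [∀ x, Module ℂ (L x)]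
  [∀ x, TopologicalSpace (L x)] [FiberBundle FL L] [VectorBundle ℂ FL L]
  (𝓛 : HolLieAlgebroid EM FL L)
  (FE : Type*) [NormedAddCommGroup FE] [NormedSpace ℂ FE] (E : M → Type*)
  [TopologicalSpace (TotalSpace FE E)] [∀ x, AddCommGroup (E x)] [∀ x, Module ℂ (E x)]
  [∀ x, TopologicalSpace (E x)] [FiberBundle FE E] [VectorBundle ℂ FE E]

theorem act_add (l m : HolSec EM FL L U) (f : HolFun EM U) :
    𝓛.act (l + m) f = 𝓛.act l f + 𝓛.act m f := by
  refine Subtype.ext (funext fun x => ?_)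
  change holDerivAt f.1 x (𝓛.anchor x (l.1 x + m.1 x)) =
    holDerivAt f.1 x (𝓛.anchor x (l.1 x)) + holDerivAt f.1 x (𝓛.anchor x (m.1 x))
  rw [map_add, map_add]

theorem act_smul (g : HolFun EM U) (l : HolSec EM FL L U) (f : HolFun EM U) :
    𝓛.act (g • l) f = g * 𝓛.act l f := by
  refine Subtype.ext (funext fun x => ?_)
  change holDerivAt f.1 x (𝓛.anchor x (g.1 x • l.1 x)) =
    g.1 x * holDerivAt f.1 x (𝓛.anchor x (l.1 x))
  rw [map_smul, map_smul, smul_eq_mul]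

theorem act_smul_complex (c : ℂ) (l : HolSec EM FL L U) (f : HolFun EM U) :
    𝓛.act (c • l) f = c • 𝓛.act l f := by
  refine Subtype.ext (funext fun x => ?_)
  change holDerivAt f.1 x (𝓛.anchor x (c • l.1 x)) = c • holDerivAt f.1 x (𝓛.anchor x (l.1 x))
  rw [map_smul, map_smul]

theorem act_zero (f : HolFun EM U) : 𝓛.act 0 f = 0 := by
  have h := 𝓛.act_smul_complex 0 0 f
  rwa [zero_smul, zero_smul] at h

/-- The module `D_𝓛(𝓔)(U)` of `𝓛`-derivations of `𝓔` over the open set `U`: pairs `(l, δ)` of a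
section `l` of `𝓛` over `U` and a morphism of sheaves `δ : 𝓔|_U → 𝓔|_U`, `ℂ`-linear and such that
`δ(f e) = f δ(e) + ρ(l)(f) e`. -/
def derSecSub (U : Opens M) : Submodule ℂ
    (HolSec EM FL L U × Π V : Set.Iic U, Module.End ℂ (HolSec EM FE E (V : Opens M))) where
  carrier := {d | (∀ (V : Set.Iic U) (f : HolFun EM (V : Opens M)) e,
      d.2 V (f • e) = f • d.2 V e + 𝓛.act (HolSec.res V.2 d.1) f • e) ∧
    ∀ (V W : Set.Iic U) (h : (W : Opens M) ≤ V) e,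
      d.2 W (HolSec.res h e) = HolSec.res h (d.2 V e)}
  add_mem' := by
    rintro d d' ⟨h1, h2⟩ ⟨h1', h2'⟩
    refine ⟨fun V f e => ?_, fun V W h e => ?_⟩
    · simp only [Prod.fst_add, Prod.snd_add, Pi.add_apply, LinearMap.add_apply, h1, h1', map_add,
        act_add, smul_add, add_smul]
      abel
    · simp only [Prod.snd_add, Pi.add_apply, LinearMap.add_apply, h2 V W h, h2' V W h, map_add]
  zero_mem' := by
    refine ⟨fun V f e => ?_, fun V W h e => ?_⟩
    · simp only [Prod.fst_zero, Prod.snd_zero, Pi.zero_apply, LinearMap.zero_apply, map_zero,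
        act_zero, smul_zero, zero_smul, add_zero]
    · simp only [Prod.snd_zero, Pi.zero_apply, LinearMap.zero_apply, map_zero]
  smul_mem' := by
    rintro c d ⟨h1, h2⟩
    refine ⟨fun V f e => ?_, fun V W h e => ?_⟩
    · simp only [Prod.smul_fst, Prod.smul_snd, Pi.smul_apply, LinearMap.smul_apply, h1, map_smul,
        act_smul_complex, smul_add, smul_assoc, smul_comm c f]
    · simp only [Prod.smul_snd, Pi.smul_apply, LinearMap.smul_apply, h2 V W h, map_smul]

variable {𝓛 FE E}

variable (𝓛 FE E) in
/-- The type `D_𝓛(𝓔)(U)`. -/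
def DerSec (U : Opens M) : Type _ := 𝓛.derSecSub FE E U

instance : AddCommGroup (𝓛.DerSec FE E U) := inferInstanceAs (AddCommGroup (𝓛.derSecSub FE E U))

namespace DerSec

/-- The action of a derivation on sections over a smaller open set. -/
def op (d : 𝓛.DerSec FE E U) (h : V ≤ U) : Module.End ℂ (HolSec EM FE E V) := d.1.2 ⟨V, h⟩

theorem ext {d d' : 𝓛.DerSec FE E U} (h1 : d.1.1 = d'.1.1)
    (h2 : ∀ V (h : V ≤ U) e, op d h e = op d' h e) : d = d' :=
  Subtype.ext (Prod.ext h1 (funext fun V => LinearMap.ext (h2 V V.2)))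

theorem op_smul (d : 𝓛.DerSec FE E U) (h : V ≤ U) (f : HolFun EM V) (e : HolSec EM FE E V) :
    op d h (f • e) = f • op d h e + 𝓛.act (HolSec.res h d.1.1) f • e :=
  d.2.1 ⟨V, h⟩ f e

theorem op_res (d : 𝓛.DerSec FE E U) (h : V ≤ U) (h' : W ≤ V) (e : HolSec EM FE E V) :
    op d (h'.trans h) (HolSec.res h' e) = HolSec.res h' (op d h e) :=
  d.2.2 ⟨V, h⟩ ⟨W, h'.trans h⟩ h' e

/-- Construct a derivation. -/
def mk (l : HolSec EM FL L U) (δ : ∀ V, V ≤ U → Module.End ℂ (HolSec EM FE E V))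
    (h1 : ∀ V (h : V ≤ U) (f : HolFun EM V) e,
      δ V h (f • e) = f • δ V h e + 𝓛.act (HolSec.res h l) f • e)
    (h2 : ∀ V W (h : V ≤ U) (h' : W ≤ V) e,
      δ W (h'.trans h) (HolSec.res h' e) = HolSec.res h' (δ V h e)) : 𝓛.DerSec FE E U :=
  ⟨(l, fun V => δ V V.2), fun V f e => h1 V V.2 f e, fun V _ h e => h2 V _ V.2 h e⟩

/-- The product `f • (l, δ) = (f l, f δ)`. -/
instance : SMul (HolFun EM U) (𝓛.DerSec FE E U) where
  smul f d := mk (f • d.1.1) (fun V h => HolFun.res h f • op d h)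
    (fun V h g e => by
      rw [LinearMap.smul_apply, op_smul, LinearMap.smul_apply, smul_add, HolSec.res_smul,
        act_smul, smul_smul, smul_smul, smul_smul, mul_comm g])
    (fun V W h h' e => by
      rw [LinearMap.smul_apply, op_res d h h', LinearMap.smul_apply, HolSec.res_smul]
      rfl)

theorem op_smul_left (f : HolFun EM U) (d : 𝓛.DerSec FE E U) (h : V ≤ U) (e : HolSec EM FE E V) :
    op (f • d) h e = HolFun.res h f • op d h e := rfl

theorem op_add_left (d d' : 𝓛.DerSec FE E U) (h : V ≤ U) (e : HolSec EM FE E V) :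
    op (d + d') h e = op d h e + op d' h e := rfl

instance : Module (HolFun EM U) (𝓛.DerSec FE E U) where
  one_smul d := ext (one_smul (HolFun EM U) d.1.1) fun V h e => by
    rw [op_smul_left, map_one, one_smul]
  mul_smul f g d := ext (mul_smul f g d.1.1) fun V h e => by
    rw [op_smul_left, op_smul_left, op_smul_left, map_mul, mul_smul]
  smul_zero f := ext (smul_zero f) fun V h e => smul_zero (HolFun.res h f)
  smul_add f d d' := ext (smul_add f d.1.1 d'.1.1) fun V h e =>
    smul_add (HolFun.res h f) (op d h e) (op d' h e)
  add_smul f g d := ext (add_smul f g d.1.1) fun V h e =>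
    add_smul (HolFun.res h f) (HolFun.res h g) (op d h e)
  zero_smul d := ext (zero_smul (HolFun EM U) d.1.1) fun V h e =>
    zero_smul (HolFun EM V) (op d h e)

/-- Restriction of derivations. -/
def res (h : V ≤ U) (d : 𝓛.DerSec FE E U) : 𝓛.DerSec FE E V :=
  mk (HolSec.res h d.1.1) (fun _ h' => op d (h'.trans h)) (fun _ h' => op_smul d (h'.trans h))
    (fun _ _ h' => op_res d (h'.trans h))

/-- The symbol map `σ : D_𝓛(𝓔) → 𝓛`. The anchor of `D_𝓛(𝓔)` is `ρ ∘ σ`. -/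
def symbol (U : Opens M) : 𝓛.DerSec FE E U →ₗ[HolFun EM U] HolSec EM FL L U where
  toFun d := d.1.1
  map_add' _ _ := rfl
  map_smul' _ _ := rfl

/-- The bracket `[(l, δ), (l', δ')] = ([l, l'], δ δ' - δ' δ)` of `D_𝓛(𝓔)`. -/
def bracket (d d' : 𝓛.DerSec FE E U) : 𝓛.DerSec FE E U :=
  mk (𝓛.bracket U d.1.1 d'.1.1) (fun _ h => op d h ∘ₗ op d' h - op d' h ∘ₗ op d h)
    (fun V h f e => by
      simp only [LinearMap.sub_apply, LinearMap.comp_apply, op_smul, map_add, ← 𝓛.bracket_res,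
        𝓛.act_bracket, smul_sub, sub_smul]
      abel)
    (fun V W h h' e => by
      simp only [LinearMap.sub_apply, LinearMap.comp_apply, op_res _ h h', map_sub])

end DerSec

variable (𝓛 FE E)

section Endomorphisms

variable [∀ x, IsTopologicalAddGroup (E x)] [∀ x, ContinuousSMul ℂ (E x)]

variable (EM) in
/-- The holomorphic sections over `U` of the endomorphism bundle `End(E)`. -/
abbrev endSec (U : Opens M) :=
  HolSec EM (FE →L[ℂ] FE) (fun x => E x →L[ℂ] E x) U

variable {FE E}

/-- A holomorphic endomorphism acting on holomorphic sections over a smaller open set. -/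
def endOp (φ : endSec EM FE E U) (h : V ≤ U) : Module.End ℂ (HolSec EM FE E V) where
  toFun e := ⟨fun x => φ.1 ⟨x, h x.2⟩ (e.1 x),
    ContMDiff.clm_bundle_apply
      (HolSec.res (F := FE →L[ℂ] FE) (E := fun x => E x →L[ℂ] E x) h φ).2 e.2⟩
  map_add' e e' := Subtype.ext (funext fun x => map_add (φ.1 ⟨x, h x.2⟩) (e.1 x) (e'.1 x))
  map_smul' c e := Subtype.ext (funext fun x => map_smul (φ.1 ⟨x, h x.2⟩) c (e.1 x))

/-- The inclusion `ι : End(𝓔) → D_𝓛(𝓔)`. -/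
def endInclusion (U : Opens M) : endSec EM FE E U →ₗ[HolFun EM U] 𝓛.DerSec FE E U where
  toFun φ := DerSec.mk 0 (fun _ h => endOp φ h)
    (fun V h f e => by
      rw [map_zero, act_zero, zero_smul, add_zero]
      exact Subtype.ext (funext fun x => map_smul (φ.1 ⟨x, h x.2⟩) (f.1 x) (e.1 x)))
    (fun _ _ _ _ _ => rfl)
  map_add' _ _ := DerSec.ext (add_zero (0 : HolSec EM FL L U)).symm fun _ _ _ => rfl
  map_smul' f _ := DerSec.ext (smul_zero (A := HolSec EM FL L U) f).symm fun _ _ _ => rfl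

end Endomorphisms

/-- A global holomorphic `𝓛`-connection on `𝓔`: connections
`∇ : 𝓛(U) × 𝓔(U) → 𝓔(U)` for all open sets `U`, compatible with restriction. -/
structure HolConnection where
  cov : ∀ U : Opens M, HolSec EM FL L U →ₗ[ℂ] HolSec EM FE E U →ₗ[ℂ] HolSec EM FE E U
  smul_left : ∀ U (f : HolFun EM U) l e, cov U (f • l) e = f • cov U l e
  leibniz : ∀ U l (f : HolFun EM U) e, cov U l (f • e) = f • cov U l e + 𝓛.act l f • e
  cov_res : ∀ {U V} (h : V ≤ U) l e,
    cov V (HolSec.res h l) (HolSec.res h e) = HolSec.res h (cov U l e)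

/-- A splitting `s : 𝓛 → D_𝓛(𝓔)` of the symbol map, as a morphism of sheaves of modules over
holomorphic functions. -/
structure HolSplitting where
  toHom : ∀ U : Opens M, HolSec EM FL L U →ₗ[HolFun EM U] 𝓛.DerSec FE E U
  res : ∀ {U V} (h : V ≤ U) l, toHom V (HolSec.res h l) = DerSec.res h (toHom U l)
  symbol_toHom : ∀ U l, DerSec.symbol U (toHom U l) = l

variable {𝓛 FE E}

/-- A holomorphic connection is flat if `∇_l ∇_m - ∇_m ∇_l - ∇_[l,m] = 0`. -/
def HolConnection.IsFlat (C : 𝓛.HolConnection FE E) : Prop :=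
  ∀ U l m e, C.cov U l (C.cov U m e) - C.cov U m (C.cov U l e) - C.cov U (𝓛.bracket U l m) e = 0

/-- A splitting is a morphism of holomorphic Lie algebroids if it preserves anchors and brackets. -/
structure HolSplitting.IsLieAlgebroidMorphism (s : 𝓛.HolSplitting FE E) : Prop where
  anchor : ∀ U l (f : HolFun EM U), 𝓛.act (DerSec.symbol U (s.toHom U l)) f = 𝓛.act l f
  bracket : ∀ U l m, s.toHom U (𝓛.bracket U l m) = DerSec.bracket (s.toHom U l) (s.toHom U m)

variable (𝓛) in
/-- The triad `(T^{0,1}M ⋈ L, T^{0,1}M, E)` of a holomorphic Lie algebroid `L` and a holomorphic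
vector bundle `E`. The anchor of `T^{0,1}M ⋈ L` is the inclusion on `T^{0,1}M` and the anchor of
`L`, followed by the identification of `TM` with `T^{1,0}M`, on `L`; the Bott connection of
`T^{0,1}M` on `L` and the connection on `E` are the Cauchy-Riemann operators; the bracket of `L`
extends the bracket of holomorphic sections. (The bracket of `T^{0,1}M` and the connection of `L`
on `T^{0,1}M` are determined by the anchor being a homomorphism.) -/
structure IsAtiyahTriad (T : LieAlgebroid.MatchedTriad (SmoothFun EM M) (AntiholFields EM M)
    (SmoothSec EM FL L) (SmoothSec EM FE E)) : Prop where
  anchor : ∀ (X : AntiholFields EM M) (l : SmoothSec EM FL L) (f : SmoothFun EM M) (x : M),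
    (T.alg.anchor (X, l) f).1 x = cderiv f.1 x (X.1 x + holToComplex x (𝓛.anchor x (l.1 x)))
  bott : ∀ (X : AntiholFields EM M) (l : SmoothSec EM FL L) (x : M),
    (T.matched.bott.cov X l).1 x = dbarAt (F := FL) l.1 x (X.1 x)
  bracket : ∀ (l m : SmoothSec EM FL L) (U : Opens M) (l' m' : HolSec EM FL L U),
    (∀ x : U, l.1 x = l'.1 x) → (∀ x : U, m.1 x = m'.1 x) →
      ∀ x : U, (T.alg.bracket (0, l) (0, m)).2.1 x = (𝓛.bracket U l' m').1 x
  conn : ∀ (X : AntiholFields EM M) (e : SmoothSec EM FE E) (x : M),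
    (T.conn.cov X e).1 x = dbarAt (F := FE) e.1 x (X.1 x)

end HolLieAlgebroid

end Geometry

end

/-! Near each point a smooth section of a holomorphic bundle is a combination of holomorphic
sections with smooth coefficients. Hence a map that is tensorial over smooth functions vanishes at a
point once it vanishes on the sections holomorphic near that point (`tensorial_eq_zero`). Most
identities below are checked this way: on holomorphic sections the Cauchy-Riemann operators give
zero, and what remains is an axiom of `𝓛` or of a holomorphic connection.

The triad. Holomorphic frames and the Leibniz rule extend the bracket of `𝓛` to smooth sections,
independently of the frame (`frameBracket_change`). Together with the ∂̄-terms this is the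
`L`-component of the bracket on `T^{0,1}M ⊕ L`. The other component is then forced, because the
anchor has to turn brackets into commutators and is injective on `T^{0,1}M` (`eq_of_der`); it is of
type (0,1) because the commutator of the anchors and the anchor of the `L`-component agree on
holomorphic functions (`cderiv_bracketSnd`). The Jacobiator is tensorial and vanishes on holomorphic
sections (`jacobiator_eq_zero`). For uniqueness, the difference of two admissible brackets is
tensorial and vanishes on holomorphic sections (`IsAtiyahTriad.alg_eq`).

The Atiyah class. A partition of unity glues frame derivatives to an extending connection
(`exists_smoothCov`). Two extending connections differ by a bundle map φ from `L` to `End E`, and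
their cocycles by dφ (`atiyahForm_sub`). So the class is well defined, and it is zero exactly when
some extending connection has zero cocycle. For holomorphic l and e the cocycle is R(X, l)e =
∂̄_X(∇_l e) (`atiyahForm_apply_hol`). Therefore a zero cocycle says that ∇_l e is holomorphic, so
that ∇ restricts to a holomorphic connection; conversely, a holomorphic connection, extended to
smooth sections through frames, has zero cocycle (`atiyahForm_smoothCov`).

The sequence. A derivation with zero symbol is linear over holomorphic functions, hence given by an
endomorphism of the bundle (`range_endInclusion`). Differentiating components in a frame along ρ(l)
gives a local derivation with symbol l (`exists_derSec`). A splitting and a connection are the same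
data read in two ways, and compatibility of the splitting with brackets is flatness
(`HolConnection.isFlat_iff`). -/

noncomputable section

variable {EM : Type*} [NormedAddCommGroup EM] [NormedSpace ℂ EM]
  {M : Type*} [TopologicalSpace M] [ChartedSpace EM M]
  {W : Type*} [NormedAddCommGroup W] [NormedSpace ℂ W]

/-! ### Complex tangent vectors; differentials and vector fields in charts. -/

/-- The real and imaginary parts of a complex tangent vector. -/
def CTangent.re {x : M} : CTangent EM x →ₗ[ℝ] TangentSpace 𝓘(ℝ, EM) x :=
  TensorProduct.lift (LinearMap.lsmul ℝ _ ∘ₗ Complex.reLm)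

def CTangent.im {x : M} : CTangent EM x →ₗ[ℝ] TangentSpace 𝓘(ℝ, EM) x :=
  TensorProduct.lift (LinearMap.lsmul ℝ _ ∘ₗ Complex.imLm)

theorem CTangent.re_tmul {x : M} (a : ℂ) (v : TangentSpace 𝓘(ℝ, EM) x) :
    CTangent.re (EM := EM) (a ⊗ₜ[ℝ] v) = a.re • v := rfl

theorem CTangent.im_tmul {x : M} (a : ℂ) (v : TangentSpace 𝓘(ℝ, EM) x) :
    CTangent.im (EM := EM) (a ⊗ₜ[ℝ] v) = a.im • v := rfl

theorem CTangent.eq_re_add_im {x : M} (Z : CTangent EM x) :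
    Z = (1 : ℂ) ⊗ₜ[ℝ] CTangent.re Z + Complex.I ⊗ₜ[ℝ] CTangent.im Z := by
  induction Z using TensorProduct.induction_on with
  | zero => simp
  | add a b ha hb =>
    conv_lhs => rw [ha, hb]
    simp only [map_add, TensorProduct.tmul_add]
    abel
  | tmul a v =>
    rw [CTangent.re_tmul, CTangent.im_tmul, ← TensorProduct.smul_tmul, ← TensorProduct.smul_tmul,
      ← TensorProduct.add_tmul]
    congr 1
    apply Complex.ext <;> simp

theorem cderiv_tmul (u : M → W) (x : M) (a : ℂ) (v : TangentSpace 𝓘(ℝ, EM) x) :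
    cderiv u x (a ⊗ₜ[ℝ] v) = a • mvfderiv 𝓘(ℝ, EM) u x v := by
  simp [cderiv]

theorem cderiv_congr {u v : M → W} {x : M} (h : u =ᶠ[𝓝 x] v) :
    cderiv (EM := EM) u x = cderiv v x := by
  have : mvfderiv 𝓘(ℝ, EM) u x = mvfderiv 𝓘(ℝ, EM) v x := by
    ext w
    have h1 := h.mfderiv_eq (I := 𝓘(ℝ, EM)) (I' := 𝓘(ℝ, W))
    simp only [mvfderiv, h1]
    rfl
  simp only [cderiv, this]

section chart
variable {𝕜 : Type*} [NontriviallyNormedField 𝕜] {E : Type*} [NormedAddCommGroup E]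
  [NormedSpace 𝕜 E] [ChartedSpace E M] {G : Type*} [NormedAddCommGroup G] [NormedSpace 𝕜 G]

theorem MDifferentiableAt.differentiableAt_comp_extChartAt_symm {u : M → G} {x : M}
    (hu : MDifferentiableAt 𝓘(𝕜, E) 𝓘(𝕜, G) u x) :
    DifferentiableAt 𝕜 (u ∘ (extChartAt 𝓘(𝕜, E) x).symm) (extChartAt 𝓘(𝕜, E) x x) := by
  have := hu.2
  rw [DifferentiableWithinAtProp, ModelWithCorners.range_eq_univ, Set.inter_univ] at this
  exact differentiableWithinAt_univ.1 this

theorem mvfderiv_eq_fderiv {u : M → G} {x : M} (hu : MDifferentiableAt 𝓘(𝕜, E) 𝓘(𝕜, G) u x) :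
    mvfderiv 𝓘(𝕜, E) u x = fderiv 𝕜 (u ∘ (extChartAt 𝓘(𝕜, E) x).symm) (extChartAt 𝓘(𝕜, E) x x) := by
  rw [MDifferentiableAt.mvfderiv hu]
  simp only [ModelWithCorners.range_eq_univ, fderivWithin_univ]
  rfl

/-- The differential in terms of a chart around a different point. -/
theorem mvfderiv_chart [IsManifold 𝓘(𝕜, E) 1 M] {u : M → G} {x₀ y : M}
    (hy : y ∈ (chartAt E x₀).source)
    (hu : MDifferentiableAt 𝓘(𝕜, E) 𝓘(𝕜, G) u y) (v : TangentSpace 𝓘(𝕜, E) y) :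
    mvfderiv 𝓘(𝕜, E) u y v =
      fderiv 𝕜 (u ∘ (extChartAt 𝓘(𝕜, E) x₀).symm) (extChartAt 𝓘(𝕜, E) x₀ y)
        (mvfderiv 𝓘(𝕜, E) (extChartAt 𝓘(𝕜, E) x₀) y v) := by
  have hy' : y ∈ (extChartAt 𝓘(𝕜, E) x₀).source := by simpa using hy
  have h1 : MDifferentiableAt 𝓘(𝕜, E) 𝓘(𝕜, E) (extChartAt 𝓘(𝕜, E) x₀) y :=
    mdifferentiableAt_extChartAt hy
  have h2 : MDifferentiableAt 𝓘(𝕜, E) 𝓘(𝕜, E) (extChartAt 𝓘(𝕜, E) x₀).symm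
      (extChartAt 𝓘(𝕜, E) x₀ y) := by
    have := mdifferentiableWithinAt_extChartAt_symm (I := 𝓘(𝕜, E))
      ((extChartAt 𝓘(𝕜, E) x₀).map_source hy')
    rwa [ModelWithCorners.range_eq_univ, mdifferentiableWithinAt_univ] at this
  have h3 : MDifferentiableAt 𝓘(𝕜, E) 𝓘(𝕜, G) (u ∘ (extChartAt 𝓘(𝕜, E) x₀).symm)
      (extChartAt 𝓘(𝕜, E) x₀ y) := by
    refine MDifferentiableAt.comp (I' := 𝓘(𝕜, E)) _ ?_ h2
    rwa [(extChartAt 𝓘(𝕜, E) x₀).left_inv hy']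
  have h4 : u =ᶠ[𝓝 y] (u ∘ (extChartAt 𝓘(𝕜, E) x₀).symm) ∘ (extChartAt 𝓘(𝕜, E) x₀) := by
    filter_upwards [(isOpen_extChartAt_source (I := 𝓘(𝕜, E)) x₀).mem_nhds hy'] with z hz
    rw [Function.comp_apply, Function.comp_apply, (extChartAt 𝓘(𝕜, E) x₀).left_inv hz]
  have h5 := h4.mfderiv_eq (I := 𝓘(𝕜, E)) (I' := 𝓘(𝕜, G))
  have h6 := mfderiv_comp_apply y h3 h1 v
  rw [mfderiv_eq_fderiv] at h6
  have h7 : mvfderiv 𝓘(𝕜, E) u y v = mfderiv 𝓘(𝕜, E) 𝓘(𝕜, G) u y v := rfl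
  rw [h7, h5]
  exact h6

/-- Links the two descriptions of a tangent vector, by bundle coordinates and by the derivative of a
chart, so that smoothness of a vector field can be tested on chart components. -/
theorem trivializationAt_tangent_snd [IsManifold 𝓘(𝕜, E) 1 M] {x₀ y : M}
    (hy : y ∈ (chartAt E x₀).source) (v : TangentSpace 𝓘(𝕜, E) y) :
    (trivializationAt E (TangentSpace 𝓘(𝕜, E)) x₀ ⟨y, v⟩).2 =
      mvfderiv 𝓘(𝕜, E) (extChartAt 𝓘(𝕜, E) x₀) y v := by
  have h := DFunLike.congr_fun
    (TangentBundle.continuousLinearMapAt_trivializationAt (I := 𝓘(𝕜, E)) hy) v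
  rw [Trivialization.continuousLinearMapAt_apply,
    Trivialization.coe_linearMapAt_of_mem _ (by simpa using hy)] at h
  exact h

/-- A vector field is smooth if its components in the chart are. -/
theorem contMDiffAt_vectorField_iff [IsManifold 𝓘(𝕜, E) ∞ M] {x₀ x : M}
    (hx : x ∈ (chartAt E x₀).source) {X : Π y : M, TangentSpace 𝓘(𝕜, E) y} :
    haveI : IsManifold 𝓘(𝕜, E) 1 M := IsManifold.of_le (n := ∞) (by simp)
    ContMDiffAt 𝓘(𝕜, E) 𝓘(𝕜, E).tangent ∞ (fun y => (⟨y, X y⟩ : TangentBundle 𝓘(𝕜, E) M)) x ↔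
      ContMDiffAt 𝓘(𝕜, E) 𝓘(𝕜, E) ∞
        (fun y => (mvfderiv 𝓘(𝕜, E) (extChartAt 𝓘(𝕜, E) x₀) y (X y) : E)) x := by
  have : IsManifold 𝓘(𝕜, E) 1 M := IsManifold.of_le (n := ∞) (by simp)
  have : IsManifold 𝓘(𝕜, E) (∞ + 1) M := ‹IsManifold 𝓘(𝕜, E) ∞ M›
  have := TangentBundle.contMDiffVectorBundle (n := ∞) (I := 𝓘(𝕜, E)) (M := M)
  have h := Trivialization.contMDiffAt_section_iff (IB := 𝓘(𝕜, E)) (n := ∞) (s := X) (x₀ := x)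
    (trivializationAt E (TangentSpace 𝓘(𝕜, E)) x₀) (by simpa using hx)
  refine h.trans (Filter.EventuallyEq.contMDiffAt_iff ?_)
  filter_upwards [(chartAt E x₀).open_source.mem_nhds hx] with y hy
  exact trivializationAt_tangent_snd hy (X y)

/-- Smoothness of order ∞ at a point provides a neighbourhood for each finite order, not one for all
orders at once; order 1 is enough here. For the same reason later hypotheses ask for smoothness at
all nearby points. -/
theorem eventually_mdifferentiableAt [IsManifold 𝓘(𝕜, E) ∞ M] {u : M → G} {x : M}
    (hu : ContMDiffAt 𝓘(𝕜, E) 𝓘(𝕜, G) ∞ u x) :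
    ∀ᶠ y in 𝓝 x, MDifferentiableAt 𝓘(𝕜, E) 𝓘(𝕜, G) u y := by
  have : IsManifold 𝓘(𝕜, E) 1 M := IsManifold.of_le (n := ∞) (by simp)
  have h1 : ContMDiffAt 𝓘(𝕜, E) 𝓘(𝕜, G) 1 u x := hu.of_le (by simp)
  filter_upwards [(contMDiffAt_iff_contMDiffAt_nhds (by simp)).1 h1] with y hy
  exact ContMDiffAt.mdifferentiableAt hy (by simp)

theorem contDiffAt_comp_extChartAt_symm {u : M → G} {x : M}
    (hu : ContMDiffAt 𝓘(𝕜, E) 𝓘(𝕜, G) ∞ u x) :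
    ContDiffAt 𝕜 ∞ (u ∘ (extChartAt 𝓘(𝕜, E) x).symm) (extChartAt 𝓘(𝕜, E) x x) := by
  have h := (contMDiffAt_iff.1 hu).2
  rw [ModelWithCorners.range_eq_univ, contDiffWithinAt_univ] at h
  exact h

/-- The derivative of a smooth function along a smooth vector field is smooth. -/
theorem contMDiffAt_mvfderiv_apply [IsManifold 𝓘(𝕜, E) ∞ M] {u : M → G} {x : M}
    (hu : ContMDiffAt 𝓘(𝕜, E) 𝓘(𝕜, G) ∞ u x) {X : Π y : M, TangentSpace 𝓘(𝕜, E) y}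
    (hX : haveI : IsManifold 𝓘(𝕜, E) 1 M := IsManifold.of_le (n := ∞) (by simp)
      ContMDiffAt 𝓘(𝕜, E) 𝓘(𝕜, E).tangent ∞ (fun y => (⟨y, X y⟩ : TangentBundle 𝓘(𝕜, E) M)) x) :
    ContMDiffAt 𝓘(𝕜, E) 𝓘(𝕜, G) ∞ (fun y => mvfderiv 𝓘(𝕜, E) u y (X y)) x := by
  have : IsManifold 𝓘(𝕜, E) 1 M := IsManifold.of_le (n := ∞) (by simp)
  have hx := mem_chart_source E x
  rw [contMDiffAt_vectorField_iff hx] at hX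
  have h1 : ContDiffAt 𝕜 ∞ (fderiv 𝕜 (u ∘ (extChartAt 𝓘(𝕜, E) x).symm)) (extChartAt 𝓘(𝕜, E) x x) :=
    (contDiffAt_comp_extChartAt_symm hu).fderiv_right (by simp)
  have h2 : ContMDiffAt 𝓘(𝕜, E) 𝓘(𝕜, E →L[𝕜] G) ∞
      (fun y => fderiv 𝕜 (u ∘ (extChartAt 𝓘(𝕜, E) x).symm) (extChartAt 𝓘(𝕜, E) x y)) x :=
    ContMDiffAt.comp (I' := 𝓘(𝕜, E)) x h1.contMDiffAt contMDiffAt_extChartAt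
  refine (h2.clm_apply hX).congr_of_eventuallyEq ?_
  filter_upwards [eventually_mdifferentiableAt hu, (chartAt E x).open_source.mem_nhds hx] with y hy hy'
  exact mvfderiv_chart hy' hy (X y)

end chart

/-- The components of a real vector field in a chart. -/
theorem mpullbackWithin_extChartAt_symm_apply [IsManifold 𝓘(ℝ, EM) 1 M]
    {x : M} {p : EM} (hp : p ∈ (extChartAt 𝓘(ℝ, EM) x).target)
    (Y : Π y : M, TangentSpace 𝓘(ℝ, EM) y) :
    VectorField.mpullbackWithin 𝓘(ℝ, EM) 𝓘(ℝ, EM) (extChartAt 𝓘(ℝ, EM) x).symm Y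
      (Set.range 𝓘(ℝ, EM)) p =
      mvfderiv 𝓘(ℝ, EM) (extChartAt 𝓘(ℝ, EM) x) ((extChartAt 𝓘(ℝ, EM) x).symm p)
        (Y ((extChartAt 𝓘(ℝ, EM) x).symm p)) := by
  rw [VectorField.mpullbackWithin_apply, ContinuousLinearMap.inverse_eq
    (mfderivWithin_extChartAt_symm_comp_mfderiv_extChartAt hp)
    (mfderiv_extChartAt_comp_mfderivWithin_extChartAt_symm hp)]
  rfl

/-- Commutators of derivatives along real vector fields. -/
theorem mvfderiv_mlieBracket [IsManifold 𝓘(ℝ, EM) ∞ M] {G : Type*} [NormedAddCommGroup G]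
    [NormedSpace ℝ G] {u : M → G} {x : M}
    (hu : ContMDiffAt 𝓘(ℝ, EM) 𝓘(ℝ, G) ∞ u x) {X Y : Π y : M, TangentSpace 𝓘(ℝ, EM) y}
    (hX : haveI : IsManifold 𝓘(ℝ, EM) 1 M := IsManifold.of_le (n := ∞) (by simp)
      ContMDiffAt 𝓘(ℝ, EM) 𝓘(ℝ, EM).tangent ∞ (fun y => (⟨y, X y⟩ : TangentBundle 𝓘(ℝ, EM) M)) x)
    (hY : haveI : IsManifold 𝓘(ℝ, EM) 1 M := IsManifold.of_le (n := ∞) (by simp)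
      ContMDiffAt 𝓘(ℝ, EM) 𝓘(ℝ, EM).tangent ∞
        (fun y => (⟨y, Y y⟩ : TangentBundle 𝓘(ℝ, EM) M)) x) :
    mvfderiv 𝓘(ℝ, EM) u x (VectorField.mlieBracket 𝓘(ℝ, EM) X Y x) =
      mvfderiv 𝓘(ℝ, EM) (fun y => mvfderiv 𝓘(ℝ, EM) u y (Y y)) x (X x) -
        mvfderiv 𝓘(ℝ, EM) (fun y => mvfderiv 𝓘(ℝ, EM) u y (X y)) x (Y x) := by
  have : IsManifold 𝓘(ℝ, EM) 1 M := IsManifold.of_le (n := ∞) (by simp)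
  have hx := mem_chart_source EM x
  set φ := extChartAt 𝓘(ℝ, EM) x with hφ
  have hxφ : x ∈ φ.source := mem_extChartAt_source x
  have htar : φ.target ∈ 𝓝 (φ x) := extChartAt_target_mem_nhds x
  -- In the chart, Y(u) is the derivative of u ∘ φ⁻¹ along the pulled back field. This is needed on
  -- a whole neighbourhood, since it is differentiated once more below.
  have key : ∀ Y : Π y : M, TangentSpace 𝓘(ℝ, EM) y,
      ContMDiffAt 𝓘(ℝ, EM) 𝓘(ℝ, EM).tangent ∞
        (fun y => (⟨y, Y y⟩ : TangentBundle 𝓘(ℝ, EM) M)) x →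
      ∀ᶠ p in 𝓝 (φ x), mvfderiv 𝓘(ℝ, EM) u (φ.symm p) (Y (φ.symm p)) = fderiv ℝ (u ∘ φ.symm) p
        (VectorField.mpullbackWithin 𝓘(ℝ, EM) 𝓘(ℝ, EM) φ.symm Y (Set.range 𝓘(ℝ, EM)) p) := by
    intro Y hY
    have hc : Filter.Tendsto φ.symm (𝓝 (φ x)) (𝓝 x) := by
      have := (continuousAt_extChartAt_symm (I := 𝓘(ℝ, EM)) x).tendsto
      rwa [extChartAt_to_inv] at this
    filter_upwards [htar, hc.eventually (eventually_mdifferentiableAt hu)] with p hp hp'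
    have hs : φ.symm p ∈ (chartAt EM x).source := by
      have := φ.map_target hp
      rwa [hφ, extChartAt_source] at this
    rw [mvfderiv_chart hs hp', mpullbackWithin_extChartAt_symm_apply hp, ← hφ, φ.right_inv hp]
  have hdiff : ∀ Y : Π y : M, TangentSpace 𝓘(ℝ, EM) y,
      ContMDiffAt 𝓘(ℝ, EM) 𝓘(ℝ, EM).tangent ∞
        (fun y => (⟨y, Y y⟩ : TangentBundle 𝓘(ℝ, EM) M)) x →
      DifferentiableAt ℝ (VectorField.mpullbackWithin 𝓘(ℝ, EM) 𝓘(ℝ, EM) φ.symm Y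
        (Set.range 𝓘(ℝ, EM)) : EM → EM) (φ x) := by
    intro Y hY
    rw [contMDiffAt_vectorField_iff hx] at hY
    have h1 := (contDiffAt_comp_extChartAt_symm hY).differentiableAt (by simp)
    refine h1.congr_of_eventuallyEq ?_
    filter_upwards [htar] with p hp
    exact mpullbackWithin_extChartAt_symm_apply hp Y
  have hder : ∀ Y : Π y : M, TangentSpace 𝓘(ℝ, EM) y,
      ContMDiffAt 𝓘(ℝ, EM) 𝓘(ℝ, EM).tangent ∞
        (fun y => (⟨y, Y y⟩ : TangentBundle 𝓘(ℝ, EM) M)) x → ∀ v : TangentSpace 𝓘(ℝ, EM) x,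
      mvfderiv 𝓘(ℝ, EM) (fun y => mvfderiv 𝓘(ℝ, EM) u y (Y y)) x v =
        fderiv ℝ (fun p => fderiv ℝ (u ∘ φ.symm) p (VectorField.mpullbackWithin 𝓘(ℝ, EM) 𝓘(ℝ, EM)
          φ.symm Y (Set.range 𝓘(ℝ, EM)) p)) (φ x) (mvfderiv 𝓘(ℝ, EM) φ x v) := by
    intro Y hY v
    rw [mvfderiv_chart hx ((contMDiffAt_mvfderiv_apply hu hY).mdifferentiableAt (by simp))]
    exact congrFun (congrArg DFunLike.coe (Filter.EventuallyEq.fderiv_eq (key Y hY))) _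
  have hval : ∀ Y : Π y : M, TangentSpace 𝓘(ℝ, EM) y,
      VectorField.mpullbackWithin 𝓘(ℝ, EM) 𝓘(ℝ, EM) φ.symm Y (Set.range 𝓘(ℝ, EM)) (φ x) =
        mvfderiv 𝓘(ℝ, EM) φ x (Y x) := by
    intro Y
    rw [mpullbackWithin_extChartAt_symm_apply (φ.map_source hxφ), ← hφ, φ.left_inv hxφ]
  rw [hder X hX, hder Y hY, ← hval X, ← hval Y]
  -- The commutator formula in a vector space, which rests on the symmetry of the second derivative
  -- of u ∘ φ⁻¹.
  have := VectorField.fderiv_apply_lieBracket (n := ∞) (contDiffAt_comp_extChartAt_symm hu)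
    (by rw [minSmoothness_of_isRCLikeNormedField]; exact WithTop.coe_le_coe.2 le_top) (hdiff Y hY) (hdiff X hX)
  rw [← hφ] at this
  rw [← this, mvfderiv_chart hx (hu.mdifferentiableAt (by simp))]
  congr 1
  rw [← VectorField.mlieBracketWithin_univ, VectorField.mlieBracketWithin_apply]
  simp only [Set.preimage_univ, Set.univ_inter, ModelWithCorners.range_eq_univ]
  -- The bracket on the manifold is the bracket in the chart, pulled back to x; the invertible
  -- derivative of the chart undoes this pull-back.
  obtain ⟨e, he⟩ := isInvertible_mfderiv_extChartAt (I := 𝓘(ℝ, EM)) (mem_extChartAt_source x)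
  change mfderiv _ _ _ _ _ = _
  rw [← he, ContinuousLinearMap.inverse_equiv]
  refine (e.apply_symm_apply _).trans ?_
  exact congrFun (VectorField.lieBracketWithin_univ (E := EM)) _

end

/-! ### Calculus of the complexified differential. -/

noncomputable section

variable {EM : Type*} [NormedAddCommGroup EM] [NormedSpace ℂ EM]
  {M : Type*} [TopologicalSpace M] [ChartedSpace EM M]
  {W : Type*} [NormedAddCommGroup W] [NormedSpace ℂ W]

theorem cderiv_apply (u : M → W) (x : M) (Z : CTangent EM x) :
    cderiv u x Z = mvfderiv 𝓘(ℝ, EM) u x (CTangent.re Z) +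
      Complex.I • mvfderiv 𝓘(ℝ, EM) u x (CTangent.im Z) := by
  conv_lhs => rw [CTangent.eq_re_add_im Z]
  rw [map_add, cderiv_tmul, cderiv_tmul, one_smul]

theorem cderiv_const (c : W) (x : M) : cderiv (EM := EM) (fun _ : M => c) x = 0 := by
  ext Z
  simp [cderiv_apply, mvfderiv_const]

section
variable {x : M}

theorem cderiv_add {u v : M → W} (hu : MDifferentiableAt 𝓘(ℝ, EM) 𝓘(ℝ, W) u x)
    (hv : MDifferentiableAt 𝓘(ℝ, EM) 𝓘(ℝ, W) v x) :
    cderiv (EM := EM) (fun y => u y + v y) x = cderiv u x + cderiv v x := by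
  refine LinearMap.ext fun Z => ?_
  have h := mvfderiv_add hu hv
  simp only [cderiv_apply, LinearMap.add_apply]
  change mvfderiv 𝓘(ℝ, EM) (u + v) x _ + _ • mvfderiv 𝓘(ℝ, EM) (u + v) x _ = _
  rw [h]
  simp only [add_apply, smul_add]
  abel

theorem mvfderiv_clm_comp {W W' : Type*} [NormedAddCommGroup W] [NormedSpace ℝ W]
    [NormedAddCommGroup W'] [NormedSpace ℝ W'] (A : W →L[ℝ] W')
    {u : M → W} (hu : MDifferentiableAt 𝓘(ℝ, EM) 𝓘(ℝ, W) u x) (v : TangentSpace 𝓘(ℝ, EM) x) :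
    mvfderiv 𝓘(ℝ, EM) (fun y => A (u y)) x v = A (mvfderiv 𝓘(ℝ, EM) u x v) := by
  have hA : MDifferentiableAt 𝓘(ℝ, W) 𝓘(ℝ, W') A (u x) := A.differentiableAt.mdifferentiableAt
  have h1 := mfderiv_comp_apply x hA hu v
  rw [mfderiv_eq_fderiv, A.fderiv] at h1
  exact h1

theorem cderiv_clm_comp {W' : Type*} [NormedAddCommGroup W'] [NormedSpace ℂ W'] (A : W →L[ℂ] W')
    {u : M → W} (hu : MDifferentiableAt 𝓘(ℝ, EM) 𝓘(ℝ, W) u x) (Z : CTangent EM x) :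
    cderiv (fun y => A (u y)) x Z = A (cderiv u x Z) := by
  have h := mvfderiv_clm_comp (A.restrictScalars ℝ) hu
  rw [cderiv_apply, cderiv_apply, map_add, map_smul]
  exact congrArg₂ (fun a b => a + Complex.I • b) (h _) (h _)

theorem cderiv_mul {u v : M → ℂ} (hu : MDifferentiableAt 𝓘(ℝ, EM) 𝓘(ℝ, ℂ) u x)
    (hv : MDifferentiableAt 𝓘(ℝ, EM) 𝓘(ℝ, ℂ) v x) (Z : CTangent EM x) :
    cderiv (fun y => u y * v y) x Z = u x * cderiv v x Z + cderiv u x Z * v x := by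
  have hs : MDifferentiableAt 𝓘(ℝ, EM) 𝓘(ℝ, ℂ) (fun y => u y * v y) x := by
    have : DifferentiableAt ℝ (fun p : ℂ × ℂ => p.1 * p.2) (u x, v x) := by fun_prop
    exact MDifferentiableAt.comp (I' := 𝓘(ℝ, ℂ × ℂ)) (g := fun p : ℂ × ℂ => p.1 * p.2)
      x this.mdifferentiableAt (hu.prodMk_space hv)
  have h : ∀ w : TangentSpace 𝓘(ℝ, EM) x, mvfderiv 𝓘(ℝ, EM) (fun y => u y * v y) x w =
      u x * mvfderiv 𝓘(ℝ, EM) v x w + mvfderiv 𝓘(ℝ, EM) u x w * v x := by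
    intro w
    rw [mvfderiv_eq_fderiv hs, mvfderiv_eq_fderiv hu, mvfderiv_eq_fderiv hv]
    have := fderiv_mul hu.differentiableAt_comp_extChartAt_symm
      hv.differentiableAt_comp_extChartAt_symm
    have e : ((fun y => u y * v y) ∘ (extChartAt 𝓘(ℝ, EM) x).symm) =
      (u ∘ (extChartAt 𝓘(ℝ, EM) x).symm) * (v ∘ (extChartAt 𝓘(ℝ, EM) x).symm) := rfl
    rw [e]
    refine (DFunLike.congr_fun this w).trans ?_
    change (u ∘ (extChartAt 𝓘(ℝ, EM) x).symm) (extChartAt 𝓘(ℝ, EM) x x) * _ +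
      (v ∘ (extChartAt 𝓘(ℝ, EM) x).symm) (extChartAt 𝓘(ℝ, EM) x x) * _ = _
    rw [Function.comp_apply, Function.comp_apply, extChartAt_to_inv, mul_comm (v x)]
    rfl
  rw [cderiv_apply, cderiv_apply, cderiv_apply, h, h]
  simp only [smul_eq_mul]
  ring

end

/-! ### Holomorphic functions -/

section
variable {x : M}

theorem ContMDiffAt.real_of_complex {V : Type*} [NormedAddCommGroup V] [NormedSpace ℂ V]
    {N : Type*} [TopologicalSpace N] [ChartedSpace V N] {u : M → N} {x : M}
    (hu : ContMDiffAt 𝓘(ℂ, EM) 𝓘(ℂ, V) ∞ u x) : ContMDiffAt 𝓘(ℝ, EM) 𝓘(ℝ, V) ∞ u x := by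
  rw [contMDiffAt_iff] at hu ⊢
  exact ⟨hu.1, hu.2.restrict_scalars ℝ⟩

theorem MDifferentiableAt.real_of_complex {u : M → W}
    (hu : MDifferentiableAt 𝓘(ℂ, EM) 𝓘(ℂ, W) u x) : MDifferentiableAt 𝓘(ℝ, EM) 𝓘(ℝ, W) u x :=
  ⟨hu.1, hu.2.restrictScalars ℝ⟩

theorem mvfderiv_real_eq_complex {u : M → W} (hu : MDifferentiableAt 𝓘(ℂ, EM) 𝓘(ℂ, W) u x)
    (v : EM) : (mvfderiv 𝓘(ℝ, EM) u x : EM →L[ℝ] W) v = (mvfderiv 𝓘(ℂ, EM) u x : EM →L[ℂ] W) v := by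
  rw [mvfderiv_eq_fderiv hu, mvfderiv_eq_fderiv hu.real_of_complex]
  exact congrFun (congrArg DFunLike.coe (hu.differentiableAt_comp_extChartAt_symm.fderiv_restrictScalars ℝ)) v

theorem tangentJ_tangentJ (v : TangentSpace 𝓘(ℝ, EM) x) : tangentJ x (tangentJ x v) = -v := by
  change Complex.I • (Complex.I • (show EM from v)) = -(show EM from v)
  rw [smul_smul, Complex.I_mul_I, neg_one_smul]

/-- For Z = X + iY the equation JZ = -iZ splits into JX = Y and JY = -X, and the second follows from
the first by J² = -1. So a vector of type (0,1) is determined by its real part. -/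
theorem isAntiholVec_iff (Z : CTangent EM x) :
    IsAntiholVec Z ↔ CTangent.im Z = tangentJ x (CTangent.re Z) := by
  have hI : Complex.I • Z = (-1 : ℂ) ⊗ₜ[ℝ] CTangent.im Z + Complex.I ⊗ₜ[ℝ] CTangent.re Z := by
    conv_lhs => rw [CTangent.eq_re_add_im Z]
    rw [smul_add, TensorProduct.smul_tmul', TensorProduct.smul_tmul', smul_eq_mul, smul_eq_mul,
      mul_one, Complex.I_mul_I, add_comm]
  have hZ : (tangentJ x).lTensor ℂ Z =
      (1 : ℂ) ⊗ₜ[ℝ] tangentJ x (CTangent.re Z) + Complex.I ⊗ₜ[ℝ] tangentJ x (CTangent.im Z) := by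
    conv_lhs => rw [CTangent.eq_re_add_im Z]
    rw [map_add, LinearMap.lTensor_tmul, LinearMap.lTensor_tmul]
  rw [IsAntiholVec, hI, hZ]
  constructor
  · intro h
    have := congrArg CTangent.re h
    simp only [map_add, map_neg, CTangent.re_tmul] at this
    simp only [Complex.one_re, Complex.I_re, one_smul, zero_smul, add_zero, Complex.neg_re,
      neg_smul, neg_neg] at this
    exact this.symm
  · intro h
    rw [h, tangentJ_tangentJ, TensorProduct.tmul_neg, TensorProduct.neg_tmul]
    abel

theorem mvfderiv_tangentJ {u : M → W} (hu : MDifferentiableAt 𝓘(ℂ, EM) 𝓘(ℂ, W) u x)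
    (v : TangentSpace 𝓘(ℝ, EM) x) :
    mvfderiv 𝓘(ℝ, EM) u x (tangentJ x v) = Complex.I • mvfderiv 𝓘(ℝ, EM) u x v := by
  have h1 := mvfderiv_real_eq_complex hu v
  have h2 := mvfderiv_real_eq_complex hu (tangentJ x v)
  have h3 := (mvfderiv 𝓘(ℂ, EM) u x).map_smul Complex.I (show TangentSpace 𝓘(ℂ, EM) x from v)
  exact (h2.trans h3).trans (congrArg (Complex.I • ·) h1.symm)

theorem cderiv_antihol {u : M → W} (hu : MDifferentiableAt 𝓘(ℂ, EM) 𝓘(ℂ, W) u x)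
    {Z : CTangent EM x} (hZ : IsAntiholVec Z) : cderiv u x Z = 0 := by
  rw [isAntiholVec_iff] at hZ
  rw [cderiv_apply, hZ, mvfderiv_tangentJ hu, smul_smul, Complex.I_mul_I, neg_one_smul,
    add_neg_cancel]

/-- By du(Jv) = i du(v), the vectors v and -iJv contribute du(v) each, and the factor ½ in
`holToComplex` compensates for this. -/
theorem cderiv_holToComplex {u : M → W} (hu : MDifferentiableAt 𝓘(ℂ, EM) 𝓘(ℂ, W) u x)
    (v : TangentSpace 𝓘(ℂ, EM) x) :
    cderiv u x (holToComplex x v) = mvfderiv 𝓘(ℂ, EM) u x v := by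
  rw [holToComplex, map_smul, map_sub, cderiv_tmul, cderiv_tmul, mvfderiv_tangentJ hu, smul_smul,
    Complex.I_mul_I, neg_one_smul, sub_neg_eq_add, one_smul, ← two_smul ℂ, smul_smul]
  norm_num
  exact mvfderiv_real_eq_complex hu v

end

section
variable [IsManifold 𝓘(ℂ, EM) ∞ M] {x : M}

/-- The tangent space at x is the model space by means of the preferred chart at x, so this chart
has the identity as derivative at x. Its components are the test functions that recover a tangent
vector from its derivations. -/
theorem mvfderiv_extChartAt_self (v : TangentSpace 𝓘(ℝ, EM) x) :
    (mvfderiv 𝓘(ℝ, EM) (extChartAt 𝓘(ℂ, EM) x) x) v = v := by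
  have : IsManifold 𝓘(ℝ, EM) 1 M := IsManifold.of_le (n := ∞) (by simp)
  exact DFunLike.congr_fun (mfderiv_extChartAt_self (I := 𝓘(ℝ, EM)) (x := x)) v

theorem mdifferentiableAt_extChartAt_self :
    MDifferentiableAt 𝓘(ℝ, EM) 𝓘(ℝ, EM) (extChartAt 𝓘(ℂ, EM) x) x := by
  have : IsManifold 𝓘(ℝ, EM) 1 M := IsManifold.of_le (n := ∞) (by simp)
  exact mdifferentiableAt_extChartAt (I := 𝓘(ℝ, EM)) (mem_chart_source EM x)

theorem eventually_contMDiffAt_extChartAt (x : M) :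
    ∀ᶠ y in 𝓝 x, ContMDiffAt 𝓘(ℂ, EM) 𝓘(ℂ, EM) ∞ (extChartAt 𝓘(ℂ, EM) x) y := by
  filter_upwards [(chartAt EM x).open_source.mem_nhds (mem_chart_source EM x)] with y hy
  exact contMDiffAt_extChartAt' hy

/-- A complex tangent vector that kills all holomorphic functions is of type `(0, 1)`. -/
theorem isAntiholVec_of_forall_cderiv_eq_zero {Z : CTangent EM x}
    (h : ∀ u : M → ℂ, (∀ᶠ y in 𝓝 x, ContMDiffAt 𝓘(ℂ, EM) 𝓘(ℂ, ℂ) ∞ u y) → cderiv u x Z = 0) :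
    IsAntiholVec Z := by
  -- Continuous linear functionals separate points, and their compositions with the chart are
  -- holomorphic near x.
  have h1 : cderiv (extChartAt 𝓘(ℂ, EM) x) x Z = 0 := by
    rw [SeparatingDual.eq_zero_iff_forall_dual_eq_zero (R := ℂ)]
    intro g
    rw [← cderiv_clm_comp g mdifferentiableAt_extChartAt_self]
    refine h _ ?_
    filter_upwards [eventually_contMDiffAt_extChartAt (EM := EM) x] with y hy
    exact ContMDiffAt.comp (I' := 𝓘(ℂ, EM)) y g.contMDiff.contMDiffAt hy
  -- The derivative of the chart sends X + iY to X + JY in `EM`, so X = -JY.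
  rw [cderiv_apply, mvfderiv_extChartAt_self, mvfderiv_extChartAt_self] at h1
  have h2 : CTangent.re Z = -tangentJ x (CTangent.im Z) := eq_neg_of_add_eq_zero_left h1
  rw [isAntiholVec_iff, h2, map_neg, tangentJ_tangentJ, neg_neg]

/-- The derivative of the conjugate of a function. -/
theorem mvfderiv_conj {u : M → ℂ} (hu : MDifferentiableAt 𝓘(ℝ, EM) 𝓘(ℝ, ℂ) u x)
    (v : TangentSpace 𝓘(ℝ, EM) x) : mvfderiv 𝓘(ℝ, EM) (fun y => (starRingEnd ℂ) (u y)) x v =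
      (starRingEnd ℂ) (mvfderiv 𝓘(ℝ, EM) u x v) :=
  mvfderiv_clm_comp (Complex.conjCLE : ℂ →L[ℝ] ℂ) hu v

/-- Vectors of type `(1, 0)` kill the conjugates of holomorphic functions. -/
theorem cderiv_conj_holToComplex {u : M → ℂ} (hu : MDifferentiableAt 𝓘(ℂ, EM) 𝓘(ℂ, ℂ) u x)
    (v : TangentSpace 𝓘(ℂ, EM) x) :
    cderiv (fun y => (starRingEnd ℂ) (u y)) x (holToComplex x v) = 0 := by
  rw [holToComplex, map_smul, map_sub, cderiv_tmul, cderiv_tmul,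
    mvfderiv_conj hu.real_of_complex, mvfderiv_conj hu.real_of_complex, mvfderiv_tangentJ hu,
    smul_eq_mul Complex.I (mvfderiv 𝓘(ℝ, EM) u x _), map_mul, Complex.conj_I, smul_eq_mul Complex.I,
    ← mul_assoc, mul_neg, Complex.I_mul_I, neg_neg, one_mul, one_smul, sub_self, smul_zero]

/-- A vector of type `(0, 1)` that kills the conjugates of all holomorphic functions vanishes. -/
theorem IsAntiholVec.eq_zero_of_conj {Z : CTangent EM x} (hZ : IsAntiholVec Z)
    (h : ∀ u : M → ℂ, (∀ᶠ y in 𝓝 x, ContMDiffAt 𝓘(ℂ, EM) 𝓘(ℂ, ℂ) ∞ u y) →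
      cderiv (fun y => (starRingEnd ℂ) (u y)) x Z = 0) :
    Z = 0 := by
  have h1 : (show EM from CTangent.re Z) = 0 := by
    rw [SeparatingDual.eq_zero_iff_forall_dual_eq_zero (R := ℂ)]
    intro g
    -- The test function is the conjugate of g composed with the chart. Since A is conjugate linear,
    -- A(JX) = -iA(X), and Z = X + iJX is sent to 2A(X).
    let A : EM →L[ℝ] ℂ := (Complex.conjCLE : ℂ →L[ℝ] ℂ) ∘L g.restrictScalars ℝ
    have h2 : cderiv (fun y => A (extChartAt 𝓘(ℂ, EM) x y)) x Z = 0 :=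
        h (fun y => g (extChartAt 𝓘(ℂ, EM) x y)) (by
      filter_upwards [eventually_contMDiffAt_extChartAt (EM := EM) x] with y hy
      exact ContMDiffAt.comp (I' := 𝓘(ℂ, EM)) y g.contMDiff.contMDiffAt hy)
    rw [cderiv_apply, mvfderiv_clm_comp A mdifferentiableAt_extChartAt_self,
      mvfderiv_clm_comp A mdifferentiableAt_extChartAt_self, mvfderiv_extChartAt_self,
      mvfderiv_extChartAt_self, (isAntiholVec_iff Z).1 hZ] at h2
    have h3 : A (tangentJ x (CTangent.re Z)) = -Complex.I • A (CTangent.re Z) := by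
      change (starRingEnd ℂ) (g (Complex.I • (show EM from CTangent.re Z))) =
        -Complex.I • (starRingEnd ℂ) (g (show EM from CTangent.re Z))
      rw [map_smul, smul_eq_mul, map_mul, Complex.conj_I, smul_eq_mul]
    rw [h3, smul_smul, mul_neg, Complex.I_mul_I, neg_neg, one_smul, ← two_smul ℂ] at h2
    have h4 : A (CTangent.re Z) = 0 := by simpa using h2
    have h5 : (starRingEnd ℂ) (g (show EM from CTangent.re Z)) = 0 := h4
    simpa using h5
  have h2 : CTangent.re Z = 0 := h1
  rw [CTangent.eq_re_add_im Z, (isAntiholVec_iff Z).1 hZ, h2, map_zero, TensorProduct.tmul_zero,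
    TensorProduct.tmul_zero, add_zero]

/-- A vector of type `(0, 1)` that kills all smooth functions vanishes. -/
theorem IsAntiholVec.eq_zero {Z : CTangent EM x} (hZ : IsAntiholVec Z)
    (h : ∀ u : M → ℂ, (∀ᶠ y in 𝓝 x, ContMDiffAt 𝓘(ℝ, EM) 𝓘(ℝ, ℂ) ∞ u y) → cderiv u x Z = 0) :
    Z = 0 :=
  hZ.eq_zero_of_conj fun _ hu => h _ (hu.mono fun y hy => ContMDiffAt.comp (I' := 𝓘(ℝ, ℂ)) y
    (Complex.conjCLE : ℂ →L[ℝ] ℂ).contMDiff.contMDiffAt hy.real_of_complex)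

/-! ### Complex vector fields -/

variable {Z Z' : Π x : M, CTangent EM x}

/-- The decomposition X + iY is unique, so the smooth fields X and Y provided by the definition are
the pointwise real and imaginary parts. -/
theorem complexFields_re_im (hZ : Z ∈ complexFields EM M) :
    ContMDiff 𝓘(ℝ, EM) 𝓘(ℝ, EM).tangent ∞
      (fun x => (⟨x, CTangent.re (Z x)⟩ : TangentBundle 𝓘(ℝ, EM) M)) ∧
    ContMDiff 𝓘(ℝ, EM) 𝓘(ℝ, EM).tangent ∞
      (fun x => (⟨x, CTangent.im (Z x)⟩ : TangentBundle 𝓘(ℝ, EM) M)) := by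
  obtain ⟨X, Y, hX, hY, h⟩ := hZ
  have h1 : ∀ x, CTangent.re (Z x) = X x := fun x => by
    rw [h, map_add, CTangent.re_tmul, CTangent.re_tmul]; simp
  have h2 : ∀ x, CTangent.im (Z x) = Y x := fun x => by
    rw [h, map_add, CTangent.im_tmul, CTangent.im_tmul]; simp
  simp only [h1, h2]
  exact ⟨hX, hY⟩

theorem contMDiffAt_cderiv_apply (hZ : Z ∈ complexFields EM M) {u : M → W}
    (hu : ContMDiffAt 𝓘(ℝ, EM) 𝓘(ℝ, W) ∞ u x) :
    ContMDiffAt 𝓘(ℝ, EM) 𝓘(ℝ, W) ∞ (fun y => cderiv u y (Z y)) x := by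
  obtain ⟨h1, h2⟩ := complexFields_re_im hZ
  have h3 : ContMDiffAt 𝓘(ℝ, EM) 𝓘(ℝ, W) ∞
      (fun y => Complex.I • mvfderiv 𝓘(ℝ, EM) u y (CTangent.im (Z y))) x :=
    ContMDiffAt.comp (I' := 𝓘(ℝ, W)) x
      ((Complex.I • ContinuousLinearMap.id ℂ W).restrictScalars ℝ).contMDiff.contMDiffAt
      (contMDiffAt_mvfderiv_apply hu (h2 x))
  exact ((contMDiffAt_mvfderiv_apply hu (h1 x)).add h3).congr_of_eventuallyEq
    (Filter.Eventually.of_forall fun y => cderiv_apply u y (Z y))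

/-- The commutator of complex vector fields. -/
theorem exists_commutator [FiniteDimensional ℂ EM] (hZ : Z ∈ complexFields EM M) (hZ' : Z' ∈ complexFields EM M) :
    ∃ B ∈ complexFields EM M, ∀ (x : M) (u : M → ℂ), ContMDiffAt 𝓘(ℝ, EM) 𝓘(ℝ, ℂ) ∞ u x →
      cderiv u x (B x) = cderiv (fun y => cderiv u y (Z' y)) x (Z x) -
        cderiv (fun y => cderiv u y (Z y)) x (Z' x) := by
  have h1 : IsManifold 𝓘(ℝ, EM) 1 M := IsManifold.of_le (n := ∞) (by simp)
  have : CompleteSpace EM := FiniteDimensional.complete ℂ EM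
  have h2 : IsManifold 𝓘(ℝ, EM) (minSmoothness ℝ 2) M := by
    rw [minSmoothness_of_isRCLikeNormedField]
    exact IsManifold.of_le (n := ∞) (WithTop.coe_le_coe.2 le_top)
  have : IsManifold 𝓘(ℝ, EM) (((⊤ : ℕ∞) : WithTop ℕ∞) + 1) M :=
    (inferInstance : IsManifold 𝓘(ℝ, EM) ∞ M)
  obtain ⟨hX, hY⟩ := complexFields_re_im hZ
  obtain ⟨hX', hY'⟩ := complexFields_re_im hZ'
  set X := fun x => CTangent.re (Z x) with eX
  set Y := fun x => CTangent.im (Z x) with eY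
  set X' := fun x => CTangent.re (Z' x) with eX'
  set Y' := fun x => CTangent.im (Z' x) with eY'
  have hb : ∀ {V V' : Π y : M, TangentSpace 𝓘(ℝ, EM) y},
      ContMDiff 𝓘(ℝ, EM) 𝓘(ℝ, EM).tangent ∞
        (fun x => (⟨x, V x⟩ : TangentBundle 𝓘(ℝ, EM) M)) →
      ContMDiff 𝓘(ℝ, EM) 𝓘(ℝ, EM).tangent ∞
        (fun x => (⟨x, V' x⟩ : TangentBundle 𝓘(ℝ, EM) M)) →
      ContMDiff 𝓘(ℝ, EM) 𝓘(ℝ, EM).tangent ∞ (fun x =>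
        (⟨x, VectorField.mlieBracket 𝓘(ℝ, EM) V V' x⟩ : TangentBundle 𝓘(ℝ, EM) M)) :=
    fun hV hV' x => ContMDiffAt.mlieBracket_vectorField (m := ⊤) (n := ⊤) (hV x) (hV' x)
      (by rw [minSmoothness_of_isRCLikeNormedField]; rfl)
  -- The bilinear expansion [X + iY, X' + iY'] = ([X,X'] - [Y,Y']) + i([X,Y'] + [Y,X']).
  refine ⟨fun x => (1 : ℂ) ⊗ₜ (VectorField.mlieBracket 𝓘(ℝ, EM) X X' x -
      VectorField.mlieBracket 𝓘(ℝ, EM) Y Y' x) +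
    Complex.I ⊗ₜ (VectorField.mlieBracket 𝓘(ℝ, EM) X Y' x +
      VectorField.mlieBracket 𝓘(ℝ, EM) Y X' x),
    ⟨_, _, (hb hX hX').sub_section (hb hY hY'), (hb hX hY').add_section (hb hY hX'),
      fun x => rfl⟩, fun x u hu => ?_⟩
  have hs : ∀ {V : Π y : M, TangentSpace 𝓘(ℝ, EM) y},
      ContMDiff 𝓘(ℝ, EM) 𝓘(ℝ, EM).tangent ∞
        (fun x => (⟨x, V x⟩ : TangentBundle 𝓘(ℝ, EM) M)) →
      MDifferentiableAt 𝓘(ℝ, EM) 𝓘(ℝ, ℂ) (fun y => mvfderiv 𝓘(ℝ, EM) u y (V y)) x :=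
    fun hV => (contMDiffAt_mvfderiv_apply hu (hV x)).mdifferentiableAt (by simp)
  let J : ℂ →L[ℝ] ℂ := (Complex.I • ContinuousLinearMap.id ℂ ℂ).restrictScalars ℝ
  have hsJ : ∀ {w : M → ℂ}, MDifferentiableAt 𝓘(ℝ, EM) 𝓘(ℝ, ℂ) w x →
      MDifferentiableAt 𝓘(ℝ, EM) 𝓘(ℝ, ℂ) (fun y => J (w y)) x := fun hw =>
    MDifferentiableAt.comp (I' := 𝓘(ℝ, ℂ)) x J.mdifferentiableAt hw
  have hd : ∀ {V V' : Π y : M, TangentSpace 𝓘(ℝ, EM) y},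
      ContMDiff 𝓘(ℝ, EM) 𝓘(ℝ, EM).tangent ∞
        (fun x => (⟨x, V x⟩ : TangentBundle 𝓘(ℝ, EM) M)) →
      ContMDiff 𝓘(ℝ, EM) 𝓘(ℝ, EM).tangent ∞
        (fun x => (⟨x, V' x⟩ : TangentBundle 𝓘(ℝ, EM) M)) → ∀ w,
      mvfderiv 𝓘(ℝ, EM) (fun y => mvfderiv 𝓘(ℝ, EM) u y (V y) +
        J (mvfderiv 𝓘(ℝ, EM) u y (V' y))) x w =
      mvfderiv 𝓘(ℝ, EM) (fun y => mvfderiv 𝓘(ℝ, EM) u y (V y)) x w +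
        Complex.I * mvfderiv 𝓘(ℝ, EM) (fun y => mvfderiv 𝓘(ℝ, EM) u y (V' y)) x w := by
    intro V V' hV hV' w
    refine (DFunLike.congr_fun (mvfderiv_add (hs hV) (hsJ (hs hV'))) w).trans ?_
    rw [add_apply, mvfderiv_clm_comp J (hs hV')]
    rfl
  have e1 : (fun y => cderiv u y (Z y)) = fun y => mvfderiv 𝓘(ℝ, EM) u y (X y) +
      J (mvfderiv 𝓘(ℝ, EM) u y (Y y)) := funext fun y => cderiv_apply u y (Z y)
  have e2 : (fun y => cderiv u y (Z' y)) = fun y => mvfderiv 𝓘(ℝ, EM) u y (X' y) +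
      J (mvfderiv 𝓘(ℝ, EM) u y (Y' y)) := funext fun y => cderiv_apply u y (Z' y)
  rw [e1, e2, cderiv_apply _ x (Z x), cderiv_apply _ x (Z' x), hd hX hY, hd hX hY, hd hX' hY',
    hd hX' hY', map_add, cderiv_tmul, cderiv_tmul, map_sub, map_add, mvfderiv_mlieBracket hu (hX x)
    (hX' x), mvfderiv_mlieBracket hu (hY x) (hY' x), mvfderiv_mlieBracket hu (hX x) (hY' x),
    mvfderiv_mlieBracket hu (hY x) (hX' x)]
  simp only [smul_eq_mul]
  -- Only the terms with both Y and Y' carry i², which has to become the sign of [Y,Y'].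
  linear_combination (mvfderiv 𝓘(ℝ, EM) (fun y => mvfderiv 𝓘(ℝ, EM) u y (CTangent.im (Z y))) x
    (CTangent.im (Z' x)) - mvfderiv 𝓘(ℝ, EM) (fun y => mvfderiv 𝓘(ℝ, EM) u y (CTangent.im (Z' y))) x
    (CTangent.im (Z x))) * Complex.I_mul_I

end

/-! ### Smooth functions with complex linear derivatives are holomorphic -/

section
variable [FiniteDimensional ℂ EM]

theorem exists_restrictScalars_eq {V W : Type*} [NormedAddCommGroup V] [NormedSpace ℂ V]
    [NormedAddCommGroup W] [NormedSpace ℂ W] (A : V →L[ℝ] W)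
    (h : ∀ v, A (Complex.I • v) = Complex.I • A v) :
    ∃ A' : V →L[ℂ] W, A'.restrictScalars ℝ = A := by
  refine ⟨⟨⟨⟨A, A.map_add⟩, fun c v => ?_⟩, A.cont⟩, rfl⟩
  change A (c • v) = c • A v
  conv_lhs => rw [← Complex.re_add_im c]
  conv_rhs => rw [← Complex.re_add_im c]
  rw [add_smul, add_smul, map_add, mul_smul, mul_smul, Complex.coe_smul, Complex.coe_smul,
    Complex.coe_smul, Complex.coe_smul, map_smul, map_smul, h]

/-- Induction on the order: each directional derivative z ↦ Dg(z)y is again smooth over ℝ and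
complex differentiable. Indeed D²g is complex linear in its second argument, because every Dg(z) is
complex linear, and hence by symmetry also in its first. -/
theorem ContDiffOn.complex_of_real {V : Type*} [NormedAddCommGroup V] [NormedSpace ℂ V]
    [FiniteDimensional ℂ V] {O : Set V} (hO : IsOpen O) {g : V → W}
    (hg : ContDiffOn ℝ ∞ g O) (hd : DifferentiableOn ℂ g O) : ContDiffOn ℂ ∞ g O := by
  rw [contDiffOn_infty]
  intro n
  induction n generalizing g with
  | zero => exact contDiffOn_zero.2 hg.continuousOn
  | succ n ih =>
    rw [Nat.cast_succ, contDiffOn_succ_iff_fderiv_of_isOpen hO]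
    refine ⟨hd, by simp, contDiffOn_clm_apply.2 fun y => ?_⟩
    have heq : ∀ x ∈ O, fderiv ℝ g x = (fderiv ℂ g x).restrictScalars ℝ := fun x hx =>
      (hd.differentiableAt (hO.mem_nhds hx)).fderiv_restrictScalars ℝ
    have h1 : ContDiffOn ℝ ∞ (fderiv ℝ g) O := hg.fderiv_of_isOpen hO (by simp)
    refine ih ?_ fun x hx => ?_
    · exact (h1.clm_apply contDiffOn_const).congr fun x hx => (DFunLike.congr_fun (heq x hx) y).symm
    · have hD : HasFDerivAt (fderiv ℝ g) (fderiv ℝ (fderiv ℝ g) x) x :=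
        (((h1 x hx).contDiffAt (hO.mem_nhds hx)).differentiableAt (by simp)).hasFDerivAt
      have hy : ∀ w, HasFDerivAt (fun z => fderiv ℝ g z w)
          ((ContinuousLinearMap.apply ℝ W w) ∘L (fderiv ℝ (fderiv ℝ g) x)) x := fun w =>
        ((ContinuousLinearMap.apply ℝ W w).hasFDerivAt).comp x hD
      have hsymm := second_derivative_symmetric_of_eventually_of_real (f := g)
        (f' := fderiv ℝ g) (x := x) (by
          filter_upwards [hO.mem_nhds hx] with z hz
          exact ((hd.differentiableAt (hO.mem_nhds hz)).restrictScalars ℝ).hasFDerivAt) hD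
      -- Differentiate the identity Dg(z)(iw) = i Dg(z)w, valid for z near x.
      have hlin : ∀ v w, fderiv ℝ (fderiv ℝ g) x v (Complex.I • w) =
          Complex.I • fderiv ℝ (fderiv ℝ g) x v w := by
        intro v w
        let J : W →L[ℝ] W := (Complex.I • ContinuousLinearMap.id ℂ W).restrictScalars ℝ
        have h2 : HasFDerivAt (fun z => fderiv ℝ g z (Complex.I • w))
            (J ∘L ((ContinuousLinearMap.apply ℝ W w) ∘L (fderiv ℝ (fderiv ℝ g) x))) x := by
          refine (J.hasFDerivAt.comp x (hy w)).congr_of_eventuallyEq ?_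
          filter_upwards [hO.mem_nhds hx] with z hz
          rw [Function.comp_apply, heq z hz]
          exact (fderiv ℂ g z).map_smul _ _
        exact DFunLike.congr_fun ((hy (Complex.I • w)).unique h2) v
      obtain ⟨A, hA⟩ := exists_restrictScalars_eq
        ((ContinuousLinearMap.apply ℝ W y) ∘L (fderiv ℝ (fderiv ℝ g) x)) (fun v => by
          change fderiv ℝ (fderiv ℝ g) x (Complex.I • v) y =
            Complex.I • fderiv ℝ (fderiv ℝ g) x v y
          rw [hsymm, hlin, hsymm])
      have h3 : HasFDerivAt (fun z => fderiv ℝ g z y) A x :=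
        hasFDerivAt_of_restrictScalars ℝ (hy y) hA
      refine (h3.congr_of_eventuallyEq ?_).differentiableAt.differentiableWithinAt
      filter_upwards [hO.mem_nhds hx] with z hz
      rw [heq z hz]
      rfl

/-- A smooth function killed by all vectors of type `(0, 1)` is holomorphic. -/
theorem contMDiffAt_complex_of_cderiv [IsManifold 𝓘(ℂ, EM) ∞ M] {u : M → W} {x : M}
    (h : ∀ᶠ y in 𝓝 x, ContMDiffAt 𝓘(ℝ, EM) 𝓘(ℝ, W) ∞ u y ∧
      ∀ Z : CTangent EM y, IsAntiholVec Z → cderiv u y Z = 0) :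
    ContMDiffAt 𝓘(ℂ, EM) 𝓘(ℂ, W) ∞ u x := by
  have hM : IsManifold 𝓘(ℂ, EM) 1 M := IsManifold.of_le (n := ∞) (by simp)
  have hdiff : ∀ᶠ y in 𝓝 x, MDifferentiableAt 𝓘(ℂ, EM) 𝓘(ℂ, W) u y := by
    filter_upwards [h] with y ⟨hy, hZ⟩
    have hm := hy.mdifferentiableAt (n := ∞) (by simp)
    refine ⟨hy.continuousAt.continuousWithinAt, ?_⟩
    have h1 := hm.differentiableAt_comp_extChartAt_symm
    have h2 : ∀ v : TangentSpace 𝓘(ℝ, EM) y, mvfderiv 𝓘(ℝ, EM) u y (tangentJ y v) =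
        Complex.I • mvfderiv 𝓘(ℝ, EM) u y v := by
      intro v
      -- Evaluated on v + iJv, which is of type (0,1), the hypothesis is the Cauchy-Riemann equation
      -- for v.
      have h3 := hZ ((1 : ℂ) ⊗ₜ v + Complex.I ⊗ₜ tangentJ y v) (by
        rw [isAntiholVec_iff, map_add, map_add]
        simp [CTangent.re_tmul, CTangent.im_tmul])
      rw [map_add, cderiv_tmul, cderiv_tmul, one_smul] at h3
      rw [eq_neg_of_add_eq_zero_left h3, smul_neg, smul_smul, Complex.I_mul_I, neg_one_smul,
        neg_neg]
    rw [mvfderiv_eq_fderiv hm] at h2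
    have h3 := (differentiableAt_iff_restrictScalars ℝ (𝕜' := ℂ) h1).2
      (exists_restrictScalars_eq _ h2)
    exact h3.differentiableWithinAt
  have hx := mem_extChartAt_source (I := 𝓘(ℂ, EM)) x
  set φ := extChartAt 𝓘(ℂ, EM) x with hφ
  have hcont : ContinuousOn φ.symm φ.target := continuousOn_extChartAt_symm x
  obtain ⟨N, hN, hNo, hxN⟩ := eventually_nhds_iff.1 (hdiff.and h)
  let O : Set EM := φ.target ∩ φ.symm ⁻¹' N
  have hO : IsOpen O := hcont.isOpen_inter_preimage (isOpen_extChartAt_target x) hNo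
  have hxO : φ x ∈ O := ⟨φ.map_source hx, by
    change φ.symm (φ x) ∈ N
    rwa [φ.left_inv hx]⟩
  have hφs : ∀ p ∈ O, ContMDiffAt 𝓘(ℂ, EM) 𝓘(ℂ, EM) ∞ φ.symm p := fun p hp =>
    (contMDiffOn_extChartAt_symm (n := ∞) x).contMDiffAt
      ((isOpen_extChartAt_target (I := 𝓘(ℂ, EM)) x).mem_nhds hp.1)
  have hg : ContDiffOn ℝ ∞ (u ∘ φ.symm) O := fun p hp =>
    (ContMDiffAt.comp (I' := 𝓘(ℝ, EM)) p (hN _ hp.2).2.1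
      (hφs p hp).real_of_complex).contDiffAt.contDiffWithinAt
  have hgd : DifferentiableOn ℂ (u ∘ φ.symm) O := fun p hp =>
    (MDifferentiableAt.comp (I' := 𝓘(ℂ, EM)) p (hN _ hp.2).1
      ((hφs p hp).mdifferentiableAt (by simp))).differentiableAt.differentiableWithinAt
  rw [contMDiffAt_iff]
  refine ⟨h.self_of_nhds.1.continuousAt, ?_⟩
  exact ((hg.complex_of_real hO hgd).contDiffAt (hO.mem_nhds hxO)).contDiffWithinAt

end

end

/-! ### Smooth and holomorphic sections in local holomorphic frames. -/

noncomputable section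

variable {EM : Type*} [NormedAddCommGroup EM] [NormedSpace ℂ EM]
  {M : Type*} [TopologicalSpace M] [ChartedSpace EM M]

section Coordinates

variable {𝕜 : Type*} [NontriviallyNormedField 𝕜] [NormedAlgebra 𝕜 ℂ] [NormedSpace 𝕜 EM]
  {F : Type*} [NormedAddCommGroup F] [NormedSpace ℂ F] [FiniteDimensional ℂ F]
  [NormedSpace 𝕜 F] [IsScalarTower 𝕜 ℂ F]

theorem contMDiffAt_iff_coord {u : M → F} {x : M} :
    ContMDiffAt 𝓘(𝕜, EM) 𝓘(𝕜, F) ∞ u x ↔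
      ∀ i, ContMDiffAt 𝓘(𝕜, EM) 𝓘(𝕜, ℂ) ∞ (fun y => (Module.finBasis ℂ F).coord i (u y)) x := by
  constructor
  · intro h i
    let A : F →L[ℂ] ℂ := LinearMap.toContinuousLinearMap ((Module.finBasis ℂ F).coord i)
    exact ContMDiffAt.comp (I' := 𝓘(𝕜, F)) x (A.restrictScalars 𝕜).contMDiff.contMDiffAt h
  · intro h
    have h1 : ∀ i, ContMDiffAt 𝓘(𝕜, EM) 𝓘(𝕜, F) ∞
        (fun y => (Module.finBasis ℂ F).coord i (u y) • Module.finBasis ℂ F i) x := fun i =>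
      ContMDiffAt.comp (I' := 𝓘(𝕜, ℂ)) x (((ContinuousLinearMap.id ℂ ℂ).smulRight
        (Module.finBasis ℂ F i)).restrictScalars 𝕜).contMDiff.contMDiffAt (h i)
    have h2 := contMDiffAt_finsetSum (t := Finset.univ) (fun i _ => h1 i)
    refine h2.congr_of_eventuallyEq (Filter.Eventually.of_forall fun y => ?_)
    exact ((Module.finBasis ℂ F).sum_repr (u y)).symm

theorem ContMDiffAt.mul_complex {u v : M → ℂ} {x : M}
    (hu : ContMDiffAt 𝓘(𝕜, EM) 𝓘(𝕜, ℂ) ∞ u x) (hv : ContMDiffAt 𝓘(𝕜, EM) 𝓘(𝕜, ℂ) ∞ v x) :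
    ContMDiffAt 𝓘(𝕜, EM) 𝓘(𝕜, ℂ) ∞ (fun y => u y * v y) x :=
  ContMDiffAt.comp x (contDiff_mul (𝕜 := 𝕜) (𝔸 := ℂ)).contMDiff.contMDiffAt (hu.prodMk_space hv)

end Coordinates

section Bundle

variable {F : Type*} [NormedAddCommGroup F] [NormedSpace ℂ F]
  {E : M → Type*} [TopologicalSpace (TotalSpace F E)] [∀ x, AddCommGroup (E x)]
  [∀ x, Module ℂ (E x)] [∀ x, TopologicalSpace (E x)] [FiberBundle F E] [VectorBundle ℂ F E]
  {U V : Opens M}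

variable (EM F) in
/-- Smoothness of a section at a point. -/
def SmoothSecAt (s : Π x, E x) (x : M) : Prop :=
  ContMDiffAt 𝓘(ℝ, EM) (𝓘(ℝ, EM).prod 𝓘(ℝ, F)) ∞ (fun y => TotalSpace.mk' F y (s y)) x

variable (EM F) in
/-- Holomorphy of a section at a point. -/
def HolSecAt (s : Π x, E x) (x : M) : Prop :=
  ContMDiffAt 𝓘(ℂ, EM) (𝓘(ℂ, EM).prod 𝓘(ℂ, F)) ∞ (fun y => TotalSpace.mk' F y (s y)) x

theorem SmoothSecAt.congr {s t : Π x, E x} {x : M} (hs : SmoothSecAt EM F s x)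
    (h : ∀ᶠ y in 𝓝 x, t y = s y) : SmoothSecAt EM F t x := by
  refine ContMDiffAt.congr_of_eventuallyEq (f := fun y => TotalSpace.mk' F y (s y)) hs ?_
  filter_upwards [h] with y hy
  rw [hy]

theorem HolSecAt.congr {s t : Π x, E x} {x : M} (hs : HolSecAt EM F s x)
    (h : ∀ᶠ y in 𝓝 x, t y = s y) : HolSecAt EM F t x := by
  refine ContMDiffAt.congr_of_eventuallyEq (f := fun y => TotalSpace.mk' F y (s y)) hs ?_
  filter_upwards [h] with y hy
  rw [hy]

/-- Extension by zero of a holomorphic section. -/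
def HolSec.ext (s : HolSec EM F E U) (x : M) : E x :=
  open scoped Classical in if h : x ∈ U then s.1 ⟨x, h⟩ else 0

theorem HolSec.ext_apply (s : HolSec EM F E U) {x : M} (hx : x ∈ U) : s.ext x = s.1 ⟨x, hx⟩ :=
  dif_pos hx

theorem HolSec.holSecAt_ext (s : HolSec EM F E U) {x : M} (hx : x ∈ U) :
    HolSecAt EM F s.ext x := by
  refine (contMDiffAt_subtype_iff (U := U) (x := ⟨x, hx⟩)).1 ?_
  refine (s.2 ⟨x, hx⟩).congr_of_eventuallyEq (Filter.Eventually.of_forall fun y => ?_)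
  dsimp only
  rw [s.ext_apply y.2]

/-- A section that is holomorphic at all points of an open set. -/
def HolSec.of (s : Π x, E x) (h : ∀ x ∈ U, HolSecAt EM F s x) : HolSec EM F E U :=
  ⟨fun x => s x, fun x => (contMDiffAt_subtype_iff (U := U) (x := x)).2 (h x x.2)⟩

/-- A function that is holomorphic at all points of an open set. -/
def HolFun.of (u : M → ℂ) (h : ∀ x ∈ U, ContMDiffAt 𝓘(ℂ, EM) 𝓘(ℂ, ℂ) ∞ u x) : HolFun EM U :=
  ⟨fun x => u x, fun x => (contMDiffAt_subtype_iff (U := U) (x := x)).2 (h x x.2)⟩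

theorem HolSec.eq_of_forall {s t : HolSec EM F E U} (h : ∀ x, s.1 x = t.1 x) : s = t :=
  Subtype.ext (funext h)

theorem SmoothSec.eq_of_forall {s t : SmoothSec EM F E} (h : ∀ x, s.1 x = t.1 x) : s = t :=
  Subtype.ext (funext h)

theorem SmoothFun.eq_of_forall {s t : SmoothFun EM M} (h : ∀ x, s.1 x = t.1 x) : s = t :=
  Subtype.ext (funext h)

theorem HolFun.eq_of_forall {s t : HolFun EM U} (h : ∀ x, s.1 x = t.1 x) : s = t :=
  Subtype.ext (funext h)

theorem SmoothSec.smoothSecAt (s : SmoothSec EM F E) (x : M) : SmoothSecAt EM F s.1 x := s.2 x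

def SmoothSec.of (s : Π x, E x) (h : ∀ x, SmoothSecAt EM F s x) : SmoothSec EM F E := ⟨s, h⟩

def SmoothFun.of (u : M → ℂ) (h : ∀ x, ContMDiffAt 𝓘(ℝ, EM) 𝓘(ℝ, ℂ) ∞ u x) : SmoothFun EM M :=
  ⟨u, h⟩

section values
variable (s t : SmoothSec EM F E) (f g : SmoothFun EM M) (c : ℂ) (x : M)
theorem SmoothSec.add_apply : (s + t).1 x = s.1 x + t.1 x := rfl
theorem SmoothSec.sub_apply : (s - t).1 x = s.1 x - t.1 x := rfl
theorem SmoothSec.neg_apply : (-s).1 x = -s.1 x := rfl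
theorem SmoothSec.zero_apply : (0 : SmoothSec EM F E).1 x = 0 := rfl
theorem SmoothSec.smul_apply : (f • s).1 x = f.1 x • s.1 x := rfl
theorem SmoothSec.smul_complex_apply : (c • s).1 x = c • s.1 x := rfl
theorem SmoothFun.mul_apply : (f * g).1 x = f.1 x * g.1 x := rfl
theorem SmoothFun.zero_apply : (0 : SmoothFun EM M).1 x = 0 := rfl
end values

section values
variable (s t : HolSec EM F E U) (f g : HolFun EM U) (c : ℂ) (x : U)
theorem HolSec.add_apply : (s + t).1 x = s.1 x + t.1 x := rfl
theorem HolSec.sub_apply : (s - t).1 x = s.1 x - t.1 x := rfl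
theorem HolSec.smul_apply : (f • s).1 x = f.1 x • s.1 x := rfl
end values

def SmoothSec.eval (x : M) : SmoothSec EM F E →+ E x where
  toFun s := s.1 x
  map_zero' := rfl
  map_add' _ _ := rfl

def HolSec.eval (x : U) : HolSec EM F E U →+ E x where
  toFun s := s.1 x
  map_zero' := rfl
  map_add' _ _ := rfl

theorem SmoothSec.sum_apply {ι : Type*} (S : Finset ι) (s : ι → SmoothSec EM F E) (x : M) :
    (∑ i ∈ S, s i).1 x = ∑ i ∈ S, (s i).1 x := map_sum (SmoothSec.eval x) s S

theorem HolSec.sum_apply {ι : Type*} (S : Finset ι) (s : ι → HolSec EM F E U) (x : U) :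
    (∑ i ∈ S, s i).1 x = ∑ i ∈ S, (s i).1 x := map_sum (HolSec.eval x) s S

variable [FiniteDimensional ℂ F]

variable (F) in
/-- The components of a vector in the local frame around `x₀`. -/
def co (x₀ : M) (i : Fin (Module.finrank ℂ F)) (y : M) : E y →ₗ[ℂ] ℂ :=
  (Module.finBasis ℂ F).coord i ∘ₗ (trivializationAt F E x₀).linearMapAt ℂ y

variable (F E) in
/-- The local frame around `x₀`. -/
def fr (x₀ : M) (i : Fin (Module.finrank ℂ F)) (y : M) : E y :=
  (trivializationAt F E x₀).symmₗ ℂ y (Module.finBasis ℂ F i)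

variable (F E) in
/-- The open set on which the local frame around `x₀` is defined. -/
def frSet (x₀ : M) : Opens M :=
  ⟨(trivializationAt F E x₀).baseSet, (trivializationAt F E x₀).open_baseSet⟩

theorem mem_frSet (x₀ : M) : x₀ ∈ frSet F E x₀ := mem_baseSet_trivializationAt F E x₀

variable {x₀ y : M}

theorem co_eq (hy : y ∈ frSet F E x₀) (i) (v : E y) :
    co F x₀ i y v = (Module.finBasis ℂ F).coord i (trivializationAt F E x₀ ⟨y, v⟩).2 := by
  have hy' : y ∈ (trivializationAt F E x₀).baseSet := hy
  rw [co, LinearMap.comp_apply, Trivialization.coe_linearMapAt_of_mem _ hy']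

theorem symm_co (w : F) :
    (trivializationAt F E x₀).symmₗ ℂ y w =
      ∑ i, (Module.finBasis ℂ F).coord i w • fr F E x₀ i y := by
  conv_lhs => rw [← (Module.finBasis ℂ F).sum_repr w]
  rw [map_sum]
  simp only [map_smul]
  rfl

theorem sum_co_smul_fr (hy : y ∈ frSet F E x₀) (v : E y) :
    ∑ i, co F x₀ i y v • fr F E x₀ i y = v := by
  have hy' : y ∈ (trivializationAt F E x₀).baseSet := hy
  have h := symm_co (E := E) (x₀ := x₀) (y := y) ((trivializationAt F E x₀).linearMapAt ℂ y v)
  rw [Trivialization.symmₗ_linearMapAt _ hy'] at h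
  exact h.symm

theorem co_fr (hy : y ∈ frSet F E x₀) (i j) :
    co F x₀ i y (fr F E x₀ j y) = if j = i then 1 else 0 := by
  have hy' : y ∈ (trivializationAt F E x₀).baseSet := hy
  rw [co, fr, LinearMap.comp_apply, Trivialization.linearMapAt_symmₗ _ hy', Module.Basis.coord_apply,
    Module.Basis.repr_self_apply]

variable [ContMDiffVectorBundle ∞ F E 𝓘(ℂ, EM)]

theorem holSecAt_iff {s : Π x, E x} (hy : y ∈ frSet F E x₀) :
    HolSecAt EM F s y ↔
      ∀ i, ContMDiffAt 𝓘(ℂ, EM) 𝓘(ℂ, ℂ) ∞ (fun z => co F x₀ i z (s z)) y := by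
  have h := Trivialization.contMDiffAt_section_iff (IB := 𝓘(ℂ, EM)) (n := ∞) (s := s)
    (trivializationAt F E x₀) hy
  refine h.trans (contMDiffAt_iff_coord.trans (forall_congr' fun i => ?_))
  refine Filter.EventuallyEq.contMDiffAt_iff ?_
  filter_upwards [(frSet F E x₀).isOpen.mem_nhds hy] with z hz
  exact (co_eq hz i (s z)).symm

theorem holSecAt_fr (hy : y ∈ frSet F E x₀) (i) : HolSecAt EM F (fr F E x₀ i) y := by
  rw [holSecAt_iff hy]
  intro j
  refine (contMDiffAt_const (c := if i = j then (1 : ℂ) else 0)).congr_of_eventuallyEq ?_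
  filter_upwards [(frSet F E x₀).isOpen.mem_nhds hy] with z hz
  exact co_fr hz j i

theorem smoothSecAt_iff_self {s : Π x, E x} :
    SmoothSecAt EM F s y ↔
      ∀ i, ContMDiffAt 𝓘(ℝ, EM) 𝓘(ℝ, ℂ) ∞ (fun z => co F y i z (s z)) y := by
  have h := contMDiffAt_along_iff (𝕜 := ℝ) (F := F) (E := E) (g := id) (s := s)
    (contMDiff_id (I := 𝓘(ℝ, EM)) (M := M) (n := ∞)) y
  refine h.trans (contMDiffAt_iff_coord.trans (forall_congr' fun i => ?_))
  refine Filter.EventuallyEq.contMDiffAt_iff ?_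
  filter_upwards [(frSet F E y).isOpen.mem_nhds (mem_frSet y)] with z hz
  exact (co_eq hz i (s z)).symm

-- Smoothness of a section at y is defined through the trivialization centred at y. Other frames may
-- be used because the components of one holomorphic frame in another are holomorphic, and in
-- particular smooth over ℝ.
variable (F) in
theorem contMDiffAt_co_change {s : Π x, E x} {x₀ x₁ : M} (h₀ : y ∈ frSet F E x₀)
    (h₁ : y ∈ frSet F E x₁)
    (hs : ∀ i, ContMDiffAt 𝓘(ℝ, EM) 𝓘(ℝ, ℂ) ∞ (fun z => co F x₀ i z (s z)) y) (i) :
    ContMDiffAt 𝓘(ℝ, EM) 𝓘(ℝ, ℂ) ∞ (fun z => co F x₁ i z (s z)) y := by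
  have h : ∀ j, ContMDiffAt 𝓘(ℝ, EM) 𝓘(ℝ, ℂ) ∞
      (fun z => co F x₀ j z (s z) * co F x₁ i z (fr F E x₀ j z)) y := fun j =>
    (hs j).mul_complex ((holSecAt_iff h₁).1 (holSecAt_fr h₀ j) i).real_of_complex
  refine (contMDiffAt_finsetSum (t := Finset.univ) (fun j _ => h j)).congr_of_eventuallyEq ?_
  filter_upwards [(frSet F E x₀).isOpen.mem_nhds h₀] with z hz
  conv_lhs => rw [← sum_co_smul_fr hz (s z)]
  rw [map_sum]
  simp only [map_smul, smul_eq_mul]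

theorem smoothSecAt_iff {s : Π x, E x} (hy : y ∈ frSet F E x₀) :
    SmoothSecAt EM F s y ↔
      ∀ i, ContMDiffAt 𝓘(ℝ, EM) 𝓘(ℝ, ℂ) ∞ (fun z => co F x₀ i z (s z)) y :=
  smoothSecAt_iff_self.trans
    ⟨contMDiffAt_co_change F (mem_frSet y) hy, contMDiffAt_co_change F hy (mem_frSet y)⟩

theorem HolSecAt.smoothSecAt {s : Π x, E x} (hs : HolSecAt EM F s y) : SmoothSecAt EM F s y :=
  smoothSecAt_iff_self.2 fun i => ((holSecAt_iff (mem_frSet y)).1 hs i).real_of_complex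

theorem SmoothSecAt.smul {s : Π x, E x} {f : M → ℂ} (hf : ContMDiffAt 𝓘(ℝ, EM) 𝓘(ℝ, ℂ) ∞ f y)
    (hs : SmoothSecAt EM F s y) : SmoothSecAt EM F (fun z => f z • s z) y := by
  rw [smoothSecAt_iff_self] at hs ⊢
  simp only [map_smul, smul_eq_mul]
  exact fun i => hf.mul_complex (hs i)

theorem HolSecAt.smul {s : Π x, E x} {f : M → ℂ} (hf : ContMDiffAt 𝓘(ℂ, EM) 𝓘(ℂ, ℂ) ∞ f y)
    (hs : HolSecAt EM F s y) : HolSecAt EM F (fun z => f z • s z) y := by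
  rw [holSecAt_iff (mem_frSet y)] at hs ⊢
  simp only [map_smul, smul_eq_mul]
  exact fun i => hf.mul_complex (hs i)

theorem SmoothSecAt.add {s t : Π x, E x} (hs : SmoothSecAt EM F s y)
    (ht : SmoothSecAt EM F t y) : SmoothSecAt EM F (fun z => s z + t z) y := by
  rw [smoothSecAt_iff_self] at hs ht ⊢
  simp only [map_add]
  exact fun i => (hs i).add (ht i)

theorem SmoothSecAt.sum {ι : Type*} {S : Finset ι} {s : ι → Π x, E x}
    (hs : ∀ i ∈ S, SmoothSecAt EM F (s i) y) : SmoothSecAt EM F (fun z => ∑ i ∈ S, s i z) y := by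
  simp only [smoothSecAt_iff_self] at hs ⊢
  simp only [map_sum]
  exact fun j => contMDiffAt_finsetSum fun i hi => hs i hi j

theorem HolSecAt.sum {ι : Type*} {S : Finset ι} {s : ι → Π x, E x}
    (hs : ∀ i ∈ S, HolSecAt EM F (s i) y) : HolSecAt EM F (fun z => ∑ i ∈ S, s i z) y := by
  simp only [holSecAt_iff (mem_frSet y)] at hs ⊢
  simp only [map_sum]
  exact fun j => contMDiffAt_finsetSum fun i hi => hs i hi j

theorem SmoothSecAt.zero : SmoothSecAt EM F (fun z => (0 : E z)) y := by
  rw [smoothSecAt_iff_self]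
  simp only [map_zero]
  exact fun _ => contMDiffAt_const

end Bundle
end

noncomputable section

variable {EM : Type*} [NormedAddCommGroup EM] [NormedSpace ℂ EM]
  {M : Type*} [TopologicalSpace M] [ChartedSpace EM M]

/-! ### Bump functions -/

theorem exists_real_bump [FiniteDimensional ℂ EM] [T2Space M] [IsManifold 𝓘(ℂ, EM) ∞ M] {x : M}
    {U : Set M} (hU : U ∈ 𝓝 x) : ∃ f : M → ℝ, ContMDiff 𝓘(ℝ, EM) 𝓘(ℝ, ℝ) ∞ f ∧ (∀ y, 0 ≤ f y) ∧
      (∀ᶠ y in 𝓝 x, f y = 1) ∧ tsupport f ⊆ U := by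
  have : FiniteDimensional ℝ EM := FiniteDimensional.complexToReal EM
  obtain ⟨f, -, hf⟩ := (SmoothBumpFunction.nhds_basis_tsupport (I := 𝓘(ℝ, EM)) x).mem_iff.1 hU
  exact ⟨f, f.contMDiff, fun y => f.nonneg, f.eventuallyEq_one, hf⟩

theorem contMDiffAt_ofReal {f : M → ℝ} {x : M} (hf : ContMDiffAt 𝓘(ℝ, EM) 𝓘(ℝ, ℝ) ∞ f x) :
    ContMDiffAt 𝓘(ℝ, EM) 𝓘(ℝ, ℂ) ∞ (fun y => (f y : ℂ)) x :=
  ContMDiffAt.comp (I' := 𝓘(ℝ, ℝ)) x Complex.ofRealCLM.contMDiff.contMDiffAt hf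

theorem exists_bump [FiniteDimensional ℂ EM] [T2Space M] [IsManifold 𝓘(ℂ, EM) ∞ M] {x : M}
    {U : Set M} (hU : U ∈ 𝓝 x) : ∃ χ : SmoothFun EM M,
      (∀ᶠ y in 𝓝 x, χ.1 y = 1) ∧ tsupport χ.1 ⊆ U := by
  obtain ⟨f, hf, -, h1, hs⟩ := exists_real_bump (EM := EM) hU
  refine ⟨⟨fun y => (f y : ℂ), fun y => contMDiffAt_ofReal (hf y)⟩, ?_, ?_⟩
  · filter_upwards [h1] with y hy
    rw [hy, Complex.ofReal_one]
  · refine Set.Subset.trans (closure_mono fun y hy => ?_) hs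
    intro h
    refine hy ?_
    change ((f y : ℝ) : ℂ) = 0
    rw [h, Complex.ofReal_zero]

theorem exists_opens_of_eventually {P : M → Prop} {x : M} (h : ∀ᶠ y in 𝓝 x, P y) :
    ∃ U : Opens M, x ∈ U ∧ ∀ y ∈ U, P y := by
  obtain ⟨U, hU, hUo, hx⟩ := eventually_nhds_iff.1 h
  exact ⟨⟨U, hUo⟩, hx, hU⟩

section Bundle

variable {F : Type*} [NormedAddCommGroup F] [NormedSpace ℂ F]
  {E : M → Type*} [TopologicalSpace (TotalSpace F E)] [∀ x, AddCommGroup (E x)]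
  [∀ x, Module ℂ (E x)] [∀ x, TopologicalSpace (E x)] [FiberBundle F E] [VectorBundle ℂ F E]
  {U V : Opens M} [FiniteDimensional ℂ F]

theorem SmoothFun.exists_extension [FiniteDimensional ℂ EM] [T2Space M]
    [IsManifold 𝓘(ℂ, EM) ∞ M] {u : M → ℂ} {x : M}
    (hu : ∀ᶠ y in 𝓝 x, ContMDiffAt 𝓘(ℝ, EM) 𝓘(ℝ, ℂ) ∞ u y) :
    ∃ f : SmoothFun EM M, ∀ᶠ y in 𝓝 x, f.1 y = u y := by
  obtain ⟨χ, h1, hχ⟩ := exists_bump (EM := EM) hu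
  refine ⟨SmoothFun.of (fun y => χ.1 y * u y) fun y => ?_, ?_⟩
  · by_cases hy : y ∈ tsupport χ.1
    · exact (χ.2 y).mul_complex (hχ hy)
    · refine (contMDiffAt_const (c := (0 : ℂ))).congr_of_eventuallyEq ?_
      filter_upwards [(isClosed_tsupport χ.1).isOpen_compl.mem_nhds hy] with z hz
      rw [image_eq_zero_of_notMem_tsupport hz, zero_mul]
  · filter_upwards [h1] with y hy
    change χ.1 y * u y = u y
    rw [hy, one_mul]

variable [ContMDiffVectorBundle ∞ F E 𝓘(ℂ, EM)]

theorem SmoothSecAt.cut {s : Π x, E x} {χ : SmoothFun EM M}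
    (h : ∀ y ∈ tsupport χ.1, SmoothSecAt EM F s y) (y : M) :
    SmoothSecAt EM F (fun y => χ.1 y • s y) y := by
  by_cases hy : y ∈ tsupport χ.1
  · exact SmoothSecAt.smul (χ.2 y) (h y hy)
  · refine SmoothSecAt.zero.congr ?_
    filter_upwards [(isClosed_tsupport χ.1).isOpen_compl.mem_nhds hy] with z hz
    rw [image_eq_zero_of_notMem_tsupport hz, zero_smul]

theorem SmoothSec.exists_extension [FiniteDimensional ℂ EM] [T2Space M]
    [IsManifold 𝓘(ℂ, EM) ∞ M] {s : Π x, E x} {x : M}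
    (hs : ∀ᶠ y in 𝓝 x, SmoothSecAt EM F s y) :
    ∃ t : SmoothSec EM F E, ∀ᶠ y in 𝓝 x, t.1 y = s y := by
  obtain ⟨χ, h1, hχ⟩ := exists_bump (EM := EM) hs
  refine ⟨SmoothSec.of (fun y => χ.1 y • s y) (SmoothSecAt.cut hχ), ?_⟩
  filter_upwards [h1] with y hy
  change χ.1 y • s y = s y
  rw [hy, one_smul]

/-- Holomorphy of a smooth section near a point. -/
def IsHolNear (s : SmoothSec EM F E) (x : M) : Prop := ∀ᶠ y in 𝓝 x, HolSecAt EM F s.1 y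

theorem IsHolNear.zero {x : M} : IsHolNear (0 : SmoothSec EM F E) x :=
  Filter.Eventually.of_forall fun y => (holSecAt_iff (mem_frSet y)).2 fun i => by
    simp only [SmoothSec.zero_apply, map_zero]
    exact contMDiffAt_const

/-- The algebraic structures live on global smooth sections. A bump function equal to 1 near x turns
the germ of a local holomorphic section into such a section. -/
theorem HolSec.exists_extension [FiniteDimensional ℂ EM] [T2Space M]
    [IsManifold 𝓘(ℂ, EM) ∞ M] (s : HolSec EM F E U) {x : M} (hx : x ∈ U) :
    ∃ t : SmoothSec EM F E, IsHolNear t x ∧ ∀ᶠ y in 𝓝 x, t.1 y = s.ext y := by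
  have h : ∀ᶠ y in 𝓝 x, HolSecAt EM F s.ext y := by
    filter_upwards [U.isOpen.mem_nhds hx] with y hy using s.holSecAt_ext hy
  obtain ⟨t, ht⟩ := SmoothSec.exists_extension (h.mono fun y hy => hy.smoothSecAt)
  refine ⟨t, ?_, ht⟩
  filter_upwards [h, ht.eventually_nhds] with y h1 h2 using h1.congr h2

theorem exists_isHolNear_eq [FiniteDimensional ℂ EM] [T2Space M]
    [IsManifold 𝓘(ℂ, EM) ∞ M] {x : M} (v : E x) :
    ∃ t : SmoothSec EM F E, IsHolNear t x ∧ t.1 x = v := by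
  have h : ∀ᶠ y in 𝓝 x, HolSecAt EM F
      (fun y => ∑ i, co F x i x v • fr F E x i y) y := by
    filter_upwards [(frSet F E x).isOpen.mem_nhds (mem_frSet x)] with y hy
    exact HolSecAt.sum fun i _ => HolSecAt.smul contMDiffAt_const (holSecAt_fr hy i)
  obtain ⟨t, ht⟩ := SmoothSec.exists_extension (h.mono fun y hy => hy.smoothSecAt)
  refine ⟨t, ?_, ?_⟩
  · filter_upwards [h, ht.eventually_nhds] with y h1 h2 using h1.congr h2
  · rw [ht.self_of_nhds]
    exact sum_co_smul_fr (mem_frSet x) v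

/-- Near every point, a smooth section is a combination of sections that are holomorphic there. -/
theorem exists_isHolNear_frame [FiniteDimensional ℂ EM] [T2Space M]
    [IsManifold 𝓘(ℂ, EM) ∞ M] (s : SmoothSec EM F E) (x : M) :
    ∃ (χ : SmoothFun EM M) (f : Fin (Module.finrank ℂ F) → SmoothFun EM M)
      (t : Fin (Module.finrank ℂ F) → SmoothSec EM F E), χ.1 x = 1 ∧ (∀ i, IsHolNear (t i) x) ∧
      (∀ i, (f i).1 x = co F x i x (s.1 x)) ∧ χ • s = ∑ i, f i • t i := by
  obtain ⟨χ, h1, hχ⟩ := exists_bump (EM := EM) ((frSet F E x).isOpen.mem_nhds (mem_frSet x))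
  -- One factor χ cuts off the coefficients and the other the frame sections, so the sum of the
  -- products is χ² times the section.
  refine ⟨χ * χ, fun i => SmoothFun.of (fun y => χ.1 y * co F x i y (s.1 y)) fun y => ?_,
    fun i => SmoothSec.of (fun y => χ.1 y • fr F E x i y) (SmoothSecAt.cut fun y hy =>
      (holSecAt_fr (hχ hy) i).smoothSecAt), ?_, fun i => ?_, fun i => ?_, ?_⟩
  · by_cases hy : y ∈ tsupport χ.1
    · exact (χ.2 y).mul_complex ((smoothSecAt_iff (hχ hy)).1 (s.2 y) i)
    · refine (contMDiffAt_const (c := (0 : ℂ))).congr_of_eventuallyEq ?_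
      filter_upwards [(isClosed_tsupport χ.1).isOpen_compl.mem_nhds hy] with z hz
      rw [image_eq_zero_of_notMem_tsupport hz, zero_mul]
  · rw [SmoothFun.mul_apply, h1.self_of_nhds, one_mul]
  · filter_upwards [(frSet F E x).isOpen.mem_nhds (mem_frSet x), h1.eventually_nhds] with y hy h2
    refine (holSecAt_fr hy i).congr (h2.mono fun z hz => ?_)
    change χ.1 z • fr F E x i z = _
    rw [hz, one_smul]
  · change χ.1 x * co F x i x (s.1 x) = _
    rw [h1.self_of_nhds, one_mul]
  · refine SmoothSec.eq_of_forall fun y => ?_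
    rw [SmoothSec.sum_apply, SmoothSec.smul_apply, SmoothFun.mul_apply]
    change _ = ∑ i, (χ.1 y * co F x i y (s.1 y)) • χ.1 y • fr F E x i y
    by_cases hy : y ∈ frSet F E x
    · conv_lhs => rw [← sum_co_smul_fr hy (s.1 y)]
      rw [Finset.smul_sum]
      refine Finset.sum_congr rfl fun i _ => ?_
      rw [smul_smul, smul_smul]
      congr 1
      ring
    · have h0 : χ.1 y = 0 := image_eq_zero_of_notMem_tsupport fun h => hy (hχ h)
      simp [h0]

/-- A tensorial map that vanishes on the sections that are holomorphic near a point is zero. -/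
theorem tensorial_eq_zero [FiniteDimensional ℂ EM] [T2Space M]
    [IsManifold 𝓘(ℂ, EM) ∞ M] {N : Type*} [AddCommGroup N] [Module ℂ N] {x : M}
    (φ : SmoothSec EM F E →+ N) (h : ∀ (f : SmoothFun EM M) s, φ (f • s) = f.1 x • φ s)
    (h0 : ∀ s, IsHolNear s x → φ s = 0) (s : SmoothSec EM F E) : φ s = 0 := by
  obtain ⟨χ, f, t, hχ, ht, -, hs⟩ := exists_isHolNear_frame s x
  -- As χ is 1 at x, the section may be replaced by its multiple χ • s, which is a sum over a
  -- holomorphic frame.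
  have h1 := h χ s
  rw [hχ, one_smul] at h1
  rw [← h1, hs, map_sum]
  exact Finset.sum_eq_zero fun i _ => by rw [h, h0 _ (ht i), smul_zero]

/-- A tensorial map only depends on the value of the section at the point. -/
theorem tensorial_eq_of_eq [FiniteDimensional ℂ EM] [T2Space M]
    [IsManifold 𝓘(ℂ, EM) ∞ M] {N : Type*} [AddCommGroup N] [Module ℂ N] {x : M}
    (φ : SmoothSec EM F E →+ N) (h : ∀ (f : SmoothFun EM M) s, φ (f • s) = f.1 x • φ s)
    {s s' : SmoothSec EM F E} (hs : s.1 x = s'.1 x) : φ s = φ s' := by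
  rw [← sub_eq_zero, ← map_sub]
  obtain ⟨χ, f, t, hχ, -, hf, h2⟩ := exists_isHolNear_frame (s - s') x
  have h1 := h χ (s - s')
  rw [hχ, one_smul] at h1
  rw [← h1, h2, map_sum]
  refine Finset.sum_eq_zero fun i _ => ?_
  rw [h, hf, SmoothSec.sub_apply, hs, sub_self, map_zero, zero_smul]

end Bundle

/-! ### Vector fields -/

section VectorFields

variable [IsManifold 𝓘(ℂ, EM) ∞ M]

/-- The real and the complex tangent bundle are different bundles on the same fibres. Their
coordinates agree because the real derivative of a holomorphic chart is its complex derivative. -/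
theorem contMDiffAt_real_of_smoothSecAt {s : Π y : M, TangentSpace 𝓘(ℂ, EM) y} {x : M}
    (hs : SmoothSecAt EM EM s x) :
    ContMDiffAt 𝓘(ℝ, EM) 𝓘(ℝ, EM).tangent ∞
      (fun y => (⟨y, (show TangentSpace 𝓘(ℝ, EM) y from s y)⟩ : TangentBundle 𝓘(ℝ, EM) M)) x := by
  have : IsManifold 𝓘(ℂ, EM) 1 M := IsManifold.of_le (n := ∞) (by simp)
  have hx := mem_chart_source EM x
  refine (contMDiffAt_vectorField_iff hx).2 ?_
  have h := (contMDiffAt_along_iff (𝕜 := ℝ) (F := EM) (E := (TangentSpace 𝓘(ℂ, EM) : M → Type _))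
    (g := id) (s := s) (contMDiff_id (I := 𝓘(ℝ, EM)) (M := M) (n := ∞)) x).1 hs
  refine h.congr_of_eventuallyEq ?_
  filter_upwards [(chartAt EM x).open_source.mem_nhds hx] with y hy
  have h1 := trivializationAt_tangent_snd (𝕜 := ℂ) hy (s y)
  refine Eq.trans ?_ h1.symm
  exact mvfderiv_real_eq_complex (mdifferentiableAt_extChartAt (I := 𝓘(ℂ, EM)) hy) (s y)

theorem contMDiffAt_real_tangentJ {s : Π y : M, TangentSpace 𝓘(ℂ, EM) y} {x : M}
    [FiniteDimensional ℂ EM] (hs : SmoothSecAt EM EM s x) :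
    ContMDiffAt 𝓘(ℝ, EM) 𝓘(ℝ, EM).tangent ∞ (fun y => (⟨y, tangentJ y
      (show TangentSpace 𝓘(ℝ, EM) y from s y)⟩ : TangentBundle 𝓘(ℝ, EM) M)) x :=
  contMDiffAt_real_of_smoothSecAt (s := fun y => Complex.I • s y)
    (SmoothSecAt.smul (f := fun _ => Complex.I) contMDiffAt_const hs)

theorem holToComplex_mem_complexFields [FiniteDimensional ℂ EM]
    {s : Π y : M, TangentSpace 𝓘(ℂ, EM) y} (hs : ∀ x, SmoothSecAt EM EM s x) :
    (fun x => holToComplex x (s x)) ∈ complexFields EM M := by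
  have h : (fun x => 1 ⊗ₜ (show TangentSpace 𝓘(ℝ, EM) x from s x) +
      Complex.I ⊗ₜ tangentJ x (show TangentSpace 𝓘(ℝ, EM) x from -s x)) ∈ complexFields EM M := by
    refine ⟨_, _, fun x => contMDiffAt_real_of_smoothSecAt (hs x), fun x =>
      contMDiffAt_real_tangentJ (s := fun y => -s y) ?_, fun x => rfl⟩
    exact (SmoothSecAt.smul (f := fun _ => (-1 : ℂ)) contMDiffAt_const (hs x)).congr
      (Filter.Eventually.of_forall fun y => (neg_one_smul ℂ (s y)).symm)
  have h2 := (complexFields EM M).smul_mem (algebraMap ℂ (smoothFunAlg EM M) (1 / 2)) h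
  convert h2 using 1
  funext x
  change _ = (1 / 2 : ℂ) • ((1 : ℂ) ⊗ₜ[ℝ] (show TangentSpace 𝓘(ℝ, EM) x from s x) +
    Complex.I ⊗ₜ[ℝ] tangentJ x (-(show TangentSpace 𝓘(ℝ, EM) x from s x)))
  rw [map_neg, TensorProduct.tmul_neg, ← sub_eq_add_neg]
  rfl

/-- For scalars i this is Jv - iJJv = Jv + iv = i(v - iJv): the projection to type (1,0) turns J
into multiplication by i. Real scalars are harmless. -/
theorem holToComplex_smul {x : M} (c : ℂ) (v : TangentSpace 𝓘(ℂ, EM) x) :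
    holToComplex x (c • v) = c • holToComplex x v := by
  have key : ∀ v : TangentSpace 𝓘(ℝ, EM) x, (1 : ℂ) ⊗ₜ[ℝ] tangentJ x v -
      Complex.I ⊗ₜ[ℝ] tangentJ x (tangentJ x v) =
      Complex.I • ((1 : ℂ) ⊗ₜ[ℝ] v - Complex.I ⊗ₜ[ℝ] tangentJ x v) := fun v => by
    rw [tangentJ_tangentJ, smul_sub, TensorProduct.smul_tmul', TensorProduct.smul_tmul',
      smul_eq_mul, smul_eq_mul, mul_one, Complex.I_mul_I, TensorProduct.tmul_neg,
      TensorProduct.neg_tmul]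
    abel
  have hv : (show TangentSpace 𝓘(ℝ, EM) x from c • v) =
      c.re • (show TangentSpace 𝓘(ℝ, EM) x from v) +
      c.im • tangentJ x (show TangentSpace 𝓘(ℝ, EM) x from v) := by
    change c • (show EM from v) = c.re • (show EM from v) + c.im • (Complex.I • (show EM from v))
    generalize (show EM from v) = w
    conv_lhs => rw [← Complex.re_add_im c, add_smul, mul_smul]
    rfl
  have e : ∀ v : TangentSpace 𝓘(ℂ, EM) x, holToComplex x v = (1 / 2 : ℂ) •
      ((1 : ℂ) ⊗ₜ[ℝ] (show TangentSpace 𝓘(ℝ, EM) x from v) -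
        Complex.I ⊗ₜ[ℝ] tangentJ x (show TangentSpace 𝓘(ℝ, EM) x from v)) := fun _ => rfl
  rw [e, e, hv]
  have k2 := key (show TangentSpace 𝓘(ℝ, EM) x from v)
  generalize (show TangentSpace 𝓘(ℝ, EM) x from v) = w at k2
  rw [smul_comm c]
  congr 1
  conv_rhs => rw [← Complex.re_add_im c, add_smul, mul_smul, ← k2]
  simp only [map_add, map_smul, TensorProduct.tmul_add, TensorProduct.tmul_smul, smul_sub]
  have hr : ∀ (r : ℝ) (z : CTangent EM x), (r : ℂ) • z = r • z := fun r z => Complex.coe_smul r z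
  simp only [hr]
  abel

theorem holToComplex_add {x : M} (v w : TangentSpace 𝓘(ℂ, EM) x) :
    holToComplex x (v + w) = holToComplex x v + holToComplex x w := by
  have e : ∀ v : TangentSpace 𝓘(ℝ, EM) x, holToComplex x v = (1 / 2 : ℂ) •
      ((1 : ℂ) ⊗ₜ[ℝ] v - Complex.I ⊗ₜ[ℝ] tangentJ x v) := fun _ => rfl
  refine (e _).trans (Eq.trans ?_ (congrArg₂ (· + ·) (e _).symm (e _).symm))
  rw [← smul_add]
  congr 1
  refine (congrArg (fun z => (1 : ℂ) ⊗ₜ[ℝ] z - Complex.I ⊗ₜ[ℝ] tangentJ x z)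
    (rfl : _ = (show TangentSpace 𝓘(ℝ, EM) x from v) + (show TangentSpace 𝓘(ℝ, EM) x from w))).trans ?_
  rw [map_add, TensorProduct.tmul_add, TensorProduct.tmul_add]
  abel

/-- The map `TM → T^{1,0} M` as a linear map. -/
def holToComplexₗ (x : M) : TangentSpace 𝓘(ℂ, EM) x →ₗ[ℂ] CTangent EM x where
  toFun := holToComplex x
  map_add' := holToComplex_add
  map_smul' := holToComplex_smul

theorem isAntiholVec_tmul_add_tmul {x : M} (v : TangentSpace 𝓘(ℝ, EM) x) :
    IsAntiholVec ((1 : ℂ) ⊗ₜ[ℝ] v + Complex.I ⊗ₜ[ℝ] tangentJ x v) := by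
  rw [isAntiholVec_iff, map_add, map_add]
  simp [CTangent.re_tmul, CTangent.im_tmul]

/-- It suffices to extend the real part X of the vector to a smooth field and to take X + iJX
everywhere. -/
theorem exists_antiholField [FiniteDimensional ℂ EM] [T2Space M] {x : M} {Z : CTangent EM x}
    (hZ : IsAntiholVec Z) : ∃ X : AntiholFields EM M, X.1 x = Z := by
  obtain ⟨s, -, hs⟩ := exists_isHolNear_eq (EM := EM) (F := EM)
    (E := (TangentSpace 𝓘(ℂ, EM) : M → Type _)) (x := x) (CTangent.re Z)
  refine ⟨⟨fun y => 1 ⊗ₜ (show TangentSpace 𝓘(ℝ, EM) y from s.1 y) +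
      Complex.I ⊗ₜ tangentJ y (show TangentSpace 𝓘(ℝ, EM) y from s.1 y),
    ⟨_, _, fun y => contMDiffAt_real_of_smoothSecAt (s.2 y), fun y =>
      contMDiffAt_real_tangentJ (s.2 y), fun y => rfl⟩, fun y => ?_⟩, ?_⟩
  · exact isAntiholVec_tmul_add_tmul (show TangentSpace 𝓘(ℝ, EM) y from s.1 y)
  · rw [CTangent.eq_re_add_im Z, (isAntiholVec_iff Z).1 hZ]
    change (1 : ℂ) ⊗ₜ[ℝ] (show TangentSpace 𝓘(ℝ, EM) x from s.1 x) +
      Complex.I ⊗ₜ[ℝ] tangentJ x (show TangentSpace 𝓘(ℝ, EM) x from s.1 x) = _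
    rw [hs]

/-- Local test functions extend to global ones with the same germ, so global functions already
separate vectors of type (0,1). -/
theorem AntiholFields.eq_of_cderiv [FiniteDimensional ℂ EM] [T2Space M] {X Y : AntiholFields EM M}
    (h : ∀ (f : SmoothFun EM M) x, cderiv f.1 x (X.1 x) = cderiv f.1 x (Y.1 x)) : X = Y := by
  refine Subtype.ext (funext fun x => sub_eq_zero.1 ?_)
  refine IsAntiholVec.eq_zero ((X - Y).2.2 x) fun u hu => ?_
  obtain ⟨f, hf⟩ := SmoothFun.exists_extension hu
  rw [← cderiv_congr hf]
  rw [map_sub, h, sub_self]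

end VectorFields

end

/-! ### Derivatives in frames and the Cauchy-Riemann operator. -/

noncomputable section

variable {EM : Type*} [NormedAddCommGroup EM] [NormedSpace ℂ EM]
  {M : Type*} [TopologicalSpace M] [ChartedSpace EM M]

theorem ContMDiffAt.mdiff {W : Type*} [NormedAddCommGroup W] [NormedSpace ℂ W] {u : M → W} {x : M}
    (h : ContMDiffAt 𝓘(ℝ, EM) 𝓘(ℝ, W) ∞ u x) : MDifferentiableAt 𝓘(ℝ, EM) 𝓘(ℝ, W) u x :=
  h.mdifferentiableAt (n := ∞) (by simp)

section Bundle

variable {F : Type*} [NormedAddCommGroup F] [NormedSpace ℂ F]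
  {E : M → Type*} [TopologicalSpace (TotalSpace F E)] [∀ x, AddCommGroup (E x)]
  [∀ x, Module ℂ (E x)] [∀ x, TopologicalSpace (E x)] [FiberBundle F E] [VectorBundle ℂ F E]
  {U V : Opens M} [FiniteDimensional ℂ F]

variable (F) in
/-- The derivative of a section in the local frame around `x₀`. -/
def frameDer (x₀ : M) (e : Π x, E x) (y : M) : CTangent EM y →ₗ[ℂ] E y :=
  ∑ i, (cderiv (fun z => co F x₀ i z (e z)) y).smulRight (fr F E x₀ i y)

theorem frameDer_apply (x₀ : M) (e : Π x, E x) (y : M) (Z : CTangent EM y) :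
    frameDer F x₀ e y Z = ∑ i, cderiv (fun z => co F x₀ i z (e z)) y Z • fr F E x₀ i y := by
  simp [frameDer]

theorem frameDer_congr {e e' : Π x, E x} {y : M} (x₀ : M) (h : ∀ᶠ z in 𝓝 y, e z = e' z) :
    frameDer (EM := EM) F x₀ e y = frameDer F x₀ e' y := by
  refine LinearMap.ext fun Z => ?_
  rw [frameDer_apply, frameDer_apply]
  refine Finset.sum_congr rfl fun i _ => ?_
  rw [cderiv_congr (h.mono fun z hz => congrArg (co F x₀ i z) hz)]

/-- `dbarAt` uses the trivialization centred at x. For the frame of this trivialization the equality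
holds on all complex vectors; for other frames it holds only on vectors of type (0,1). -/
theorem sum_cderiv_co_smul_fr_self {e : Π x, E x} {x : M}
    (he : ContMDiffAt 𝓘(ℝ, EM) 𝓘(ℝ, F) ∞ (fun y => (trivializationAt F E x ⟨y, e y⟩).2) x) :
    dbarAt (F := F) e x = frameDer (EM := EM) F x e x := by
  refine LinearMap.ext fun Z => ?_
  rw [frameDer_apply, dbarAt, LinearMap.comp_apply, symm_co]
  refine Finset.sum_congr rfl fun i _ => ?_
  let A : F →L[ℂ] ℂ := LinearMap.toContinuousLinearMap ((Module.finBasis ℂ F).coord i)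
  congr 1
  refine (cderiv_clm_comp A he.mdiff Z).symm.trans ?_
  refine LinearMap.congr_fun (cderiv_congr ?_) Z
  filter_upwards [(frSet F E x).isOpen.mem_nhds (mem_frSet x)] with y hy
  exact (co_eq hy i (e y)).symm

variable [ContMDiffVectorBundle ∞ F E 𝓘(ℂ, EM)] {e e' : Π x, E x} {x₀ x₁ y : M}

theorem frameDer_add (hy : y ∈ frSet F E x₀) (he : SmoothSecAt EM F e y)
    (he' : SmoothSecAt EM F e' y) : frameDer (EM := EM) F x₀ (fun z => e z + e' z) y =
      frameDer F x₀ e y + frameDer F x₀ e' y := by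
  refine LinearMap.ext fun Z => ?_
  rw [LinearMap.add_apply, frameDer_apply, frameDer_apply, frameDer_apply, ← Finset.sum_add_distrib]
  refine Finset.sum_congr rfl fun i _ => ?_
  simp only [map_add]
  rw [cderiv_add ((smoothSecAt_iff hy).1 he i).mdiff ((smoothSecAt_iff hy).1 he' i).mdiff,
    LinearMap.add_apply, add_smul]

theorem frameDer_smul (hy : y ∈ frSet F E x₀) {f : M → ℂ}
    (hf : ContMDiffAt 𝓘(ℝ, EM) 𝓘(ℝ, ℂ) ∞ f y) (he : SmoothSecAt EM F e y) (Z : CTangent EM y) :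
    frameDer F x₀ (fun z => f z • e z) y Z = f y • frameDer F x₀ e y Z + cderiv f y Z • e y := by
  conv_rhs => rw [← sum_co_smul_fr hy (e y)]
  rw [frameDer_apply, frameDer_apply, Finset.smul_sum, Finset.smul_sum, ← Finset.sum_add_distrib]
  refine Finset.sum_congr rfl fun i _ => ?_
  simp only [map_smul, smul_eq_mul]
  rw [cderiv_mul hf.mdiff ((smoothSecAt_iff hy).1 he i).mdiff, add_smul, smul_smul, smul_smul]

theorem frameDer_zero : frameDer (EM := EM) F x₀ (fun z => (0 : E z)) y = 0 := by
  refine LinearMap.ext fun Z => ?_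
  rw [frameDer_apply]
  simp only [map_zero, cderiv_const, LinearMap.zero_apply, zero_smul, Finset.sum_const_zero]

theorem frameDer_sum {ι : Type*} (S : Finset ι) {e : ι → Π x, E x} (hy : y ∈ frSet F E x₀)
    (he : ∀ i, SmoothSecAt EM F (e i) y) : frameDer (EM := EM) F x₀ (fun z => ∑ i ∈ S, e i z) y =
      ∑ i ∈ S, frameDer F x₀ (e i) y := by
  classical
  induction S using Finset.induction_on with
  | empty => simpa using frameDer_zero
  | insert i S hi ih =>
    simp only [Finset.sum_insert hi]
    rw [frameDer_add hy (he i) (SmoothSecAt.sum fun i _ => he i), ih]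

theorem frameDer_hol (hy : y ∈ frSet F E x₀) (he : HolSecAt EM F e y) {Z : CTangent EM y}
    (hZ : IsAntiholVec Z) : frameDer F x₀ e y Z = 0 := by
  rw [frameDer_apply]
  refine Finset.sum_eq_zero fun i _ => ?_
  rw [cderiv_antihol (((holSecAt_iff hy).1 he i).mdifferentiableAt (n := ∞) (by simp)) hZ, zero_smul]

/-- A smooth section is a combination of the frame. -/
theorem eventually_eq_sum_co_smul_fr (hy : y ∈ frSet F E x₀) (e : Π x, E x) :
    ∀ᶠ z in 𝓝 y, e z = ∑ i, co F x₀ i z (e z) • fr F E x₀ i z := by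
  filter_upwards [(frSet F E x₀).isOpen.mem_nhds hy] with z hz
  exact (sum_co_smul_fr hz (e z)).symm

/-- The derivative in one frame, in terms of another one. -/
theorem frameDer_change (h₀ : y ∈ frSet F E x₀) (h₁ : y ∈ frSet F E x₁)
    (he : SmoothSecAt EM F e y) (Z : CTangent EM y) : frameDer F x₁ e y Z = frameDer F x₀ e y Z +
      ∑ i, co F x₀ i y (e y) • frameDer F x₁ (fr F E x₀ i) y Z := by
  have hc := (smoothSecAt_iff h₀).1 he
  have hf := fun i => (holSecAt_fr (EM := EM) h₀ i).smoothSecAt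
  rw [frameDer_congr x₁ (eventually_eq_sum_co_smul_fr h₀ e),
    frameDer_sum _ h₁ fun i => (hf i).smul (hc i), LinearMap.sum_apply, frameDer_apply,
    ← Finset.sum_add_distrib]
  refine Finset.sum_congr rfl fun i _ => ?_
  rw [frameDer_smul h₁ (hc i) (hf i), add_comm]

/-- The correction terms in `frameDer_change` are derivatives of holomorphic frame sections, and
these vanish along vectors of type (0,1). -/
theorem frameDer_antihol (h₀ : y ∈ frSet F E x₀) (h₁ : y ∈ frSet F E x₁)
    (he : SmoothSecAt EM F e y) {Z : CTangent EM y} (hZ : IsAntiholVec Z) :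
    frameDer F x₁ e y Z = frameDer F x₀ e y Z := by
  rw [frameDer_change h₀ h₁ he, Finset.sum_eq_zero, add_zero]
  intro i _
  rw [frameDer_hol h₁ (holSecAt_fr h₀ i) hZ, smul_zero]

theorem SmoothSecAt.triv (he : SmoothSecAt EM F e y) : ContMDiffAt 𝓘(ℝ, EM) 𝓘(ℝ, F) ∞
    (fun z => (trivializationAt F E y ⟨z, e z⟩).2) y :=
  (contMDiffAt_along_iff (𝕜 := ℝ) (F := F) (E := E) (g := id) (s := e)
    (contMDiff_id (I := 𝓘(ℝ, EM)) (M := M) (n := ∞)) y).1 he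

theorem dbarAt_eq (h₀ : y ∈ frSet F E x₀) (he : SmoothSecAt EM F e y) {Z : CTangent EM y}
    (hZ : IsAntiholVec Z) : dbarAt (F := F) e y Z = frameDer F x₀ e y Z := by
  rw [sum_cderiv_co_smul_fr_self he.triv, frameDer_antihol h₀ (mem_frSet y) he hZ]

theorem dbarAt_eq_self (he : SmoothSecAt EM F e y) (Z : CTangent EM y) :
    dbarAt (F := F) e y Z = frameDer F y e y Z := by
  rw [sum_cderiv_co_smul_fr_self he.triv]

theorem dbarAt_hol (he : HolSecAt EM F e y) {Z : CTangent EM y} (hZ : IsAntiholVec Z) :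
    dbarAt (F := F) e y Z = 0 := by
  rw [dbarAt_eq_self he.smoothSecAt, frameDer_hol (mem_frSet y) he hZ]

theorem SmoothSecAt.frameDer [IsManifold 𝓘(ℂ, EM) ∞ M] (h₀ : y ∈ frSet F E x₀)
    (he : SmoothSecAt EM F e y) {Z : Π x, CTangent EM x} (hZ : Z ∈ complexFields EM M) :
    SmoothSecAt EM F (fun z => frameDer F x₀ e z (Z z)) y := by
  simp only [frameDer_apply]
  exact SmoothSecAt.sum fun i _ => (holSecAt_fr h₀ i).smoothSecAt.smul
    (contMDiffAt_cderiv_apply hZ ((smoothSecAt_iff h₀).1 he i))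

/-- In one fixed frame the equation ∂̄e = 0 says that every component is killed by all vectors of
type (0,1), so the components are holomorphic by `contMDiffAt_complex_of_cderiv`. -/
theorem holSecAt_of_dbarAt [FiniteDimensional ℂ EM] [IsManifold 𝓘(ℂ, EM) ∞ M] (h : ∀ᶠ z in 𝓝 y, SmoothSecAt EM F e z ∧
    ∀ Z : CTangent EM z, IsAntiholVec Z → dbarAt (F := F) e z Z = 0) : HolSecAt EM F e y := by
  rw [holSecAt_iff (mem_frSet y)]
  intro i
  refine contMDiffAt_complex_of_cderiv ?_
  filter_upwards [h, (frSet F E y).isOpen.mem_nhds (mem_frSet y)] with z ⟨hs, hz⟩ hzy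
  refine ⟨(smoothSecAt_iff hzy).1 hs i, fun Z hZ => ?_⟩
  have h1 := hz Z hZ
  rw [dbarAt_eq hzy hs hZ, frameDer_apply] at h1
  have h2 := congrArg (co F y i z) h1
  rw [map_sum, map_zero] at h2
  simp only [map_smul, co_fr hzy, smul_eq_mul, mul_ite, mul_one, mul_zero] at h2
  simpa using h2

variable [IsManifold 𝓘(ℂ, EM) ∞ M]

/-- In the definition of `dbarAt` the trivialization moves with the point. Near y it may be replaced
by the frame around y, in which smoothness is visible. -/
theorem SmoothSecAt.dbarAt (he : ∀ x, SmoothSecAt EM F e x) (X : AntiholFields EM M) (y : M) :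
    SmoothSecAt EM F (fun z => dbarAt (F := F) e z (X.1 z)) y := by
  refine (SmoothSecAt.frameDer (mem_frSet y) (he y) X.2.1).congr ?_
  filter_upwards [(frSet F E y).isOpen.mem_nhds (mem_frSet y)] with z hz
  exact dbarAt_eq hz (he z) (X.2.2 z)

theorem dbarAt_add (he : SmoothSecAt EM F e y) (he' : SmoothSecAt EM F e' y) (Z : CTangent EM y) :
    dbarAt (F := F) (fun z => e z + e' z) y Z =
      dbarAt (F := F) e y Z + dbarAt (F := F) e' y Z := by
  rw [dbarAt_eq_self he, dbarAt_eq_self he', dbarAt_eq_self (he.add he'),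
    frameDer_add (mem_frSet y) he he', LinearMap.add_apply]

theorem dbarAt_smul {f : M → ℂ} (hf : ContMDiffAt 𝓘(ℝ, EM) 𝓘(ℝ, ℂ) ∞ f y)
    (he : SmoothSecAt EM F e y) (Z : CTangent EM y) : dbarAt (F := F) (fun z => f z • e z) y Z =
      f y • dbarAt (F := F) e y Z + cderiv f y Z • e y := by
  rw [dbarAt_eq_self he, dbarAt_eq_self (he.smul hf), frameDer_smul (mem_frSet y) hf he]

/-- The Cauchy-Riemann operator on smooth sections. -/
def dbar : AntiholFields EM M →ₗ[SmoothFun EM M] SmoothSec EM F E →ₗ[ℂ] SmoothSec EM F E where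
  toFun X :=
    { toFun := fun e => SmoothSec.of (fun x => dbarAt (F := F) e.1 x (X.1 x))
        (SmoothSecAt.dbarAt e.2 X)
      map_add' := fun e e' => SmoothSec.eq_of_forall fun x => dbarAt_add (e.2 x) (e'.2 x) _
      map_smul' := fun c e => SmoothSec.eq_of_forall fun x => by
        refine (dbarAt_smul (f := fun _ => c) contMDiffAt_const (e.2 x) _).trans ?_
        rw [cderiv_const, LinearMap.zero_apply, zero_smul, add_zero]
        rfl }
  map_add' X Y := LinearMap.ext fun e => SmoothSec.eq_of_forall fun x => map_add _ (X.1 x) (Y.1 x)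
  map_smul' f X := LinearMap.ext fun e => SmoothSec.eq_of_forall fun x =>
    map_smul _ (f.1 x) (X.1 x)

theorem dbar_apply (X : AntiholFields EM M) (e : SmoothSec EM F E) (x : M) :
    (dbar X e).1 x = dbarAt (F := F) e.1 x (X.1 x) := rfl

theorem dbar_apply_hol {X : AntiholFields EM M} {e : SmoothSec EM F E} {x : M}
    (he : IsHolNear e x) : ∀ᶠ y in 𝓝 x, (dbar X e).1 y = 0 := by
  filter_upwards [he] with y hy using dbarAt_hol hy (X.2.2 y)

theorem dbar_smul_apply (X : AntiholFields EM M) (f : SmoothFun EM M) (e : SmoothSec EM F E)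
    (x : M) : (dbar X (f • e)).1 x = f.1 x • (dbar X e).1 x + cderiv f.1 x (X.1 x) • e.1 x :=
  dbarAt_smul (f.2 x) (e.2 x) _

end Bundle

end

/-! ### Extension of the bracket of `𝓛` to smooth sections. -/

noncomputable section

variable {EM : Type*} [NormedAddCommGroup EM] [NormedSpace ℂ EM]
  {M : Type*} [TopologicalSpace M] [ChartedSpace EM M]

section Frame

variable {F : Type*} [NormedAddCommGroup F] [NormedSpace ℂ F]
  {E : M → Type*} [TopologicalSpace (TotalSpace F E)] [∀ x, AddCommGroup (E x)]
  [∀ x, Module ℂ (E x)] [∀ x, TopologicalSpace (E x)] [FiberBundle F E] [VectorBundle ℂ F E]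
  {U V : Opens M} [FiniteDimensional ℂ F] [ContMDiffVectorBundle ∞ F E 𝓘(ℂ, EM)]
  {s : Π x, E x} {x₀ y : M}

variable (EM F E) in
/-- The local frame around `x₀`, as holomorphic sections. -/
def frHol (x₀ : M) (i : Fin (Module.finrank ℂ F)) : HolSec EM F E (frSet F E x₀) :=
  HolSec.of (fr F E x₀ i) fun _ hy => holSecAt_fr hy i

theorem HolSec.holSecAt_of_eq (l' : HolSec EM F E U) (hl : ∀ z : U, s z = l'.1 z) (hy : y ∈ U) :
    HolSecAt EM F s y := by
  refine (l'.holSecAt_ext hy).congr ?_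
  filter_upwards [U.isOpen.mem_nhds hy] with z hz
  rw [l'.ext_apply hz, hl ⟨z, hz⟩]

/-- The components of a holomorphic section in a local frame. -/
theorem HolSec.exists_eq_sum (hU : U ≤ frSet F E x₀) (l' : HolSec EM F E U)
    (hl : ∀ z : U, s z = l'.1 z) : ∃ c : Fin (Module.finrank ℂ F) → HolFun EM U,
      (∀ i (z : U), (c i).1 z = co F x₀ i z (s z)) ∧
      l' = ∑ i, c i • HolSec.res hU (frHol EM F E x₀ i) := by
  refine ⟨fun i => HolFun.of (fun z => co F x₀ i z (s z)) fun z hz =>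
    (holSecAt_iff (hU hz)).1 (l'.holSecAt_of_eq hl hz) i, fun i z => rfl, ?_⟩
  refine HolSec.eq_of_forall fun z => ?_
  rw [HolSec.sum_apply, ← hl]
  exact (sum_co_smul_fr (hU z.2) (s z)).symm

end Frame

variable [IsManifold 𝓘(ℂ, EM) ∞ M]
  {FL : Type*} [NormedAddCommGroup FL] [NormedSpace ℂ FL] {L : M → Type*}
  [TopologicalSpace (TotalSpace FL L)] [∀ x, AddCommGroup (L x)] [∀ x, Module ℂ (L x)]
  [∀ x, TopologicalSpace (L x)] [FiberBundle FL L] [VectorBundle ℂ FL L]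
  {U V : Opens M}

/-- The anchor with values in `T^{1,0} M`. -/
def HolAnchor.cAnchor (ρ : HolAnchor EM FL L) (x : M) : L x →ₗ[ℂ] CTangent EM x :=
  holToComplexₗ x ∘ₗ ρ.anchor x

theorem HolSecAt.anchor (ρ : HolAnchor EM FL L) {l : Π x, L x} {y : M} (hl : HolSecAt EM FL l y) :
    HolSecAt EM EM (fun z => ρ.anchor z (l z)) y :=
  ρ.contMDiff_anchor.contMDiffAt.comp y hl

theorem HolAnchor.act_apply (ρ : HolAnchor EM FL L) (l : HolSec EM FL L U) (f : HolFun EM U)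
    {u : M → ℂ} (hu : ∀ z : U, f.1 z = u z) (x : U) :
    (ρ.act l f).1 x = cderiv u x (ρ.cAnchor x (l.1 x)) := by
  have h1 : MDifferentiableAt 𝓘(ℂ, EM) 𝓘(ℂ, ℂ) (Function.extend Subtype.val f.1 (0 : M → ℂ)) x :=
    ((contMDiffOn_extend f).contMDiffAt (U.isOpen.mem_nhds x.2)).mdifferentiableAt (by simp)
  have h2 : Function.extend Subtype.val f.1 (0 : M → ℂ) =ᶠ[𝓝 (x : M)] u := by
    filter_upwards [U.isOpen.mem_nhds x.2] with z hz
    exact (Subtype.val_injective.extend_apply f.1 _ ⟨z, hz⟩).trans (hu ⟨z, hz⟩)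
  rw [← cderiv_congr h2]
  exact (cderiv_holToComplex h1 (ρ.anchor x (l.1 x))).symm

/-- Vectors of type `(1,0)` and functions whose derivatives are holomorphic. -/
theorem HolAnchor.contMDiffAt_cderiv (ρ : HolAnchor EM FL L) {l : Π x, L x} {y : M}
    (hl : HolSecAt EM FL l y) {u : M → ℂ} (hu : ContMDiffAt 𝓘(ℂ, EM) 𝓘(ℂ, ℂ) ∞ u y) :
    ContMDiffAt 𝓘(ℂ, EM) 𝓘(ℂ, ℂ) ∞ (fun z => cderiv u z (ρ.cAnchor z (l z))) y := by
  refine (contMDiffAt_mvfderiv_apply hu (hl.anchor ρ)).congr_of_eventuallyEq ?_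
  filter_upwards [eventually_mdifferentiableAt hu] with z hz
  exact cderiv_holToComplex hz _

variable [FiniteDimensional ℂ EM] [FiniteDimensional ℂ FL] [ContMDiffVectorBundle ∞ FL L 𝓘(ℂ, EM)]

theorem SmoothSecAt.anchor (ρ : HolAnchor EM FL L) {l : Π x, L x} {y : M}
    (hl : SmoothSecAt EM FL l y) : SmoothSecAt EM EM (fun z => ρ.anchor z (l z)) y := by
  have hc := smoothSecAt_iff_self.1 hl
  have hf := fun i => ((holSecAt_fr (EM := EM) (mem_frSet (F := FL) (E := L) y) i).anchor
    ρ).smoothSecAt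
  have h := SmoothSecAt.sum (S := Finset.univ) fun i _ => SmoothSecAt.smul (hc i) (hf i)
  refine h.congr ?_
  filter_upwards [eventually_eq_sum_co_smul_fr (mem_frSet (F := FL) y) l] with z hz
  conv_lhs => rw [hz]
  rw [map_sum]
  simp only [map_smul]

theorem HolAnchor.cAnchor_mem (ρ : HolAnchor EM FL L) (l : SmoothSec EM FL L) :
    (fun x => ρ.cAnchor x (l.1 x)) ∈ complexFields EM M :=
  holToComplex_mem_complexFields fun x => (l.smoothSecAt x).anchor ρ

theorem HolAnchor.cAnchor_eq_sum (ρ : HolAnchor EM FL L) {x₀ y : M} (hy : y ∈ frSet FL L x₀)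
    (v : L y) :
    ρ.cAnchor y v = ∑ i, co FL x₀ i y v • ρ.cAnchor y (fr FL L x₀ i y) := by
  conv_lhs => rw [← sum_co_smul_fr hy v]
  rw [map_sum]
  simp only [map_smul]

namespace HolLieAlgebroid

variable (𝓛 : HolLieAlgebroid EM FL L)

theorem bracket_swap (U : Opens M) (l m : HolSec EM FL L U) :
    𝓛.bracket U l m = -𝓛.bracket U m l := by
  have h := 𝓛.bracket_self U (l + m)
  simp only [map_add, LinearMap.add_apply, 𝓛.bracket_self, zero_add, add_zero] at h
  exact eq_neg_of_add_eq_zero_right h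

theorem leibniz_left (U : Opens M) (l m : HolSec EM FL L U) (f : HolFun EM U) :
    𝓛.bracket U (f • l) m = f • 𝓛.bracket U l m - 𝓛.act m f • l := by
  rw [𝓛.bracket_swap, 𝓛.leibniz, 𝓛.bracket_swap U m l, smul_neg, neg_add, neg_neg, sub_eq_add_neg]

/-- The brackets of the local frame around `x₀`. -/
def frBracket (x₀ : M) (i j : Fin (Module.finrank ℂ FL)) (y : M) : L y :=
  (𝓛.bracket _ (frHol EM FL L x₀ i) (frHol EM FL L x₀ j)).ext y

theorem frBracket_swap {x₀ y : M} (hy : y ∈ frSet FL L x₀) (i j) :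
    𝓛.frBracket x₀ i j y = -𝓛.frBracket x₀ j i y := by
  rw [frBracket, frBracket, HolSec.ext_apply _ hy, HolSec.ext_apply _ hy, 𝓛.bracket_swap]
  rfl

/-- The extension of the bracket of holomorphic sections to smooth sections, in the local frame
around `x₀`. -/
def frameBracket (x₀ : M) (l m : Π x, L x) (y : M) : L y :=
  frameDer FL x₀ m y (𝓛.cAnchor y (l y)) - frameDer FL x₀ l y (𝓛.cAnchor y (m y)) +
    ∑ i, ∑ j, (co FL x₀ i y (l y) * co FL x₀ j y (m y)) • 𝓛.frBracket x₀ i j y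

variable {𝓛} {l m m' : Π x, L x} {x₀ x₁ y : M}

theorem frameBracket_swap (hy : y ∈ frSet FL L x₀) :
    𝓛.frameBracket x₀ l m y = -𝓛.frameBracket x₀ m l y := by
  rw [frameBracket, frameBracket, neg_add, neg_sub, ← Finset.sum_neg_distrib, Finset.sum_comm]
  congr 1
  refine Finset.sum_congr rfl fun i _ => ?_
  rw [← Finset.sum_neg_distrib]
  refine Finset.sum_congr rfl fun j _ => ?_
  rw [frBracket_swap 𝓛 hy, mul_comm, smul_neg]

theorem frameBracket_congr {l' : Π x, L x} (hl : ∀ᶠ z in 𝓝 y, l z = l' z)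
    (hm : ∀ᶠ z in 𝓝 y, m z = m' z) :
    𝓛.frameBracket x₀ l m y = 𝓛.frameBracket x₀ l' m' y := by
  rw [frameBracket, frameBracket, frameDer_congr x₀ hm, frameDer_congr x₀ hl, hl.self_of_nhds,
    hm.self_of_nhds]

theorem frameBracket_add (hy : y ∈ frSet FL L x₀) (hm : SmoothSecAt EM FL m y)
    (hm' : SmoothSecAt EM FL m' y) : 𝓛.frameBracket x₀ l (fun z => m z + m' z) y =
      𝓛.frameBracket x₀ l m y + 𝓛.frameBracket x₀ l m' y := by
  simp only [frameBracket, frameDer_add hy hm hm', LinearMap.add_apply, map_add, mul_add, add_smul,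
    Finset.sum_add_distrib]
  abel

theorem frameBracket_zero : 𝓛.frameBracket x₀ l (fun _ => 0) y = 0 := by
  simp only [frameBracket, frameDer_zero, LinearMap.zero_apply, map_zero, mul_zero, zero_smul,
    Finset.sum_const_zero, sub_zero, add_zero]

theorem frameBracket_sum {ι : Type*} (S : Finset ι) {m : ι → Π x, L x} (hy : y ∈ frSet FL L x₀)
    (hm : ∀ i, SmoothSecAt EM FL (m i) y) : 𝓛.frameBracket x₀ l (fun z => ∑ i ∈ S, m i z) y =
      ∑ i ∈ S, 𝓛.frameBracket x₀ l (m i) y := by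
  classical
  induction S using Finset.induction_on with
  | empty => simpa using frameBracket_zero
  | insert i S hi ih =>
    simp only [Finset.sum_insert hi]
    rw [frameBracket_add hy (hm i) (SmoothSecAt.sum fun i _ => hm i), ih]

theorem frameBracket_smul (hy : y ∈ frSet FL L x₀) {f : M → ℂ}
    (hf : ContMDiffAt 𝓘(ℝ, EM) 𝓘(ℝ, ℂ) ∞ f y) (hm : SmoothSecAt EM FL m y) :
    𝓛.frameBracket x₀ l (fun z => f z • m z) y =
      f y • 𝓛.frameBracket x₀ l m y + cderiv f y (𝓛.cAnchor y (l y)) • m y := by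
  simp only [frameBracket, frameDer_smul hy hf hm, map_smul, smul_eq_mul, smul_add, smul_sub,
    Finset.smul_sum, smul_smul, mul_left_comm]
  abel

variable (𝓛) in
theorem bracket_sum_smul {ι κ : Type*} [Fintype ι] [Fintype κ] (c : ι → HolFun EM U)
    (d : κ → HolFun EM U) (a : ι → HolSec EM FL L U) (b : κ → HolSec EM FL L U) :
    𝓛.bracket U (∑ i, c i • a i) (∑ j, d j • b j) =
      (∑ j, 𝓛.act (∑ i, c i • a i) (d j) • b j) - (∑ i, 𝓛.act (∑ j, d j • b j) (c i) • a i) +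
        ∑ i, ∑ j, (c i * d j) • 𝓛.bracket U (a i) (b j) := by
  have h1 : ∀ j, 𝓛.bracket U (∑ i, c i • a i) (b j) =
      ∑ i, (c i • 𝓛.bracket U (a i) (b j) - 𝓛.act (b j) (c i) • a i) := fun j => by
    rw [map_sum, LinearMap.sum_apply]
    simp only [leibniz_left]
  have h2 : ∀ i, 𝓛.act (∑ j, d j • b j) (c i) = ∑ j, d j * 𝓛.act (b j) (c i) := fun i => by
    have : ∀ S : Finset κ, 𝓛.act (∑ j ∈ S, d j • b j) (c i) = ∑ j ∈ S, d j * 𝓛.act (b j) (c i) := by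
      classical
      intro S
      induction S using Finset.induction_on with
      | empty => simpa using act_zero 𝓛 (c i)
      | insert j S hj ih => rw [Finset.sum_insert hj, Finset.sum_insert hj, act_add, act_smul, ih]
    exact this _
  rw [map_sum]
  simp only [leibniz, h1, h2, Finset.sum_add_distrib, Finset.sum_smul, Finset.smul_sum, smul_sub,
    Finset.sum_sub_distrib, smul_smul]
  rw [Finset.sum_comm (f := fun i j => (d j * 𝓛.act (b j) (c i)) • a i),
    Finset.sum_comm (f := fun i j => (c i * d j) • 𝓛.bracket U (a i) (b j))]
  simp only [mul_comm (c _) (d _)]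
  abel

/-- Holomorphic sections have holomorphic components in the frame, so the Leibniz rule of `𝓛` in
both arguments applies; the three sums it produces are those in the definition of `frameBracket`. -/
theorem frameBracket_eq_bracket (hU : U ≤ frSet FL L x₀) {l' m' : HolSec EM FL L U}
    (hl : ∀ z : U, l z = l'.1 z) (hm : ∀ z : U, m z = m'.1 z) (hy : y ∈ U) :
    𝓛.frameBracket x₀ l m y = (𝓛.bracket U l' m').1 ⟨y, hy⟩ := by
  obtain ⟨c, hc, ec⟩ := l'.exists_eq_sum hU hl
  obtain ⟨d, hd, ed⟩ := m'.exists_eq_sum hU hm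
  have hfr : ∀ i j, 𝓛.bracket U (HolSec.res hU (frHol EM FL L x₀ i))
      (HolSec.res hU (frHol EM FL L x₀ j)) = HolSec.res hU (𝓛.bracket _ (frHol EM FL L x₀ i)
        (frHol EM FL L x₀ j)) := fun i j => 𝓛.bracket_res hU _ _
  have key : 𝓛.bracket U l' m' = _ :=
    (congrArg₂ (fun a b => 𝓛.bracket U a b) ec ed).trans (𝓛.bracket_sum_smul c d _ _)
  rw [← ec, ← ed] at key
  rw [key, HolSec.add_apply, HolSec.sub_apply, HolSec.sum_apply, HolSec.sum_apply,
    HolSec.sum_apply, frameBracket, frameDer_apply, frameDer_apply]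
  simp only [HolSec.sum_apply, hfr, HolSec.smul_apply]
  have e1 : ∀ i, (𝓛.act l' (d i)).1 ⟨y, hy⟩ =
      cderiv (fun z => co FL x₀ i z (m z)) y (𝓛.cAnchor y (l y)) := fun i =>
    (𝓛.act_apply l' (d i) (hd i) ⟨y, hy⟩).trans (by rw [← hl ⟨y, hy⟩])
  have e2 : ∀ i, (𝓛.act m' (c i)).1 ⟨y, hy⟩ =
      cderiv (fun z => co FL x₀ i z (l z)) y (𝓛.cAnchor y (m y)) := fun i =>
    (𝓛.act_apply m' (c i) (hc i) ⟨y, hy⟩).trans (by rw [← hm ⟨y, hy⟩])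
  simp only [e1, e2]
  refine congrArg₂ (· + ·) rfl (Finset.sum_congr rfl fun i _ => Finset.sum_congr rfl fun j _ => ?_)
  refine congrArg₂ (· • ·) (congrArg₂ (· * ·) (hc i ⟨y, hy⟩).symm (hd j ⟨y, hy⟩).symm) ?_
  exact HolSec.ext_apply _ (hU hy)

theorem frameBracket_hol (h₀ : y ∈ frSet FL L x₀) {l' m' : HolSec EM FL L U}
    (hl : ∀ z : U, l z = l'.1 z) (hm : ∀ z : U, m z = m'.1 z) (hy : y ∈ U) :
    𝓛.frameBracket x₀ l m y = (𝓛.bracket U l' m').1 ⟨y, hy⟩ := by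
  have hW : U ⊓ frSet FL L x₀ ≤ U := inf_le_left
  rw [frameBracket_eq_bracket (U := U ⊓ frSet FL L x₀) inf_le_right
    (l' := HolSec.res hW l') (m' := HolSec.res hW m') (fun z => hl ⟨z, hW z.2⟩)
    (fun z => hm ⟨z, hW z.2⟩) ⟨hy, h₀⟩, 𝓛.bracket_res]
  rfl

/-- The bracket in the frame around x₁ obeys the Leibniz rule in both arguments. Expanding l and m
in the frame around x₀ leaves its values on these frame sections; they are holomorphic, so the
values are true brackets by `frameBracket_hol`. The outcome is the defining formula in the frame
around x₀. -/
theorem frameBracket_change (h₀ : y ∈ frSet FL L x₀) (h₁ : y ∈ frSet FL L x₁)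
    (hl : SmoothSecAt EM FL l y) (hm : SmoothSecAt EM FL m y) :
    𝓛.frameBracket x₁ l m y = 𝓛.frameBracket x₀ l m y := by
  have hf := fun i => (holSecAt_fr (EM := EM) h₀ i).smoothSecAt
  have hexp : ∀ {l m : Π x, L x}, SmoothSecAt EM FL m y → 𝓛.frameBracket x₁ l m y =
      ∑ i, (co FL x₀ i y (m y) • 𝓛.frameBracket x₁ l (fr FL L x₀ i) y +
        cderiv (fun z => co FL x₀ i z (m z)) y (𝓛.cAnchor y (l y)) • fr FL L x₀ i y) := by
    intro l m hm
    have hc := (smoothSecAt_iff h₀).1 hm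
    rw [frameBracket_congr (m' := fun z => ∑ i, co FL x₀ i z (m z) • fr FL L x₀ i z)
      (Filter.Eventually.of_forall fun _ => rfl) (eventually_eq_sum_co_smul_fr h₀ m),
      frameBracket_sum _ h₁ fun i => (hf i).smul (hc i)]
    exact Finset.sum_congr rfl fun i _ => frameBracket_smul h₁ (hc i) (hf i)
  have hij : ∀ i j, 𝓛.frameBracket x₁ (fr FL L x₀ i) (fr FL L x₀ j) y =
      𝓛.frBracket x₀ i j y := fun i j => by
    rw [frBracket, HolSec.ext_apply _ h₀]
    exact frameBracket_hol h₁ (fun _ => rfl) (fun _ => rfl) h₀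
  have e1 : ∀ j, 𝓛.frameBracket x₁ l (fr FL L x₀ j) y = ∑ i,
      (co FL x₀ i y (l y) • 𝓛.frBracket x₀ i j y -
        cderiv (fun z => co FL x₀ i z (l z)) y (𝓛.cAnchor y (fr FL L x₀ j y)) • fr FL L x₀ i y) := by
    intro j
    rw [frameBracket_swap h₁, hexp hl, ← Finset.sum_neg_distrib]
    refine Finset.sum_congr rfl fun i _ => ?_
    rw [hij, frBracket_swap 𝓛 h₀, smul_neg]
    abel
  rw [hexp hm, frameBracket, frameDer_apply, frameDer_apply, 𝓛.cAnchor_eq_sum h₀ (m y)]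
  simp only [e1, map_sum, map_smul, smul_eq_mul, Finset.sum_add_distrib, Finset.smul_sum, smul_sub,
    Finset.sum_sub_distrib, smul_smul, Finset.sum_smul]
  rw [Finset.sum_comm, Finset.sum_comm (f := fun x i => (co FL x₀ x y (m y) *
    cderiv (fun z => co FL x₀ i z (l z)) y (𝓛.cAnchor y (fr FL L x₀ x y))) • fr FL L x₀ i y)]
  simp only [mul_comm (co FL x₀ _ y (m y)) (co FL x₀ _ y (l y))]
  abel

theorem smoothSecAt_frameBracket (l m : SmoothSec EM FL L) (h₀ : y ∈ frSet FL L x₀) :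
    SmoothSecAt EM FL (𝓛.frameBracket x₀ l.1 m.1) y := by
  have h1 := SmoothSecAt.frameDer h₀ (m.2 y) (𝓛.cAnchor_mem l)
  have h2 := SmoothSecAt.frameDer h₀ (l.2 y) (𝓛.cAnchor_mem m)
  have h3 : SmoothSecAt EM FL (fun y => ∑ i, ∑ j,
      (co FL x₀ i y (l.1 y) * co FL x₀ j y (m.1 y)) • 𝓛.frBracket x₀ i j y) y :=
    SmoothSecAt.sum fun i _ => SmoothSecAt.sum fun j _ => SmoothSecAt.smul
      (((smoothSecAt_iff h₀).1 (l.2 y) i).mul_complex ((smoothSecAt_iff h₀).1 (m.2 y) j))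
      (HolSec.holSecAt_ext _ h₀).smoothSecAt
  have h4 := SmoothSecAt.smul (f := fun _ => (-1 : ℂ)) contMDiffAt_const h2
  refine ((h1.add h4).add h3).congr (Filter.Eventually.of_forall fun z => ?_)
  rw [frameBracket, sub_eq_add_neg]
  exact congrArg (· + _) (congrArg (_ + ·) (neg_one_smul ℂ _).symm)

end HolLieAlgebroid

end

/-! ### The Lie algebroid on `T^{0,1}M ⊕ L`. -/

noncomputable section

variable {EM : Type*} [NormedAddCommGroup EM] [NormedSpace ℂ EM]
  {M : Type*} [TopologicalSpace M] [ChartedSpace EM M] [IsManifold 𝓘(ℂ, EM) ∞ M]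
  {FL : Type*} [NormedAddCommGroup FL] [NormedSpace ℂ FL] {L : M → Type*}
  [TopologicalSpace (TotalSpace FL L)] [∀ x, AddCommGroup (L x)] [∀ x, Module ℂ (L x)]
  [∀ x, TopologicalSpace (L x)] [FiberBundle FL L] [VectorBundle ℂ FL L]
  {U V : Opens M} [FiniteDimensional ℂ EM] [FiniteDimensional ℂ FL]
  [ContMDiffVectorBundle ∞ FL L 𝓘(ℂ, EM)]

namespace HolAnchor

variable (ρ : HolAnchor EM FL L)

/-- The complex vector field `X + ρ(l)`. -/
def field (a : AntiholFields EM M × SmoothSec EM FL L) (x : M) : CTangent EM x :=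
  a.1.1 x + ρ.cAnchor x (a.2.1 x)

theorem field_mem (a : AntiholFields EM M × SmoothSec EM FL L) :
    ρ.field a ∈ complexFields EM M :=
  add_mem a.1.2.1 (ρ.cAnchor_mem a.2)

theorem field_add (a b : AntiholFields EM M × SmoothSec EM FL L) (x : M) :
    ρ.field (a + b) x = ρ.field a x + ρ.field b x := by
  have h : ρ.cAnchor x (a.2.1 x + b.2.1 x) = _ := map_add _ _ _
  refine (congrArg (a.1.1 x + b.1.1 x + ·) h).trans ?_
  exact add_add_add_comm _ _ _ _

theorem field_smul (f : SmoothFun EM M) (a : AntiholFields EM M × SmoothSec EM FL L) (x : M) :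
    ρ.field (f • a) x = f.1 x • ρ.field a x := by
  have h : ρ.cAnchor x (f.1 x • a.2.1 x) = _ := map_smul _ _ _
  refine (congrArg (f.1 x • a.1.1 x + ·) h).trans ?_
  exact (smul_add _ _ _).symm

/-- The anchor of `T^{0,1} M ⋈ L`. -/
def der : (AntiholFields EM M × SmoothSec EM FL L) →ₗ[SmoothFun EM M]
    Derivation ℂ (SmoothFun EM M) (SmoothFun EM M) where
  toFun a := Derivation.mk'
    { toFun := fun f => SmoothFun.of (fun x => cderiv f.1 x (ρ.field a x)) fun x =>
        contMDiffAt_cderiv_apply (ρ.field_mem a) (f.2 x)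
      map_add' := fun f g => SmoothFun.eq_of_forall fun x => by
        have h : cderiv (fun y => f.1 y + g.1 y) x = _ := cderiv_add (f.2 x).mdiff (g.2 x).mdiff
        exact LinearMap.congr_fun h (ρ.field a x)
      map_smul' := fun c f => SmoothFun.eq_of_forall fun x => by
        have h := cderiv_mul (u := fun _ => c) contMDiffAt_const.mdiff (f.2 x).mdiff (ρ.field a x)
        rw [cderiv_const, LinearMap.zero_apply, zero_mul, add_zero] at h
        exact h }
    fun f g => SmoothFun.eq_of_forall fun x => by
      refine (cderiv_mul (f.2 x).mdiff (g.2 x).mdiff (ρ.field a x)).trans ?_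
      exact congrArg (f.1 x * cderiv g.1 x (ρ.field a x) + ·) (mul_comm _ _)
  map_add' a b := Derivation.ext fun f => SmoothFun.eq_of_forall fun x =>
    (congrArg (cderiv f.1 x) (ρ.field_add a b x)).trans (map_add _ _ _)
  map_smul' g a := Derivation.ext fun f => SmoothFun.eq_of_forall fun x =>
    (congrArg (cderiv f.1 x) (ρ.field_smul g a x)).trans (map_smul _ _ _)

theorem der_apply (a : AntiholFields EM M × SmoothSec EM FL L) (f : SmoothFun EM M) (x : M) :
    (ρ.der a f).1 x = cderiv f.1 x (ρ.field a x) := rfl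

/-- The anchor is injective on `T^{0,1}M`. Consequently every identity between elements of the sum
reduces to one in `L` and one between derivations. -/
theorem eq_of_der [T2Space M] {a b : AntiholFields EM M × SmoothSec EM FL L} (h2 : a.2 = b.2)
    (h : ρ.der a = ρ.der b) : a = b := by
  refine Prod.ext (AntiholFields.eq_of_cderiv fun f x => ?_) h2
  have h1 := congrArg (fun D => (D f).1 x) h
  simp only [der_apply, field, h2, map_add] at h1
  exact add_right_cancel h1

end HolAnchor

namespace HolLieAlgebroid

variable (𝓛 : HolLieAlgebroid EM FL L)

/-- The extension of the bracket of holomorphic sections to smooth sections. -/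
def smoothBracket (l m : SmoothSec EM FL L) : SmoothSec EM FL L :=
  SmoothSec.of (fun x => 𝓛.frameBracket x l.1 m.1 x) fun x => by
    -- The frame is centred at the moving point; near x the fixed frame around x gives the same
    -- bracket.
    refine (smoothSecAt_frameBracket (𝓛 := 𝓛) l m (mem_frSet x)).congr ?_
    filter_upwards [(frSet FL L x).isOpen.mem_nhds (mem_frSet x)] with y hy
    exact frameBracket_change hy (mem_frSet y) (l.2 y) (m.2 y)

/-- The component in `L` of the bracket of `T^{0,1} M ⋈ L`. -/
def bracketSnd (a b : AntiholFields EM M × SmoothSec EM FL L) : SmoothSec EM FL L :=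
  dbar a.1 b.2 - dbar b.1 a.2 + 𝓛.smoothBracket a.2 b.2

variable {𝓛} {a b c : AntiholFields EM M × SmoothSec EM FL L} {x x₀ : M}

theorem bracketSnd_apply_self : (𝓛.bracketSnd a b).1 x = dbarAt (F := FL) b.2.1 x (a.1.1 x) -
    dbarAt (F := FL) a.2.1 x (b.1.1 x) + 𝓛.frameBracket x a.2.1 b.2.1 x := rfl

theorem bracketSnd_apply : (𝓛.bracketSnd a b).1 x = frameDer FL x b.2.1 x (𝓛.field a x) -
    frameDer FL x a.2.1 x (𝓛.field b x) + ∑ i, ∑ j,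
      (co FL x i x (a.2.1 x) * co FL x j x (b.2.1 x)) • 𝓛.frBracket x i j x := by
  rw [bracketSnd_apply_self, dbarAt_eq_self (a.2.2 x), dbarAt_eq_self (b.2.2 x), frameBracket,
    HolAnchor.field, HolAnchor.field, map_add, map_add]
  abel

theorem bracketSnd_swap : 𝓛.bracketSnd a b = -𝓛.bracketSnd b a := by
  refine SmoothSec.eq_of_forall fun x => ?_
  rw [SmoothSec.neg_apply, bracketSnd_apply_self, bracketSnd_apply_self,
    frameBracket_swap (mem_frSet x)]
  abel

theorem bracketSnd_add : 𝓛.bracketSnd a (b + c) = 𝓛.bracketSnd a b + 𝓛.bracketSnd a c := by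
  refine SmoothSec.eq_of_forall fun x => ?_
  rw [SmoothSec.add_apply, bracketSnd_apply_self, bracketSnd_apply_self, bracketSnd_apply_self]
  have h1 : dbarAt (F := FL) (b + c).2.1 x (a.1.1 x) = _ := dbarAt_add (b.2.2 x) (c.2.2 x) _
  have h2 : dbarAt (F := FL) a.2.1 x ((b + c).1.1 x) = _ := map_add _ (b.1.1 x) (c.1.1 x)
  have h3 : 𝓛.frameBracket x a.2.1 (b + c).2.1 x = _ :=
    frameBracket_add (mem_frSet x) (b.2.2 x) (c.2.2 x)
  rw [h1, h2, h3]
  abel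

theorem bracketSnd_smul (f : SmoothFun EM M) :
    𝓛.bracketSnd a (f • b) = 𝓛.der a f • b.2 + f • 𝓛.bracketSnd a b := by
  refine SmoothSec.eq_of_forall fun x => ?_
  rw [SmoothSec.add_apply, SmoothSec.smul_apply, SmoothSec.smul_apply, bracketSnd_apply_self,
    bracketSnd_apply_self, 𝓛.der_apply, HolAnchor.field]
  have h1 : dbarAt (F := FL) (f • b).2.1 x (a.1.1 x) = _ := dbarAt_smul (f.2 x) (b.2.2 x) _
  have h2 : dbarAt (F := FL) a.2.1 x ((f • b).1.1 x) = _ := map_smul _ (f.1 x) (b.1.1 x)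
  have h3 : 𝓛.frameBracket x a.2.1 (f • b).2.1 x = _ :=
    frameBracket_smul (mem_frSet x) (f.2 x) (b.2.2 x)
  rw [h1, h2, h3, map_add]
  simp only [smul_add, smul_sub, add_smul]
  abel

theorem bracketSnd_hol {l m : HolSec EM FL L U} (hl : ∀ z : U, a.2.1 z = l.1 z)
    (hm : ∀ z : U, b.2.1 z = m.1 z) (z : U) :
    (𝓛.bracketSnd a b).1 z = (𝓛.bracket U l m).1 z := by
  rw [bracketSnd_apply_self, dbarAt_hol (m.holSecAt_of_eq hm z.2) (a.1.2.2 z),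
    dbarAt_hol (l.holSecAt_of_eq hl z.2) (b.1.2.2 z), sub_zero, zero_add]
  exact frameBracket_hol (mem_frSet _) hl hm z.2

/-- The commutator of two derivatives of a holomorphic function along frame sections. -/
theorem cderiv_frBracket {u : M → ℂ} {y : M} (hu : ∀ᶠ z in 𝓝 y, ContMDiffAt 𝓘(ℂ, EM) 𝓘(ℂ, ℂ) ∞ u z)
    (hy : y ∈ frSet FL L x₀) (i j) :
    cderiv u y (𝓛.cAnchor y (𝓛.frBracket x₀ i j y)) =
      cderiv (fun z => cderiv u z (𝓛.cAnchor z (fr FL L x₀ j z))) y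
        (𝓛.cAnchor y (fr FL L x₀ i y)) -
      cderiv (fun z => cderiv u z (𝓛.cAnchor z (fr FL L x₀ i z))) y
        (𝓛.cAnchor y (fr FL L x₀ j y)) := by
  obtain ⟨O, hyO, hO⟩ := exists_opens_of_eventually hu
  -- On this set both the function and the frame are holomorphic, so the anchor axiom `act_bracket`
  -- of `𝓛` applies to them.
  let W : Opens M := O ⊓ frSet FL L x₀
  have hW : W ≤ frSet FL L x₀ := inf_le_right
  have hyW : y ∈ W := ⟨hyO, hy⟩
  let u' : HolFun EM W := HolFun.of u fun z hz => hO z hz.1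
  have h1 : ∀ k, ∀ z : W, (𝓛.act (HolSec.res hW (frHol EM FL L x₀ k)) u').1 z =
      cderiv u z (𝓛.cAnchor z (fr FL L x₀ k z)) := fun k z => 𝓛.act_apply _ u' (fun _ => rfl) z
  have h2 := 𝓛.act_bracket W (HolSec.res hW (frHol EM FL L x₀ i))
    (HolSec.res hW (frHol EM FL L x₀ j)) u'
  have h3 := congrArg (fun f : HolFun EM W => f.1 ⟨y, hyW⟩) h2
  have h4 : (𝓛.act (𝓛.bracket W (HolSec.res hW (frHol EM FL L x₀ i))
      (HolSec.res hW (frHol EM FL L x₀ j))) u').1 ⟨y, hyW⟩ =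
      cderiv u y (𝓛.cAnchor y (𝓛.frBracket x₀ i j y)) := by
    rw [𝓛.bracket_res, 𝓛.act_apply _ u' (fun _ => rfl), frBracket, HolSec.ext_apply _ hy]
    rfl
  have h5 : ∀ (l : HolSec EM FL L W) k, (𝓛.act l (𝓛.act (HolSec.res hW (frHol EM FL L x₀ k))
      u')).1 ⟨y, hyW⟩ = cderiv (fun z => cderiv u z (𝓛.cAnchor z (fr FL L x₀ k z))) y
        (𝓛.cAnchor y (l.1 ⟨y, hyW⟩)) := fun l k =>
    𝓛.act_apply l _ (u := fun z => cderiv u z (𝓛.cAnchor z (fr FL L x₀ k z))) (h1 k) ⟨y, hyW⟩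
  refine h4.symm.trans (h3.trans ?_)
  exact congrArg₂ (· - ·) (h5 _ j) (h5 _ i)

theorem cderiv_sum {ι : Type*} (S : Finset ι) {u : ι → M → ℂ} {y : M}
    (hu : ∀ i, ContMDiffAt 𝓘(ℝ, EM) 𝓘(ℝ, ℂ) ∞ (u i) y) (Z : CTangent EM y) :
    cderiv (fun z => ∑ i ∈ S, u i z) y Z = ∑ i ∈ S, cderiv (u i) y Z := by
  classical
  induction S using Finset.induction_on with
  | empty => simp [cderiv_const]
  | insert i S hi ih =>
    simp only [Finset.sum_insert hi]
    rw [cderiv_add (hu i).mdiff (contMDiffAt_finsetSum fun i _ => hu i).mdiff,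
      LinearMap.add_apply, ih]

/-- On holomorphic functions, the anchor of the bracket is the commutator of the anchors. -/
theorem cderiv_bracketSnd {u : M → ℂ} (hu : ∀ᶠ z in 𝓝 x, ContMDiffAt 𝓘(ℂ, EM) 𝓘(ℂ, ℂ) ∞ u z) :
    cderiv u x (𝓛.cAnchor x ((𝓛.bracketSnd a b).1 x)) =
      cderiv (fun y => cderiv u y (𝓛.field b y)) x (𝓛.field a x) -
        cderiv (fun y => cderiv u y (𝓛.field a y)) x (𝓛.field b x) := by
  have hx := mem_frSet (F := FL) (E := L) x
  have hg := fun j => 𝓛.contMDiffAt_cderiv (holSecAt_fr (EM := EM) hx j) hu.self_of_nhds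
  set g := fun j z => cderiv u z (𝓛.cAnchor z (fr FL L x j z)) with eg
  -- As u is holomorphic, only the `L`-part of b acts on it, giving Σ b_j g_j near x. Each g_j is
  -- holomorphic as well, so in the second derivative only the `L`-part of a acts on g_j. After
  -- antisymmetrization the double sums are derivatives along the brackets of the frame.
  have key : ∀ a b : AntiholFields EM M × SmoothSec EM FL L,
      cderiv (fun y => cderiv u y (𝓛.field b y)) x (𝓛.field a x) =
        cderiv u x (𝓛.cAnchor x (frameDer FL x b.2.1 x (𝓛.field a x))) +
        ∑ i, ∑ j, co FL x i x (a.2.1 x) * co FL x j x (b.2.1 x) *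
          cderiv (g j) x (𝓛.cAnchor x (fr FL L x i x)) := by
    intro a b
    have hb := (smoothSecAt_iff hx).1 (b.2.2 x)
    have h1 : ∀ᶠ y in 𝓝 x, cderiv u y (𝓛.field b y) = ∑ j, co FL x j y (b.2.1 y) * g j y := by
      filter_upwards [hu, (frSet FL L x).isOpen.mem_nhds hx] with y hy hyx
      rw [HolAnchor.field, map_add, cderiv_antihol (hy.mdifferentiableAt (by simp)) (b.1.2.2 y),
        zero_add, 𝓛.cAnchor_eq_sum hyx, map_sum]
      simp only [map_smul, smul_eq_mul, g]
    have h2 : ∀ j, cderiv (g j) x (𝓛.field a x) =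
        ∑ i, co FL x i x (a.2.1 x) * cderiv (g j) x (𝓛.cAnchor x (fr FL L x i x)) := fun j => by
      rw [HolAnchor.field, map_add, cderiv_antihol ((hg j).mdifferentiableAt (by simp)) (a.1.2.2 x),
        zero_add, 𝓛.cAnchor_eq_sum hx, map_sum]
      simp only [map_smul, smul_eq_mul]
    rw [cderiv_congr h1, cderiv_sum _ fun j => (hb j).mul_complex (hg j).real_of_complex,
      frameDer_apply, map_sum, map_sum, Finset.sum_comm, ← Finset.sum_add_distrib]
    refine Finset.sum_congr rfl fun j _ => ?_
    rw [cderiv_mul (hb j).mdiff (hg j).real_of_complex.mdiff, h2, Finset.mul_sum, map_smul,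
      map_smul, smul_eq_mul, add_comm]
    refine congrArg₂ (· + ·) rfl (Finset.sum_congr rfl fun i _ => ?_)
    ring
  rw [key a b, key b a, bracketSnd_apply, map_add, map_add, map_sub, map_sub, add_sub_add_comm]
  congr 1
  rw [Finset.sum_comm (f := fun i j => co FL x i x (b.2.1 x) * co FL x j x (a.2.1 x) *
    cderiv (g j) x (𝓛.cAnchor x (fr FL L x i x))), ← Finset.sum_sub_distrib, map_sum, map_sum]
  refine Finset.sum_congr rfl fun i _ => ?_
  rw [← Finset.sum_sub_distrib, map_sum, map_sum]
  refine Finset.sum_congr rfl fun j _ => ?_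
  rw [map_smul, map_smul, cderiv_frBracket hu hx, smul_eq_mul, mul_sub]
  rw [mul_comm (co FL x j x (b.2.1 x)) (co FL x i x (a.2.1 x))]

-- The component P is forced: it is the commutator of the two anchors minus the anchor of the
-- `L`-component. By `cderiv_bracketSnd` this difference kills holomorphic functions, so it is of
-- type (0,1).
variable (𝓛) in
theorem exists_bracketFst (a b : AntiholFields EM M × SmoothSec EM FL L) :
    ∃ P : AntiholFields EM M, ∀ (x : M) (u : M → ℂ), ContMDiffAt 𝓘(ℝ, EM) 𝓘(ℝ, ℂ) ∞ u x →
      cderiv u x (𝓛.field (P, 𝓛.bracketSnd a b) x) =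
        cderiv (fun y => cderiv u y (𝓛.field b y)) x (𝓛.field a x) -
        cderiv (fun y => cderiv u y (𝓛.field a y)) x (𝓛.field b x) := by
  obtain ⟨B, hB, h⟩ := exists_commutator (𝓛.field_mem a) (𝓛.field_mem b)
  refine ⟨⟨B - fun x => 𝓛.cAnchor x ((𝓛.bracketSnd a b).1 x),
    sub_mem hB (𝓛.cAnchor_mem _), fun x => isAntiholVec_of_forall_cderiv_eq_zero fun u hu => ?_⟩,
    fun x u hu => ?_⟩
  · rw [Pi.sub_apply, map_sub, h x u hu.self_of_nhds.real_of_complex, cderiv_bracketSnd hu,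
      sub_self]
  · rw [← h x u hu, HolAnchor.field]
    congr 1
    exact sub_add_cancel _ _

variable (𝓛) in
/-- The component in `T^{0,1} M` of the bracket of `T^{0,1} M ⋈ L`. -/
def bracketFst (a b : AntiholFields EM M × SmoothSec EM FL L) : AntiholFields EM M :=
  (𝓛.exists_bracketFst a b).choose

variable (𝓛) in
/-- The bracket of `T^{0,1} M ⋈ L`. -/
def sumBracket (a b : AntiholFields EM M × SmoothSec EM FL L) :
    AntiholFields EM M × SmoothSec EM FL L :=
  (𝓛.bracketFst a b, 𝓛.bracketSnd a b)

theorem cderiv_sumBracket {u : M → ℂ} (hu : ContMDiffAt 𝓘(ℝ, EM) 𝓘(ℝ, ℂ) ∞ u x) :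
    cderiv u x (𝓛.field (𝓛.sumBracket a b) x) =
      cderiv (fun y => cderiv u y (𝓛.field b y)) x (𝓛.field a x) -
        cderiv (fun y => cderiv u y (𝓛.field a y)) x (𝓛.field b x) :=
  (𝓛.exists_bracketFst a b).choose_spec x u hu

theorem der_sumBracket : 𝓛.der (𝓛.sumBracket a b) = ⁅𝓛.der a, 𝓛.der b⁆ :=
  Derivation.ext fun f => SmoothFun.eq_of_forall fun x => by
    rw [Derivation.commutator_apply]
    exact cderiv_sumBracket (f.2 x)

variable [T2Space M]

/-- By `eq_of_der` it is enough to know the `L`-component and the image under the anchor, where the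
claim concerns commutators of derivations. Additivity and the Leibniz rule follow in the same
manner. -/
theorem sumBracket_swap : 𝓛.sumBracket a b = -𝓛.sumBracket b a := by
  refine 𝓛.eq_of_der bracketSnd_swap ?_
  rw [map_neg, der_sumBracket, der_sumBracket, lie_skew]

theorem sumBracket_add :
    𝓛.sumBracket a (b + c) = 𝓛.sumBracket a b + 𝓛.sumBracket a c := by
  refine 𝓛.eq_of_der bracketSnd_add ?_
  rw [map_add, der_sumBracket, der_sumBracket, der_sumBracket, map_add, lie_add]

theorem sumBracket_smul (f : SmoothFun EM M) :
    𝓛.sumBracket a (f • b) = 𝓛.der a f • b + f • 𝓛.sumBracket a b := by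
  refine 𝓛.eq_of_der (bracketSnd_smul f) ?_
  rw [map_add, der_sumBracket, map_smul, map_smul, map_smul, der_sumBracket]
  ext g : 1
  simp only [Derivation.commutator_apply, Derivation.add_apply, Derivation.smul_apply, smul_eq_mul,
    Derivation.leibniz]
  ring

theorem sumBracket_smul_complex (k : ℂ) : 𝓛.sumBracket a (k • b) = k • 𝓛.sumBracket a b := by
  rw [← algebraMap_smul (SmoothFun EM M) k b, sumBracket_smul, Derivation.map_algebraMap, zero_smul,
    zero_add, algebraMap_smul]

variable (𝓛) in
/-- The bracket of `T^{0,1} M ⋈ L`, as a bilinear map. -/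
def sumBracketₗ : (AntiholFields EM M × SmoothSec EM FL L) →ₗ[ℂ]
    (AntiholFields EM M × SmoothSec EM FL L) →ₗ[ℂ] (AntiholFields EM M × SmoothSec EM FL L) :=
  LinearMap.mk₂ ℂ 𝓛.sumBracket
    (fun a b c => by
      rw [sumBracket_swap, sumBracket_add, neg_add, ← sumBracket_swap, ← sumBracket_swap])
    (fun k a b => by
      rw [sumBracket_swap, sumBracket_smul_complex, sumBracket_swap (a := a), smul_neg])
    (fun _ _ _ => sumBracket_add) fun k _ _ => sumBracket_smul_complex k

variable (𝓛) in
/-- The Jacobiator of the bracket. -/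
def jacobiator (a b c : AntiholFields EM M × SmoothSec EM FL L) :
    AntiholFields EM M × SmoothSec EM FL L :=
  𝓛.sumBracketₗ a (𝓛.sumBracketₗ b c) - 𝓛.sumBracketₗ (𝓛.sumBracketₗ a b) c -
    𝓛.sumBracketₗ b (𝓛.sumBracketₗ a c)

theorem sumBracketₗ_swap : 𝓛.sumBracketₗ a b = -𝓛.sumBracketₗ b a := sumBracket_swap

theorem jacobiator_swap_left : 𝓛.jacobiator a b c = -𝓛.jacobiator b a c := by
  rw [jacobiator, jacobiator, sumBracketₗ_swap (a := b) (b := a), map_neg, LinearMap.neg_apply]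
  abel

theorem jacobiator_swap_right : 𝓛.jacobiator a b c = -𝓛.jacobiator a c b := by
  rw [jacobiator, jacobiator, sumBracketₗ_swap (a := c) (b := b),
    sumBracketₗ_swap (a := 𝓛.sumBracketₗ a b) (b := c),
    sumBracketₗ_swap (a := 𝓛.sumBracketₗ a c) (b := b), map_neg]
  abel

theorem jacobiator_add {c' : AntiholFields EM M × SmoothSec EM FL L} :
    𝓛.jacobiator a b (c + c') = 𝓛.jacobiator a b c + 𝓛.jacobiator a b c' := by
  simp only [jacobiator, map_add]
  abel

/-- The terms in which f is differentiated once cancel in pairs; those with two derivatives cancel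
because the anchor of [a, b] is the commutator of the anchors. -/
theorem jacobiator_smul (f : SmoothFun EM M) : 𝓛.jacobiator a b (f • c) = f • 𝓛.jacobiator a b c := by
  have h' : ∀ a b (f : SmoothFun EM M), 𝓛.sumBracketₗ a (f • b) =
      𝓛.der a f • b + f • 𝓛.sumBracketₗ a b := fun a b f => sumBracket_smul f
  have h2 : 𝓛.der (𝓛.sumBracketₗ a b) = ⁅𝓛.der a, 𝓛.der b⁆ := der_sumBracket
  simp only [jacobiator, h', map_add, h2, Derivation.commutator_apply, smul_sub, sub_smul]
  abel

theorem der_jacobiator : 𝓛.der (𝓛.jacobiator a b c) = 0 := by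
  have h2 : ∀ a b, 𝓛.der (𝓛.sumBracketₗ a b) = ⁅𝓛.der a, 𝓛.der b⁆ := fun a b => der_sumBracket
  rw [jacobiator, map_sub, map_sub, h2, h2, h2, h2, h2, h2, leibniz_lie, add_sub_cancel_left,
    sub_self]

/-- A tensorial map on `T^{0,1} M ⊕ L` that vanishes on the pairs `(X, l)` with `l` holomorphic near
a point is zero. -/
theorem tensorial_prod_eq_zero {N : Type*} [AddCommGroup N] [Module ℂ N]
    (φ : (AntiholFields EM M × SmoothSec EM FL L) →+ N)
    (h : ∀ (f : SmoothFun EM M) s, φ (f • s) = f.1 x • φ s)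
    (h0 : ∀ s, IsHolNear s.2 x → φ s = 0) (s) : φ s = 0 := by
  have h1 : s = AddMonoidHom.inl _ _ s.1 + AddMonoidHom.inr _ _ s.2 := by simp
  rw [h1, map_add, h0 (AddMonoidHom.inl _ _ s.1) IsHolNear.zero, zero_add]
  refine tensorial_eq_zero (x := x) (φ.comp (AddMonoidHom.inr _ _)) (fun f l => ?_) (fun l hl => ?_) s.2
  · rw [AddMonoidHom.comp_apply, AddMonoidHom.comp_apply, ← h]
    congr 1
  · exact h0 _ hl

/-- No condition is needed on the `T^{0,1}`-components: when the `L`-components are holomorphic near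
x, the ∂̄-terms vanish and the brackets, also the iterated ones, have the brackets of `𝓛` as
`L`-components. The Jacobi identity of `𝓛` concludes. -/
theorem jacobiator_hol (ha : IsHolNear a.2 x) (hb : IsHolNear b.2 x) (hc : IsHolNear c.2 x) :
    (𝓛.jacobiator a b c).2.1 x = 0 := by
  obtain ⟨W, hxW, hW⟩ := exists_opens_of_eventually (ha.and (hb.and hc))
  have e : ∀ {a b} {l m : HolSec EM FL L W}, (∀ z : W, a.2.1 z = l.1 z) →
      (∀ z : W, b.2.1 z = m.1 z) → ∀ z : W, (𝓛.sumBracketₗ a b).2.1 z = (𝓛.bracket W l m).1 z :=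
    fun h1 h2 => bracketSnd_hol h1 h2
  let a' : HolSec EM FL L W := HolSec.of a.2.1 fun z hz => (hW z hz).1
  let b' : HolSec EM FL L W := HolSec.of b.2.1 fun z hz => (hW z hz).2.1
  let c' : HolSec EM FL L W := HolSec.of c.2.1 fun z hz => (hW z hz).2.2
  have ea : ∀ z : W, a.2.1 z = a'.1 z := fun _ => rfl
  have eb : ∀ z : W, b.2.1 z = b'.1 z := fun _ => rfl
  have ec : ∀ z : W, c.2.1 z = c'.1 z := fun _ => rfl
  have h1 := e ea (e eb ec) ⟨x, hxW⟩
  have h2 := e (e ea eb) ec ⟨x, hxW⟩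
  have h3 := e eb (e ea ec) ⟨x, hxW⟩
  have h4 : (𝓛.jacobiator a b c).2.1 x = (𝓛.sumBracketₗ a (𝓛.sumBracketₗ b c)).2.1 x -
    (𝓛.sumBracketₗ (𝓛.sumBracketₗ a b) c).2.1 x - (𝓛.sumBracketₗ b (𝓛.sumBracketₗ a c)).2.1 x := rfl
  rw [h4]
  refine (congrArg₂ (· - ·) (congrArg₂ (· - ·) h1 h2) h3).trans ?_
  rw [𝓛.jacobi, HolSec.add_apply]
  abel

/-- The `L`-component is tensorial in the last argument and the Jacobiator is antisymmetric, so the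
arguments are freed from holomorphy one at a time. The `T^{0,1}`-component then vanishes by
`eq_of_der`, since commutators of derivations satisfy the Jacobi identity. -/
theorem jacobiator_eq_zero : 𝓛.jacobiator a b c = 0 := by
  have hJ : ∀ x a b, (∀ c : AntiholFields EM M × SmoothSec EM FL L, IsHolNear c.2 x →
      (𝓛.jacobiator a b c).2.1 x = 0) → ∀ c, (𝓛.jacobiator a b c).2.1 x = 0 := by
    intro x a b h0 c
    let φ : (AntiholFields EM M × SmoothSec EM FL L) →+ L x := AddMonoidHom.mk'
      (fun c => (𝓛.jacobiator a b c).2.1 x) fun c c' => by rw [jacobiator_add]; rfl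
    refine tensorial_prod_eq_zero φ (fun f c => ?_) h0 c
    change (𝓛.jacobiator a b (f • c)).2.1 x = _
    rw [jacobiator_smul]
    rfl
  have h1 : ∀ x {a b : AntiholFields EM M × SmoothSec EM FL L} c, IsHolNear a.2 x →
      IsHolNear b.2 x → (𝓛.jacobiator a b c).2.1 x = 0 := fun x a b c ha hb =>
    hJ x a b (fun c hc => jacobiator_hol ha hb hc) c
  have hneg : ∀ x {v w : AntiholFields EM M × SmoothSec EM FL L}, v = -w → w.2.1 x = 0 →
      v.2.1 x = 0 := by
    rintro x _ w rfl h
    change -(w.2.1 x) = 0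
    rw [h, neg_zero]
  have h2 : ∀ x {a : AntiholFields EM M × SmoothSec EM FL L} b c, IsHolNear a.2 x →
      (𝓛.jacobiator a b c).2.1 x = 0 := fun x a b c ha =>
    hJ x a b (fun c hc => hneg x jacobiator_swap_right (h1 x b ha hc)) c
  have h3 : ∀ x, (𝓛.jacobiator a b c).2.1 x = 0 := fun x =>
    hJ x a b (fun c hc => hneg x jacobiator_swap_right (hneg x jacobiator_swap_left
      (h2 x a b hc))) c
  exact 𝓛.eq_of_der (SmoothSec.eq_of_forall h3) (der_jacobiator.trans (map_zero _).symm)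

variable (𝓛) in
/-- The Lie algebroid `T^{0,1} M ⋈ L`. -/
def sumAlgebroid : LieAlgebroid (SmoothFun EM M) (AntiholFields EM M × SmoothSec EM FL L) where
  bracket := 𝓛.sumBracketₗ
  anchor := 𝓛.der
  bracket_self x := by
    have h : 𝓛.sumBracketₗ x x = -𝓛.sumBracketₗ x x := sumBracket_swap
    have h2 : (2 : ℂ) • 𝓛.sumBracketₗ x x = 0 := by
      rw [two_smul, ← eq_neg_iff_add_eq_zero]
      exact h
    rw [← one_smul ℂ (𝓛.sumBracketₗ x x), ← inv_mul_cancel₀ (two_ne_zero (α := ℂ)), mul_smul, h2,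
      smul_zero]
  jacobi x y z := by
    have h : 𝓛.jacobiator x y z = 0 := jacobiator_eq_zero
    rw [jacobiator, sub_sub, sub_eq_zero] at h
    exact h
  anchor_bracket _ _ := der_sumBracket
  leibniz _ f _ := sumBracket_smul f

/-- For `0 ⊕ L`: fields of type (1,0) kill the conjugates of holomorphic functions, hence so does
their commutator and so does the `T^{0,1}`-component of the bracket; a vector of type (0,1) with
this property is zero. For `T^{0,1}M ⊕ 0` every term of the `L`-component contains a zero section.
-/
theorem isMatchedSum_sumAlgebroid : LieAlgebroid.IsMatchedSum 𝓛.sumAlgebroid where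
  left X Y := SmoothSec.eq_of_forall fun x => by
    have h : (𝓛.bracketSnd (X, 0) (Y, 0)).1 x = 0 := by
      rw [bracketSnd_apply_self]
      have h1 : dbarAt (F := FL) (0 : SmoothSec EM FL L).1 x = 0 := LinearMap.ext fun Z => by
        rw [dbarAt_eq_self ((0 : SmoothSec EM FL L).2 x)]
        exact LinearMap.congr_fun frameDer_zero Z
      have h2 : 𝓛.frameBracket x (0 : SmoothSec EM FL L).1 (0 : SmoothSec EM FL L).1 x = 0 :=
        frameBracket_zero
      rw [h1, h2, LinearMap.zero_apply, LinearMap.zero_apply, sub_self, add_zero]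
    exact h
  right l m := Subtype.ext (funext fun x => by
    refine IsAntiholVec.eq_zero_of_conj ((𝓛.bracketFst (0, l) (0, m)).2.2 x) fun u hu => ?_
    have hz : ∀ (n : SmoothSec EM FL L) y, 𝓛.field (0, n) y = 𝓛.cAnchor y (n.1 y) := fun n y =>
      zero_add (𝓛.cAnchor y (n.1 y))
    have h0 : ∀ v : Π y, L y, ∀ᶠ y in 𝓝 x, cderiv (fun y => (starRingEnd ℂ) (u y)) y (𝓛.cAnchor y (v y)) = 0 := by
      intro v
      filter_upwards [hu] with y hy
      exact cderiv_conj_holToComplex (hy.mdifferentiableAt (by simp)) _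
    have h1 := cderiv_sumBracket (𝓛 := 𝓛) (a := (0, l)) (b := (0, m)) (x := x)
      (u := fun y => (starRingEnd ℂ) (u y)) (ContMDiffAt.comp (I' := 𝓘(ℝ, ℂ)) x
        (Complex.conjCLE : ℂ →L[ℝ] ℂ).contMDiff.contMDiffAt hu.self_of_nhds.real_of_complex)
    simp only [hz] at h1
    rw [cderiv_congr (h0 m.1), cderiv_congr (h0 l.1), cderiv_const, LinearMap.zero_apply,
      LinearMap.zero_apply, sub_self, HolAnchor.field, map_add,
      (h0 (𝓛.sumBracket (0, l) (0, m)).2.1).self_of_nhds, add_zero] at h1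
    exact h1)

end HolLieAlgebroid

end

/-! ### Existence and uniqueness of the triad. -/

noncomputable section

variable {EM : Type*} [NormedAddCommGroup EM] [NormedSpace ℂ EM]
  {M : Type*} [TopologicalSpace M] [ChartedSpace EM M] [IsManifold 𝓘(ℂ, EM) ∞ M]
  {FL : Type*} [NormedAddCommGroup FL] [NormedSpace ℂ FL] {L : M → Type*}
  [TopologicalSpace (TotalSpace FL L)] [∀ x, AddCommGroup (L x)] [∀ x, Module ℂ (L x)]
  [∀ x, TopologicalSpace (L x)] [FiberBundle FL L] [VectorBundle ℂ FL L]
  {FE : Type*} [NormedAddCommGroup FE] [NormedSpace ℂ FE] {E : M → Type*}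
  [TopologicalSpace (TotalSpace FE E)] [∀ x, AddCommGroup (E x)] [∀ x, Module ℂ (E x)]
  [∀ x, TopologicalSpace (E x)] [FiberBundle FE E] [VectorBundle ℂ FE E]
  {U V : Opens M} [FiniteDimensional ℂ EM] [FiniteDimensional ℂ FL] [FiniteDimensional ℂ FE]
  [ContMDiffVectorBundle ∞ FL L 𝓘(ℂ, EM)] [ContMDiffVectorBundle ∞ FE E 𝓘(ℂ, EM)] [T2Space M]

namespace HolLieAlgebroid

variable (𝓛 : HolLieAlgebroid EM FL L)

theorem der_inl_apply (X : AntiholFields EM M) (f : SmoothFun EM M) (x : M) :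
    (𝓛.der (X, 0) f).1 x = cderiv f.1 x (X.1 x) := by
  rw [𝓛.der_apply, HolAnchor.field]
  congr 1
  exact (congrArg (X.1 x + ·) (map_zero (𝓛.cAnchor x))).trans (add_zero _)

theorem dbar_smul (X : AntiholFields EM M) (f : SmoothFun EM M) (e : SmoothSec EM FE E) :
    dbar X (f • e) = f • dbar X e + 𝓛.der (X, 0) f • e :=
  SmoothSec.eq_of_forall fun x => by
    rw [dbar_smul_apply, SmoothSec.add_apply, SmoothSec.smul_apply, SmoothSec.smul_apply,
      der_inl_apply]

theorem dbar_apply_of_eventually_zero {X : AntiholFields EM M} {e : SmoothSec EM FE E} {x : M}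
    (he : ∀ᶠ y in 𝓝 x, e.1 y = 0) : (dbar X e).1 x = 0 := by
  rw [dbar_apply, dbarAt_eq_self (e.2 x), frameDer_congr x he]
  exact LinearMap.congr_fun frameDer_zero _

variable (FE E) in
/-- The triad of the Atiyah class. -/
def atiyahTriad : LieAlgebroid.MatchedTriad (SmoothFun EM M) (AntiholFields EM M)
    (SmoothSec EM FL L) (SmoothSec EM FE E) where
  alg := 𝓛.sumAlgebroid
  matched := isMatchedSum_sumAlgebroid
  conn := { cov := dbar, leibniz := 𝓛.dbar_smul }
  flat X Y := by
    refine LinearMap.ext fun e => SmoothSec.eq_of_forall fun x => ?_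
    let C : LieAlgebroid.Connection (SmoothSec EM FE E)
      (isMatchedSum_sumAlgebroid (𝓛 := 𝓛)).leftAlgebroid := { cov := dbar, leibniz := 𝓛.dbar_smul }
    let φ : SmoothSec EM FE E →+ E x :=
      -- The curvature is tensorial in e, and for e holomorphic near x each of its three terms is ∂̄
      -- of a section that is zero near x or ∂̄ of e itself.
      (SmoothSec.eval x).comp (C.curvature X Y).toAddMonoidHom
    refine tensorial_eq_zero (x := x) φ (fun f e => ?_) (fun e he => ?_) e
    · change (C.curvature X Y (f • e)).1 x = _
      rw [C.curvature_apply_smul]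
      rfl
    · change (dbar X (dbar Y e)).1 x - (dbar Y (dbar X e)).1 x - (dbar _ e).1 x = 0
      rw [dbar_apply_of_eventually_zero (dbar_apply_hol he),
        dbar_apply_of_eventually_zero (dbar_apply_hol he), (dbar_apply_hol he).self_of_nhds,
        sub_self, sub_self]

theorem isAtiyahTriad_atiyahTriad : 𝓛.IsAtiyahTriad (𝓛.atiyahTriad FE E) where
  anchor _ _ _ _ := rfl
  bott X l x := by
    have h1 : (𝓛.bracketSnd (X, 0) (0, l)).1 x = dbarAt (F := FL) l.1 x (X.1 x) := by
      rw [bracketSnd_apply_self]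
      have h1 : dbarAt (F := FL) (0 : SmoothSec EM FL L).1 x ((0 : AntiholFields EM M).1 x) = 0 :=
        map_zero _
      have h2 : 𝓛.frameBracket x (0 : SmoothSec EM FL L).1 l.1 x = 0 := by
        rw [frameBracket_swap (mem_frSet x), neg_eq_zero]
        exact frameBracket_zero
      rw [h1, h2, sub_zero, add_zero]
    exact h1
  bracket _ _ _ _ _ hl hm z := bracketSnd_hol hl hm z
  conn _ _ _ := rfl

variable {𝓛} {T : LieAlgebroid.MatchedTriad (SmoothFun EM M) (AntiholFields EM M)
  (SmoothSec EM FL L) (SmoothSec EM FE E)}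

theorem IsAtiyahTriad.anchor_eq (hT : 𝓛.IsAtiyahTriad T) : T.alg.anchor = 𝓛.der :=
  LinearMap.ext fun a => Derivation.ext fun f => SmoothFun.eq_of_forall fun x =>
    hT.anchor a.1 a.2 f x

/-- The axioms determine each piece: [X, Y] has no `L`-component, the mixed brackets are ∂̄ of
holomorphic sections and vanish at x, and the bracket of the `L`-parts is that of `𝓛`. -/
theorem IsAtiyahTriad.bracket_hol (hT : 𝓛.IsAtiyahTriad T) {x : M}
    {a b : AntiholFields EM M × SmoothSec EM FL L} (ha : IsHolNear a.2 x) (hb : IsHolNear b.2 x) :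
    (T.alg.bracket a b).2.1 x = (𝓛.bracketSnd a b).1 x := by
  obtain ⟨W, hxW, hW⟩ := exists_opens_of_eventually (ha.and hb)
  let a' : HolSec EM FL L W := HolSec.of a.2.1 fun z hz => (hW z hz).1
  let b' : HolSec EM FL L W := HolSec.of b.2.1 fun z hz => (hW z hz).2
  have h1 := hT.bracket a.2 b.2 W a' b' (fun _ => rfl) (fun _ => rfl) ⟨x, hxW⟩
  have h2 := bracketSnd_hol (𝓛 := 𝓛) (a := a) (b := b) (l := a') (m := b') (fun _ => rfl)
    (fun _ => rfl) ⟨x, hxW⟩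
  have e : ∀ a : AntiholFields EM M × SmoothSec EM FL L, a = (a.1, 0) + (0, a.2) := fun a => by simp
  have h0 : ∀ {X : AntiholFields EM M} {l : SmoothSec EM FL L}, IsHolNear l x →
      (T.alg.bracket (X, 0) (0, l)).2.1 x = 0 := fun {X l} hl => by
    rw [← dbarAt_hol hl.self_of_nhds (X.2.2 x)]
    exact hT.bott X l x
  have h3 : T.alg.bracket a b = T.alg.bracket (a.1, 0) (b.1, 0) + T.alg.bracket (a.1, 0) (0, b.2) -
      T.alg.bracket (b.1, 0) (0, a.2) + T.alg.bracket (0, a.2) (0, b.2) := by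
    conv_lhs => rw [e a, e b]
    simp only [map_add, LinearMap.add_apply]
    rw [T.alg.bracket_swap (0, a.2) (b.1, 0)]
    abel
  rw [h3]
  change (T.alg.bracket (a.1, 0) (b.1, 0)).2.1 x + (T.alg.bracket (a.1, 0) (0, b.2)).2.1 x -
    (T.alg.bracket (b.1, 0) (0, a.2)).2.1 x + (T.alg.bracket (0, a.2) (0, b.2)).2.1 x = _
  rw [T.matched.left, h0 ha, h0 hb, h2, SmoothSec.zero_apply, add_zero, sub_zero, zero_add]
  exact h1

/-- Two brackets with the same anchor obey the same Leibniz rule, so their difference is tensorial;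
its `L`-component vanishes because it does so on holomorphic sections. The `T^{0,1}`-components
agree by injectivity of the anchor. -/
theorem IsAtiyahTriad.alg_eq (hT : 𝓛.IsAtiyahTriad T) : T.alg = 𝓛.sumAlgebroid := by
  let D : (AntiholFields EM M × SmoothSec EM FL L) → (AntiholFields EM M × SmoothSec EM FL L) →
    (AntiholFields EM M × SmoothSec EM FL L) := fun a b =>
      T.alg.bracket a b - 𝓛.sumAlgebroid.bracket a b
  have hadd : ∀ a b c, D a (b + c) = D a b + D a c := fun a b c => by
    simp only [D, map_add]
    abel
  have hsmul : ∀ (f : SmoothFun EM M) a b, D a (f • b) = f • D a b := fun f a b => by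
    simp only [D, LieAlgebroid.leibniz, hT.anchor_eq, smul_sub]
    exact add_sub_add_left_eq_sub _ _ _
  have hswap : ∀ a b, D a b = -D b a := fun a b => by
    simp only [D]
    rw [T.alg.bracket_swap, 𝓛.sumAlgebroid.bracket_swap]
    abel
  have hD : ∀ x a, (∀ b, IsHolNear b.2 x → (D a b).2.1 x = 0) → ∀ b, (D a b).2.1 x = 0 := by
    intro x a h0 b
    let φ : (AntiholFields EM M × SmoothSec EM FL L) →+ L x := AddMonoidHom.mk'
      (fun b => (D a b).2.1 x) fun b c => by rw [hadd]; rfl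
    refine tensorial_prod_eq_zero φ (fun f c => ?_) h0 b
    change (D a (f • c)).2.1 x = _
    rw [hsmul]
    rfl
  have hneg : ∀ x a b, (D b a).2.1 x = 0 → (D a b).2.1 x = 0 := fun x a b h => by
    rw [hswap]
    change -((D b a).2.1 x) = 0
    rw [h, neg_zero]
  have h2 : ∀ a b, (T.alg.bracket a b).2 = (𝓛.sumAlgebroid.bracket a b).2 := fun a b =>
    SmoothSec.eq_of_forall fun x => sub_eq_zero.1 (hD x a (fun b hb => hneg x a b
      (hD x b (fun a ha => sub_eq_zero.2 (hT.bracket_hol hb ha)) a)) b)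
  refine LieAlgebroid.ext (LinearMap.ext₂ fun a b => 𝓛.eq_of_der (h2 a b) ?_) hT.anchor_eq
  rw [← hT.anchor_eq, T.alg.anchor_bracket, hT.anchor_eq]
  exact der_sumBracket.symm

theorem IsAtiyahTriad.eq (hT : 𝓛.IsAtiyahTriad T) : T = 𝓛.atiyahTriad FE E := by
  have h1 := hT.alg_eq
  have h2 : T.conn.cov = dbar := LinearMap.ext fun X => LinearMap.ext fun e =>
    SmoothSec.eq_of_forall fun x => hT.conn X e x
  clear hT
  obtain ⟨alg, matched, ⟨cov, leibniz⟩, flat⟩ := T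
  dsimp only at h1 h2
  -- The other fields are propositions, so agreement of the algebroid and of the connection
  -- suffices.
  subst h1 h2
  rfl

end HolLieAlgebroid

end

/-! ### Atiyah classes of abstract matched triads. -/

theorem LieAlgebroid.Connection.H1.mk_eq_mk {R G W : Type*} [CommRing R] [Algebra ℂ R]
    [AddCommGroup G] [Module ℂ G] [Module R G]
    [AddCommGroup W] [Module ℂ W] [Module R W] [IsScalarTower ℂ R W] {𝒢 : LieAlgebroid R G}
    (C : LieAlgebroid.Connection W 𝒢) (z z' : LinearMap.ker C.d1) :
    LieAlgebroid.Connection.H1.mk C z = LieAlgebroid.Connection.H1.mk C z' ↔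
      ∃ w, C.d0 w = z.1 - z'.1 :=
  Submodule.Quotient.eq ((LinearMap.range C.d0).submoduleOf (LinearMap.ker C.d1))

theorem LieAlgebroid.Connection.H1.mk_eq_zero {R G W : Type*} [CommRing R] [Algebra ℂ R]
    [AddCommGroup G] [Module ℂ G] [Module R G]
    [AddCommGroup W] [Module ℂ W] [Module R W] [IsScalarTower ℂ R W] {𝒢 : LieAlgebroid R G}
    (C : LieAlgebroid.Connection W 𝒢) (z : LinearMap.ker C.d1) :
    LieAlgebroid.Connection.H1.mk C z = 0 ↔ ∃ w, C.d0 w = z.1 :=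
  Submodule.Quotient.mk_eq_zero ((LinearMap.range C.d0).submoduleOf (LinearMap.ker C.d1))

namespace LieAlgebroid.MatchedTriad

variable {R A B E : Type*} [CommRing R] [Algebra ℂ R]
  [AddCommGroup A] [Module ℂ A] [Module R A] [IsScalarTower ℂ R A]
  [AddCommGroup B] [Module ℂ B] [Module R B] [IsScalarTower ℂ R B]
  [AddCommGroup E] [Module ℂ E] [Module R E] [IsScalarTower ℂ R E]
  {T : MatchedTriad R A B E}

theorem bracket_inl_inr (a : A) (b : B) : T.alg.bracket (a, 0) (0, b) =
    ((T.alg.bracket (a, 0) (0, b)).1, 0) + (0, T.matched.bott.cov a b) := by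
  simp [IsMatchedSum.bott]

namespace ExtendingConnection

/-- Splitting [a, b] into its part in `A` and D_a b isolates what depends on the extension: only the
values of the connection on `B` are not already given. -/
theorem atiyahForm_apply_eq (C : T.ExtendingConnection) (a : A) (b : B) (e : E) :
    C.atiyahForm a b e = T.conn.cov a (C.cov (0, b) e) - C.cov (0, b) (T.conn.cov a e) -
      T.conn.cov (T.alg.bracket (a, 0) (0, b)).1 e - C.cov (0, T.matched.bott.cov a b) e := by
  rw [atiyahForm_apply, Connection.curvature_apply, C.extends_conn, bracket_inl_inr, map_add,
    LinearMap.add_apply, C.extends_conn]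
  simp only [Prod.mk_add_mk, add_zero]
  abel

/-- Two extending connections differ by a bundle map from `B` to `End E`. -/
def diff (C C' : T.ExtendingConnection) : B →ₗ[R] Module.End R E where
  toFun b :=
    { toFun := fun e => C.cov (0, b) e - C'.cov (0, b) e
      map_add' := fun e e' => by simp only [map_add]; abel
      map_smul' := fun f e => by
        simp only [C.leibniz, C'.leibniz, smul_sub, RingHom.id_apply]
        abel }
  map_add' b b' := by
    ext e
    have h : ((0 : A), b + b') = (0, b) + (0, b') := by simp
    simp only [h, map_add, LinearMap.add_apply, LinearMap.coe_mk, AddHom.coe_mk]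
    abel
  map_smul' f b := by
    ext e
    have h : ((0 : A), f • b) = f • (0, b) := by simp
    simp only [h, map_smul, LinearMap.smul_apply, LinearMap.coe_mk, AddHom.coe_mk, smul_sub,
      RingHom.id_apply]

theorem diff_apply (C C' : T.ExtendingConnection) (b : B) (e : E) :
    C.diff C' b e = C.cov (0, b) e - C'.cov (0, b) e := rfl

/-- The term along the `A`-component of [a, b] is the same for both connections and drops out; what
is left is the induced connection on bundle maps from `B` to `End E`. -/
theorem atiyahForm_sub (C C' : T.ExtendingConnection) :
    C.atiyahForm - C'.atiyahForm = T.homConn.d0 (C.diff C') := by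
  ext a b e
  change C.atiyahForm a b e - C'.atiyahForm a b e = T.conn.cov a (C.diff C' b e) -
    C.diff C' b (T.conn.cov a e) - C.diff C' (T.matched.bott.cov a b) e
  simp only [atiyahForm_apply_eq, diff_apply, map_sub]
  abel

theorem atiyahClass_eq (C C' : T.ExtendingConnection) : C.atiyahClass = C'.atiyahClass :=
  (Connection.H1.mk_eq_mk _ _ _).2 ⟨C.diff C', (C.atiyahForm_sub C').symm⟩

/-- Subtract a bundle map from `B` to `End E` from an extending connection. -/
def sub (C : T.ExtendingConnection) (φ : B →ₗ[R] Module.End R E) : T.ExtendingConnection where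
  cov :=
    { toFun := fun x => C.cov x - (φ x.2).restrictScalars ℂ
      map_add' := fun x y => by
        ext e
        simp only [map_add, Prod.snd_add, LinearMap.sub_apply, LinearMap.add_apply,
          LinearMap.restrictScalars_apply]
        abel
      map_smul' := fun f x => by
        ext e
        simp only [map_smul, Prod.smul_snd, LinearMap.sub_apply, LinearMap.smul_apply,
          LinearMap.restrictScalars_apply, smul_sub, RingHom.id_apply] }
  leibniz x f e := by
    simp only [LinearMap.coe_mk, AddHom.coe_mk, LinearMap.sub_apply,
      LinearMap.restrictScalars_apply, C.leibniz, map_smul, smul_sub]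
    abel
  extends_conn a := by
    ext e
    simp [C.extends_conn]

theorem sub_cov (C : T.ExtendingConnection) (φ : B →ₗ[R] Module.End R E) (x : A × B) (e : E) :
    (C.sub φ).cov x e = C.cov x e - φ x.2 e := rfl

/-- If the cocycle is dφ, subtracting φ from the connection subtracts dφ from the cocycle by
`atiyahForm_sub`, and gives cocycle zero. -/
theorem atiyahClass_eq_zero_iff (C : T.ExtendingConnection) :
    C.atiyahClass = 0 ↔ ∃ C' : T.ExtendingConnection, C'.atiyahForm = 0 := by
  constructor
  · intro h
    obtain ⟨φ, hφ⟩ := (Connection.H1.mk_eq_zero _ _).1 h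
    have h2 : C.diff (C.sub φ) = φ := by
      ext b e
      rw [diff_apply, sub_cov, sub_sub_cancel]
    refine ⟨C.sub φ, ?_⟩
    have h3 := C.atiyahForm_sub (C.sub φ)
    rw [h2, hφ] at h3
    ext a b e
    exact sub_eq_self.1 (LinearMap.congr_fun (LinearMap.congr_fun (LinearMap.congr_fun h3 a) b) e)
  · rintro ⟨C', h⟩
    rw [C.atiyahClass_eq C']
    exact (Connection.H1.mk_eq_zero _ _).2 ⟨0, (map_zero _).trans h.symm⟩

end ExtendingConnection

end LieAlgebroid.MatchedTriad

/-! ### Partitions of unity and existence of extending connections. -/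

noncomputable section

variable {EM : Type*} [NormedAddCommGroup EM] [NormedSpace ℂ EM]
  {M : Type*} [TopologicalSpace M] [ChartedSpace EM M] [IsManifold 𝓘(ℂ, EM) ∞ M]

/-- A finite sum of bump functions. Positivity on K is enough, because the functions are normalized
later. -/
theorem exists_real_bump_of_isCompact [FiniteDimensional ℂ EM] [T2Space M] {K U : Set M}
    (hK : IsCompact K) (hU : IsOpen U) (hKU : K ⊆ U) : ∃ f : M → ℝ,
      ContMDiff 𝓘(ℝ, EM) 𝓘(ℝ, ℝ) ∞ f ∧ (∀ y, 0 ≤ f y) ∧ (∀ y ∈ K, 0 < f y) ∧ tsupport f ⊆ U := by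
  classical
  choose! g hg hg0 hg1 hgU using fun x (hx : x ∈ K) =>
    exists_real_bump (EM := EM) (hU.mem_nhds (hKU hx))
  obtain ⟨t, htK, ht⟩ := hK.elim_nhds_subcover (fun x => {y | g x y = 1}) fun x hx => hg1 x hx
  refine ⟨fun y => ∑ x ∈ t, g x y, contMDiff_finsetSum fun x hx => hg x (htK x hx),
    fun y => Finset.sum_nonneg fun x hx => hg0 x (htK x hx) y, fun y hy => ?_, ?_⟩
  · obtain ⟨x, hx, hxy⟩ := Set.mem_iUnion₂.1 (ht hy)
    refine Finset.sum_pos' (fun x hx => hg0 x (htK x hx) y) ⟨x, hx, ?_⟩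
    have h1 : g x y = 1 := hxy
    rw [h1]
    exact one_pos
  · have h1 : IsClosed (⋃ x ∈ t, tsupport (g x)) :=
      t.finite_toSet.isClosed_biUnion fun x _ => isClosed_tsupport _
    refine (closure_minimal (fun y hy => ?_) h1).trans
      (Set.iUnion₂_subset fun x hx => hgU x (htK x hx))
    by_contra h2
    refine hy (Finset.sum_eq_zero fun x hx => image_eq_zero_of_notMem_tsupport fun h3 => h2 ?_)
    exact Set.mem_iUnion₂.2 ⟨x, hx, h3⟩

/-- Smooth partitions of unity on a paracompact manifold. -/
theorem exists_smooth_partition [FiniteDimensional ℂ EM] [T2Space M] [ParacompactSpace M]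
    (V : M → Opens M) (hV : ∀ x, x ∈ V x) :
    ∃ (χ : M → SmoothFun EM M) (I : M → Finset M), (∀ α, tsupport (χ α).1 ⊆ V α) ∧
      (∀ x, ∃ J : Finset M, ∀ᶠ y in 𝓝 x, I y ⊆ J) ∧ (∀ y, ∀ α ∉ I y, (χ α).1 y = 0) ∧
      ∀ y, ∑ α ∈ I y, (χ α).1 y = 1 := by
  have : ProperSpace EM := FiniteDimensional.proper ℂ EM
  have : LocallyCompactSpace M := ChartedSpace.locallyCompactSpace EM M
  -- A locally finite refinement v of the interiors of compact sets K x ⊆ V x is shrunk to w with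
  -- closures inside v. These closures are compact as closed subsets of K x, so each carries a bump
  -- function supported in v x. No countability of M is needed.
  choose K hK hKV hKc using fun x => local_compact_nhds ((V x).isOpen.mem_nhds (hV x))
  obtain ⟨v, vo, vc, vf, vK⟩ := precise_refinement (fun x => interior (K x))
    (fun x => isOpen_interior) (Set.iUnion_eq_univ_iff.2 fun x => ⟨x, mem_interior_iff_mem_nhds.2 (hK x)⟩)
  obtain ⟨w, wc, -, wv⟩ := exists_iUnion_eq_closure_subset vo vf.point_finite vc
  have hwc : ∀ x, IsCompact (closure (w x)) := fun x => (hKc x).of_isClosed_subset isClosed_closure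
    ((wv x).trans ((vK x).trans interior_subset))
  choose f hf hf0 hf1 hfv using fun x => exists_real_bump_of_isCompact (EM := EM) (hwc x) (vo x) (wv x)
  -- The finite set of indices α with y ∈ v α; it contains every α with f α y ≠ 0. Near each point
  -- these sets lie in one finite set, which makes sums over them smooth.
  let I : M → Finset M := fun y => (vf.point_finite y).toFinset
  have hI : ∀ y, ∀ α ∉ I y, f α y = 0 := fun y α h => image_eq_zero_of_notMem_tsupport fun h1 =>
    h ((vf.point_finite y).mem_toFinset.2 (hfv α h1))
  have hJ : ∀ x, ∃ J : Finset M, ∀ᶠ y in 𝓝 x, I y ⊆ J := by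
    intro x
    obtain ⟨N, hN, hf⟩ := vf x
    refine ⟨hf.toFinset, ?_⟩
    filter_upwards [hN] with y hy α hα
    exact hf.mem_toFinset.2 ⟨y, (vf.point_finite y).mem_toFinset.1 hα, hy⟩
  let S : M → ℝ := fun y => ∑ α ∈ I y, f α y
  have hS : ContMDiff 𝓘(ℝ, EM) 𝓘(ℝ, ℝ) ∞ S := by
    intro x
    obtain ⟨J, hJ⟩ := hJ x
    refine (contMDiffAt_finsetSum (t := J) fun α _ => hf α x).congr_of_eventuallyEq ?_
    filter_upwards [hJ] with y hy
    exact Finset.sum_subset hy fun α _ => hI y α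
  have hS0 : ∀ y, S y ≠ 0 := by
    intro y
    obtain ⟨α, hα⟩ := Set.mem_iUnion.1 (wc.ge (Set.mem_univ y))
    refine (Finset.sum_pos' (fun α _ => hf0 α y) ⟨α, ?_, hf1 α y (subset_closure hα)⟩).ne'
    exact (vf.point_finite y).mem_toFinset.2 (wv α (subset_closure hα))
  refine ⟨fun α => SmoothFun.of (fun y => ((f α y / S y : ℝ) : ℂ)) fun y =>
    contMDiffAt_ofReal ((hf α y).div₀ (hS y) (hS0 y)), I, fun α => ?_, hJ, fun y α h => ?_,
    fun y => ?_⟩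
  · refine Set.Subset.trans (closure_mono (t := Function.support (f α)) fun y hy h0 => hy ?_)
      ((hfv α).trans ((vK α).trans (interior_subset.trans (hKV α))))
    change ((f α y / S y : ℝ) : ℂ) = 0
    rw [h0, zero_div, Complex.ofReal_zero]
  · change ((f α y / S y : ℝ) : ℂ) = 0
    rw [hI y α h, zero_div, Complex.ofReal_zero]
  · change ∑ α ∈ I y, ((f α y / S y : ℝ) : ℂ) = 1
    rw [← Complex.ofReal_sum, ← Finset.sum_div, div_self (hS0 y), Complex.ofReal_one]

variable {FL : Type*} [NormedAddCommGroup FL] [NormedSpace ℂ FL] {L : M → Type*}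
  [TopologicalSpace (TotalSpace FL L)] [∀ x, AddCommGroup (L x)] [∀ x, Module ℂ (L x)]
  [∀ x, TopologicalSpace (L x)] [FiberBundle FL L] [VectorBundle ℂ FL L]
  {FE : Type*} [NormedAddCommGroup FE] [NormedSpace ℂ FE] {E : M → Type*}
  [TopologicalSpace (TotalSpace FE E)] [∀ x, AddCommGroup (E x)] [∀ x, Module ℂ (E x)]
  [∀ x, TopologicalSpace (E x)] [FiberBundle FE E] [VectorBundle ℂ FE E]
  {U V : Opens M} [FiniteDimensional ℂ EM] [FiniteDimensional ℂ FL] [FiniteDimensional ℂ FE]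
  [ContMDiffVectorBundle ∞ FL L 𝓘(ℂ, EM)] [ContMDiffVectorBundle ∞ FE E 𝓘(ℂ, EM)] [T2Space M]

namespace HolLieAlgebroid

variable (𝓛 : HolLieAlgebroid EM FL L)

theorem der_inr_apply (l : SmoothSec EM FL L) (f : SmoothFun EM M) (x : M) :
    (𝓛.der (0, l) f).1 x = cderiv f.1 x (𝓛.cAnchor x (l.1 x)) :=
  (𝓛.der_apply _ f x).trans (congrArg (cderiv f.1 x) (zero_add (𝓛.cAnchor x (l.1 x))))

/-- A smooth `L`-connection on `E`, given by its values at points. -/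
structure SmoothCov (k : SmoothSec EM FL L → SmoothSec EM FE E → Π x, E x) : Prop where
  smooth : ∀ l e x, SmoothSecAt EM FE (k l e) x
  add_left : ∀ l l' e x, k (l + l') e x = k l e x + k l' e x
  smul_left : ∀ (f : SmoothFun EM M) l e x, k (f • l) e x = f.1 x • k l e x
  add_right : ∀ l e e' x, k l (e + e') x = k l e x + k l e' x
  leibniz : ∀ l (f : SmoothFun EM M) e x, k l (f • e) x =
    f.1 x • k l e x + cderiv f.1 x (𝓛.cAnchor x (l.1 x)) • e.1 x

variable {𝓛}

/-- The extending connection obtained from a smooth `L`-connection. -/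
def SmoothCov.extendingConnection {k : SmoothSec EM FL L → SmoothSec EM FE E → Π x, E x}
    (hk : 𝓛.SmoothCov k) : (𝓛.atiyahTriad FE E).ExtendingConnection :=
  have hleib : ∀ (a : AntiholFields EM M × SmoothSec EM FL L) (f : SmoothFun EM M)
      (e : SmoothSec EM FE E) (x : M), (dbar a.1 (f • e)).1 x + k a.2 (f • e) x =
        f.1 x • ((dbar a.1 e).1 x + k a.2 e x) + (𝓛.der a f).1 x • e.1 x := fun a f e x => by
    rw [dbar_smul_apply, hk.leibniz, 𝓛.der_apply, HolAnchor.field, map_add, add_smul, smul_add]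
    abel
  { cov :=
      { toFun := fun a =>
          { toFun := fun e => dbar a.1 e + SmoothSec.of (k a.2 e) (hk.smooth a.2 e)
            map_add' := fun e e' => SmoothSec.eq_of_forall fun x => by
              have h : (dbar a.1 (e + e')).1 x = (dbar a.1 e).1 x + (dbar a.1 e').1 x := by
                rw [map_add]
                rfl
              refine (congrArg₂ (· + ·) h (hk.add_right a.2 e e' x)).trans ?_
              exact add_add_add_comm _ _ _ _
            map_smul' := fun c e => SmoothSec.eq_of_forall fun x => by
              have h := hleib a (algebraMap ℂ _ c) e x
              rw [Derivation.map_algebraMap, SmoothFun.zero_apply, zero_smul, add_zero] at h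
              exact h }
        map_add' := fun a b => LinearMap.ext fun e => SmoothSec.eq_of_forall fun x => by
          have h : (dbar (a.1 + b.1) e).1 x = (dbar a.1 e).1 x + (dbar b.1 e).1 x := by
            rw [map_add]
            rfl
          refine (congrArg₂ (· + ·) h (hk.add_left a.2 b.2 e x)).trans ?_
          exact add_add_add_comm _ _ _ _
        map_smul' := fun f a => LinearMap.ext fun e => SmoothSec.eq_of_forall fun x => by
          have h : (dbar (f • a.1) e).1 x = f.1 x • (dbar a.1 e).1 x := by
            rw [map_smul]
            rfl
          refine (congrArg₂ (· + ·) h (hk.smul_left f a.2 e x)).trans ?_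
          exact (smul_add _ _ _).symm }
    leibniz := fun a f e => SmoothSec.eq_of_forall fun x => hleib a f e x
    extends_conn := fun X => LinearMap.ext fun e => SmoothSec.eq_of_forall fun x => by
      have h := hk.smul_left 0 0 e x
      rw [zero_smul, SmoothFun.zero_apply, zero_smul] at h
      exact (congrArg ((dbar X e).1 x + ·) h).trans (add_zero _) }

theorem SmoothCov.extendingConnection_apply
    {k : SmoothSec EM FL L → SmoothSec EM FE E → Π x, E x} (hk : 𝓛.SmoothCov k)
    (l : SmoothSec EM FL L) (e : SmoothSec EM FE E) (x : M) :
    (hk.extendingConnection.cov (0, l) e).1 x = k l e x := by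
  have h : (dbar (0 : AntiholFields EM M) e).1 x = 0 := by
    rw [map_zero]
    rfl
  exact (congrArg (· + k l e x) h).trans (zero_add _)

-- On the domain of a frame of `E`, differentiating components along ρ(l) is a connection, and
-- connections may be averaged with weights of sum 1.
variable (𝓛 FE E) in
theorem exists_smoothCov [ParacompactSpace M] :
    ∃ k : SmoothSec EM FL L → SmoothSec EM FE E → Π x, E x, 𝓛.SmoothCov k := by
  obtain ⟨χ, I, hχ, hJ, hI, h1⟩ := exists_smooth_partition (EM := EM) (frSet FE E) mem_frSet
  have hα : ∀ {α y}, y ∈ frSet FE E α ∨ (χ α).1 y = 0 := fun {α y} => by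
    by_cases h : y ∈ tsupport (χ α).1
    · exact Or.inl (hχ α h)
    · exact Or.inr (image_eq_zero_of_notMem_tsupport h)
  refine ⟨fun l e x => ∑ α ∈ I x, (χ α).1 x • frameDer FE α e.1 x (𝓛.cAnchor x (l.1 x)),
    fun l e x => ?_, fun l l' e x => ?_, fun f l e x => ?_, fun l e e' x => ?_, fun l f e x => ?_⟩
  · obtain ⟨J, hJ⟩ := hJ x
    have h2 : ∀ α, SmoothSecAt EM FE
        (fun y => (χ α).1 y • frameDer FE α e.1 y (𝓛.cAnchor y (l.1 y))) x := by
      intro α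
      by_cases h : x ∈ tsupport (χ α).1
      · exact ((e.smoothSecAt x).frameDer (hχ α h) (𝓛.cAnchor_mem l)).smul ((χ α).2 x)
      · refine SmoothSecAt.zero.congr ?_
        filter_upwards [(isClosed_tsupport (χ α).1).isOpen_compl.mem_nhds h] with y hy
        rw [image_eq_zero_of_notMem_tsupport hy, zero_smul]
    refine (SmoothSecAt.sum (S := J) fun α _ => h2 α).congr ?_
    filter_upwards [hJ] with y hy
    exact Finset.sum_subset hy fun α _ h => by rw [hI y α h, zero_smul]
  · simp only [SmoothSec.add_apply, map_add, smul_add, Finset.sum_add_distrib]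
  · simp only [SmoothSec.smul_apply, map_smul, Finset.smul_sum, smul_comm (f.1 x)]
  · rw [← Finset.sum_add_distrib]
    refine Finset.sum_congr rfl fun α _ => ?_
    rcases hα (α := α) (y := x) with h | h
    · have h2 : frameDer (EM := EM) FE α (e + e').1 x = _ := frameDer_add h (e.2 x) (e'.2 x)
      rw [h2, LinearMap.add_apply, smul_add]
    · rw [h, zero_smul, zero_smul, zero_smul, add_zero]
  -- The weights have sum 1, which is exactly what gives the derivative term of the Leibniz rule its
  -- coefficient 1.
  · conv_rhs => rw [← one_smul ℂ (cderiv f.1 x _ • e.1 x), ← h1 x]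
    rw [Finset.sum_smul, Finset.smul_sum, ← Finset.sum_add_distrib]
    refine Finset.sum_congr rfl fun α _ => ?_
    rcases hα (α := α) (y := x) with h | h
    · have h2 : frameDer FE α (f • e).1 x (𝓛.cAnchor x (l.1 x)) = _ :=
        frameDer_smul h (f.2 x) (e.2 x) _
      rw [h2, smul_add, smul_comm]
    · rw [h, zero_smul, zero_smul, zero_smul, smul_zero, add_zero]

end HolLieAlgebroid

end

/-! ### Extending connections with zero cocycle and holomorphic connections. -/

noncomputable section

variable {EM : Type*} [NormedAddCommGroup EM] [NormedSpace ℂ EM]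
  {M : Type*} [TopologicalSpace M] [ChartedSpace EM M] [IsManifold 𝓘(ℂ, EM) ∞ M]
  {FL : Type*} [NormedAddCommGroup FL] [NormedSpace ℂ FL] {L : M → Type*}
  [TopologicalSpace (TotalSpace FL L)] [∀ x, AddCommGroup (L x)] [∀ x, Module ℂ (L x)]
  [∀ x, TopologicalSpace (L x)] [FiberBundle FL L] [VectorBundle ℂ FL L]
  {FE : Type*} [NormedAddCommGroup FE] [NormedSpace ℂ FE] {E : M → Type*}
  [TopologicalSpace (TotalSpace FE E)] [∀ x, AddCommGroup (E x)] [∀ x, Module ℂ (E x)]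
  [∀ x, TopologicalSpace (E x)] [FiberBundle FE E] [VectorBundle ℂ FE E]
  {U V : Opens M} [FiniteDimensional ℂ EM] [FiniteDimensional ℂ FL] [FiniteDimensional ℂ FE]
  [ContMDiffVectorBundle ∞ FL L 𝓘(ℂ, EM)] [ContMDiffVectorBundle ∞ FE E 𝓘(ℂ, EM)] [T2Space M]

namespace HolLieAlgebroid

variable {𝓛 : HolLieAlgebroid EM FL L}

section Extending

variable (C : (𝓛.atiyahTriad FE E).ExtendingConnection) {l l' : SmoothSec EM FL L}
  {e e' : SmoothSec EM FE E} {x : M}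

theorem extending_leibniz (f : SmoothFun EM M) : C.cov (0, l) (f • e) =
    f • C.cov (0, l) e + 𝓛.der (0, l) f • e := C.leibniz (0, l) f e

theorem extending_add_left : C.cov (0, l + l') e = C.cov (0, l) e + C.cov (0, l') e := by
  have h : ((0 : AntiholFields EM M), l + l') = (0, l) + (0, l') := by simp
  rw [h, map_add, LinearMap.add_apply]

theorem extending_smul_left (f : SmoothFun EM M) :
    C.cov (0, f • l) e = f • C.cov (0, l) e := by
  have h : ((0 : AntiholFields EM M), f • l) = f • (0, l) := by simp
  rw [h, map_smul, LinearMap.smul_apply]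

/-- The value of an extending connection at a point only depends on germs. -/
theorem extending_congr (hl : l.1 x = l'.1 x) (he : ∀ᶠ y in 𝓝 x, e.1 y = e'.1 y) :
    (C.cov (0, l) e).1 x = (C.cov (0, l') e').1 x := by
  have h1 : (C.cov (0, l) e).1 x = (C.cov (0, l') e).1 x := by
    let φ : SmoothSec EM FL L →+ E x := AddMonoidHom.mk' (fun l => (C.cov (0, l) e).1 x)
      fun l l' => by rw [extending_add_left]; rfl
    refine tensorial_eq_of_eq φ (fun f l => ?_) hl
    change (C.cov (0, f • l) e).1 x = _
    rw [extending_smul_left]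
    rfl
  -- With χ supported where e = e', the product χ • (e - e') is zero. The Leibniz rule at x, where χ
  -- = 1 and e = e', gives ∇(e - e') = 0 there.
  obtain ⟨χ, hχ1, hχ⟩ := exists_bump (EM := EM) he
  have h2 : χ • (e - e') = 0 := SmoothSec.eq_of_forall fun y => by
    rw [SmoothSec.smul_apply, SmoothSec.sub_apply]
    by_cases hy : y ∈ tsupport χ.1
    · have h3 : e.1 y = e'.1 y := hχ hy
      rw [h3, sub_self, smul_zero]
      rfl
    · rw [image_eq_zero_of_notMem_tsupport hy, zero_smul]
      rfl
  have h3 := extending_leibniz C (l := l') (e := e - e') χ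
  rw [h2, map_zero, map_sub] at h3
  have h4 := congrArg (fun s => s.1 x) h3
  simp only [SmoothSec.zero_apply, SmoothSec.add_apply, SmoothSec.smul_apply, SmoothSec.sub_apply,
    he.self_of_nhds, sub_self, smul_zero, add_zero, hχ1.self_of_nhds, one_smul] at h4
  rw [h1, sub_eq_zero.1 h4.symm]

theorem extending_apply_zero (he : ∀ᶠ y in 𝓝 x, e.1 y = 0) : (C.cov (0, l) e).1 x = 0 := by
  rw [extending_congr C (e' := 0) rfl he, map_zero]
  rfl

theorem extending_zero_apply (hl : l.1 x = 0) : (C.cov (0, l) e).1 x = 0 := by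
  rw [extending_congr C (l' := 0) hl (Filter.Eventually.of_forall fun _ => rfl)]
  have h : ((0 : AntiholFields EM M), (0 : SmoothSec EM FL L)) = 0 := rfl
  rw [h, map_zero]
  rfl

/-- The Atiyah cocycle, evaluated on holomorphic sections. -/
theorem atiyahForm_apply_hol (X : AntiholFields EM M) (hl : IsHolNear l x) (he : IsHolNear e x) :
    (C.atiyahForm X l e).1 x = (dbar X (C.cov (0, l) e)).1 x := by
  rw [LieAlgebroid.MatchedTriad.ExtendingConnection.atiyahForm_apply_eq]
  -- Of the terms of the cocycle only ∂̄_X(∇_l e) survives: two others contain ∂̄e, which vanishes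
  -- near x, and the last one is tensorial in D_X l = ∂̄_X l, which vanishes at x.
  have h1 : (C.cov (0, l) (dbar X e)).1 x = 0 := extending_apply_zero C (dbar_apply_hol he)
  have h2 : ∀ P : AntiholFields EM M, (dbar P e).1 x = 0 := fun P =>
    (dbar_apply_hol he).self_of_nhds
  have h3 : (C.cov (0, (𝓛.atiyahTriad FE E).matched.bott.cov X l) e).1 x = 0 := by
    refine extending_zero_apply C ?_
    rw [(𝓛.isAtiyahTriad_atiyahTriad (FE := FE) (E := E)).bott]
    exact dbarAt_hol hl.self_of_nhds (X.2.2 x)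
  change (dbar X (C.cov (0, l) e)).1 x - (C.cov (0, l) (dbar X e)).1 x - (dbar _ e).1 x -
    (C.cov (0, (𝓛.atiyahTriad FE E).matched.bott.cov X l) e).1 x = _
  rw [h1, h2, h3, sub_zero, sub_zero, sub_zero]

variable {C}

/-- By `atiyahForm_apply_hol`, ∂̄(∇_l e) is the cocycle. Every (0,1) vector extends to a global
field, so ∂̄(∇_l e) vanishes in all (0,1) directions near x. -/
theorem isHolNear_extending (hC : C.atiyahForm = 0) (hl : IsHolNear l x) (he : IsHolNear e x) :
    IsHolNear (C.cov (0, l) e) x := by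
  have h : ∀ᶠ y in 𝓝 x, SmoothSecAt EM FE (C.cov (0, l) e).1 y ∧ ∀ Z : CTangent EM y,
      IsAntiholVec Z → dbarAt (F := FE) (C.cov (0, l) e).1 y Z = 0 := by
    filter_upwards [hl.eventually_nhds, he.eventually_nhds] with y hly hey
    refine ⟨(C.cov (0, l) e).2 y, fun Z hZ => ?_⟩
    obtain ⟨X, rfl⟩ := exists_antiholField hZ
    have h1 := atiyahForm_apply_hol C X hly hey
    rw [hC] at h1
    exact h1.symm
  filter_upwards [h.eventually_nhds] with y hy using holSecAt_of_dbarAt hy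

theorem HolSec.exists_lift {F : Type*} [NormedAddCommGroup F] [NormedSpace ℂ F]
    {E : M → Type*} [TopologicalSpace (TotalSpace F E)] [∀ x, AddCommGroup (E x)]
    [∀ x, Module ℂ (E x)] [∀ x, TopologicalSpace (E x)] [FiberBundle F E] [VectorBundle ℂ F E]
    [FiniteDimensional ℂ F] [ContMDiffVectorBundle ∞ F E 𝓘(ℂ, EM)] (s : HolSec EM F E U) (x : U) :
    ∃ t : SmoothSec EM F E, IsHolNear t x ∧ ∀ᶠ y in 𝓝 (x : M), ∀ hy : y ∈ U, t.1 y = s.1 ⟨y, hy⟩ := by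
  obtain ⟨t, h1, h2⟩ := s.exists_extension x.2
  exact ⟨t, h1, h2.mono fun y hy hyU => hy.trans (s.ext_apply hyU)⟩

variable (C) in
/-- The action of an extending connection on holomorphic sections. -/
def extendingHolCov (l : HolSec EM FL L U) (e : HolSec EM FE E U) (x : U) : E x :=
  (C.cov (0, (HolSec.exists_lift l x).choose) (HolSec.exists_lift e x).choose).1 x

/-- `extendingHolCov` chooses lifts anew at each point. By `extending_congr` every lift of l with
the right value and every lift of e with the right germ give the same result, so lifts can be
adapted to each verification. -/
theorem extendingHolCov_eq {l' : HolSec EM FL L U} {e' : HolSec EM FE E U} {x : U}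
    (hl : l.1 x = l'.1 x) (he : ∀ᶠ y in 𝓝 (x : M), ∀ hy : y ∈ U, e.1 y = e'.1 ⟨y, hy⟩) :
    extendingHolCov C l' e' x = (C.cov (0, l) e).1 x := by
  refine extending_congr C ?_ ?_
  · rw [hl]
    exact (HolSec.exists_lift l' x).choose_spec.2.self_of_nhds x.2
  · filter_upwards [he, (HolSec.exists_lift e' x).choose_spec.2, U.isOpen.mem_nhds x.2]
      with y h1 h2 hy
    rw [h1 hy, h2 hy]

/-- An extending connection with vanishing Atiyah cocycle defines a holomorphic connection. -/
def holConnectionOfAtiyahForm (hC : C.atiyahForm = 0) : 𝓛.HolConnection FE E :=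
  have key : ∀ (U : Opens M) (l : HolSec EM FL L U) (e : HolSec EM FE E U) (x : U),
      ∃ (l' : SmoothSec EM FL L) (e' : SmoothSec EM FE E), l'.1 x = l.1 x ∧
        (∀ᶠ y in 𝓝 (x : M), ∀ hy : y ∈ U, e'.1 y = e.1 ⟨y, hy⟩) := fun U l e x =>
    ⟨_, _, (HolSec.exists_lift l x).choose_spec.2.self_of_nhds x.2,
      (HolSec.exists_lift e x).choose_spec.2⟩
  have hadd : ∀ (U : Opens M) (l : HolSec EM FL L U) (e e' : HolSec EM FE E U) (x : U),
      extendingHolCov C l (e + e') x = extendingHolCov C l e x + extendingHolCov C l e' x := by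
    intro U l e e' x
    obtain ⟨m, f, hm, hf⟩ := key U l e x
    obtain ⟨m', f', hm', hf'⟩ := key U l e' x
    rw [extendingHolCov_eq hm hf, extendingHolCov_eq hm hf', extendingHolCov_eq (e := f + f') hm,
      map_add]
    · rfl
    · filter_upwards [hf, hf'] with y h1 h2 hy
      rw [SmoothSec.add_apply, h1 hy, h2 hy]
      rfl
  have hadd' : ∀ (U : Opens M) (l l' : HolSec EM FL L U) (e : HolSec EM FE E U) (x : U),
      extendingHolCov C (l + l') e x = extendingHolCov C l e x + extendingHolCov C l' e x := by
    intro U l l' e x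
    obtain ⟨m, f, hm, hf⟩ := key U l e x
    obtain ⟨m', f', hm', hf'⟩ := key U l' e x
    rw [extendingHolCov_eq hm hf, extendingHolCov_eq hm' hf, extendingHolCov_eq (l := m + m') _ hf,
      extending_add_left]
    · rfl
    · rw [SmoothSec.add_apply, hm, hm']
      rfl
  have hleib : ∀ (U : Opens M) (l : HolSec EM FL L U) (f : HolFun EM U) (e : HolSec EM FE E U)
      (x : U), extendingHolCov C l (f • e) x =
        f.1 x • extendingHolCov C l e x + (𝓛.act l f).1 x • e.1 x := by
    intro U l f e x
    obtain ⟨m, s, hm, hs⟩ := key U l e x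
    -- The function f lives on U only, so it is replaced by a global smooth function with the same
    -- germ at x.
    have hf := fun y (hy : y ∈ U) => ((contMDiffOn_extend f).contMDiffAt
      (U.isOpen.mem_nhds hy)).real_of_complex
    obtain ⟨g, hg⟩ := SmoothFun.exists_extension (Filter.mem_of_superset (U.isOpen.mem_nhds x.2) hf)
    have hfe : ∀ y (hy : y ∈ U), Function.extend Subtype.val f.1 (0 : M → ℂ) y = f.1 ⟨y, hy⟩ :=
      fun y hy => Subtype.val_injective.extend_apply f.1 _ ⟨y, hy⟩
    rw [extendingHolCov_eq hm hs, extendingHolCov_eq (e := g • s) hm, extending_leibniz,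
      SmoothSec.add_apply, SmoothSec.smul_apply, SmoothSec.smul_apply, 𝓛.der_inr_apply,
      cderiv_congr hg, hg.self_of_nhds, hfe x x.2, hs.self_of_nhds x.2, hm,
      𝓛.act_apply l f fun z => (hfe z z.2).symm]
    filter_upwards [hs, hg] with y h1 h2 hy
    rw [SmoothSec.smul_apply, h1 hy, h2, hfe y hy]
    rfl
  have hsmul : ∀ (U : Opens M) (f : HolFun EM U) (l : HolSec EM FL L U) (e : HolSec EM FE E U)
      (x : U), extendingHolCov C (f • l) e x = f.1 x • extendingHolCov C l e x := by
    intro U f l e x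
    obtain ⟨m, s, hm, hs⟩ := key U l e x
    have hf := fun y (hy : y ∈ U) => ((contMDiffOn_extend f).contMDiffAt
      (U.isOpen.mem_nhds hy)).real_of_complex
    obtain ⟨g, hg⟩ := SmoothFun.exists_extension (Filter.mem_of_superset (U.isOpen.mem_nhds x.2) hf)
    have hfe : g.1 x = f.1 x :=
      hg.self_of_nhds.trans (Subtype.val_injective.extend_apply f.1 _ x)
    rw [extendingHolCov_eq hm hs, extendingHolCov_eq (l := g • m) _ hs, extending_smul_left,
      SmoothSec.smul_apply, hfe]
    rw [SmoothSec.smul_apply, hfe, hm]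
    rfl
  have hhol : ∀ (U : Opens M) (l : HolSec EM FL L U) (e : HolSec EM FE E U),
      extendingHolCov C l e ∈ holSecSub EM FE E U := by
    intro U l e x
    -- One pair of lifts at x serves for all nearby points too, so near x the section is that of the
    -- extending connection applied to fixed global sections.
    obtain ⟨m, hm, hm'⟩ := HolSec.exists_lift l x
    obtain ⟨s, hs, hs'⟩ := HolSec.exists_lift e x
    refine ((contMDiffAt_subtype_iff (U := U) (x := x)).2
      (isHolNear_extending hC hm hs).self_of_nhds).congr_of_eventuallyEq ?_
    filter_upwards [continuous_subtype_val.continuousAt.eventually hm',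
      continuous_subtype_val.continuousAt.eventually hs'.eventually_nhds] with y h1 h2
    rw [extendingHolCov_eq (h1 y.2) h2]
  { cov := fun U => LinearMap.mk₂ ℂ (fun l e => ⟨extendingHolCov C l e, hhol U l e⟩)
      (fun l l' e => HolSec.eq_of_forall (hadd' U l l' e))
      (fun c l e => HolSec.eq_of_forall (hsmul U (algebraMap ℂ _ c) l e))
      (fun l e e' => HolSec.eq_of_forall (hadd U l e e'))
      (fun c l e => HolSec.eq_of_forall fun x => by
        obtain ⟨m, s, hm, hs⟩ := key U l e x
        refine (extendingHolCov_eq (l := m) (e := c • s) hm ?_).trans ?_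
        · filter_upwards [hs] with y h1 hy
          rw [SmoothSec.smul_complex_apply, h1 hy]
          rfl
        · rw [map_smul, SmoothSec.smul_complex_apply, ← extendingHolCov_eq hm hs]
          rfl)
    smul_left := fun U f l e => HolSec.eq_of_forall (hsmul U f l e)
    leibniz := fun U l f e => HolSec.eq_of_forall (hleib U l f e)
    cov_res := fun {U V} h l e => HolSec.eq_of_forall fun x => by
      obtain ⟨m, s, hm, hs⟩ := key U l e ⟨x, h x.2⟩
      change extendingHolCov C (HolSec.res h l) (HolSec.res h e) x =
        extendingHolCov C l e ⟨x, h x.2⟩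
      refine (extendingHolCov_eq (l := m) (e := s) (l' := HolSec.res h l)
        (e' := HolSec.res h e) (x := x) hm ?_).trans (extendingHolCov_eq hm hs).symm
      filter_upwards [hs] with y hy hyV using hy (h hyV) }

end Extending

/-! ### From holomorphic connections to smooth connections -/

namespace HolConnection

variable (C : 𝓛.HolConnection FE E)

theorem cov_sum_smul {ι κ : Type*} [Fintype ι] [Fintype κ] (c : ι → HolFun EM U)
    (d : κ → HolFun EM U) (a : ι → HolSec EM FL L U) (b : κ → HolSec EM FE E U) :
    C.cov U (∑ i, c i • a i) (∑ j, d j • b j) =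
      (∑ j, 𝓛.act (∑ i, c i • a i) (d j) • b j) +
        ∑ i, ∑ j, (d j * c i) • C.cov U (a i) (b j) := by
  have h1 : ∀ j, C.cov U (∑ i, c i • a i) (b j) = ∑ i, c i • C.cov U (a i) (b j) := fun j => by
    rw [map_sum, LinearMap.sum_apply]
    simp only [C.smul_left]
  rw [map_sum]
  simp only [C.leibniz, h1, Finset.sum_add_distrib, Finset.smul_sum, smul_smul]
  rw [Finset.sum_comm, add_comm]

/-- The connection on the local frames. -/
def frCov (x₀ : M) (i : Fin (Module.finrank ℂ FL)) (j : Fin (Module.finrank ℂ FE)) (y : M) : E y :=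
  (C.cov (frSet FL L x₀ ⊓ frSet FE E x₀) (HolSec.res inf_le_left (frHol EM FL L x₀ i))
    (HolSec.res inf_le_right (frHol EM FE E x₀ j))).ext y

/-- The extension of a holomorphic connection to smooth sections, in the local frames around
`x₀`. -/
def frameCov (x₀ : M) (e : Π x, E x) (y : M) : L y →ₗ[ℂ] E y :=
  frameDer FE x₀ e y ∘ₗ 𝓛.cAnchor y +
    ∑ i, ∑ j, co FE x₀ j y (e y) • (co FL x₀ i y).smulRight (C.frCov x₀ i j y)

theorem frameCov_apply (x₀ : M) (e : Π x, E x) (y : M) (v : L y) :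
    C.frameCov x₀ e y v = frameDer FE x₀ e y (𝓛.cAnchor y v) +
      ∑ i, ∑ j, (co FE x₀ j y (e y) * co FL x₀ i y v) • C.frCov x₀ i j y := by
  simp [frameCov, smul_smul]

variable {C} {l : Π x, L x} {e e' : Π x, E x} {x₀ x₁ y : M}

theorem frameCov_congr (he : ∀ᶠ z in 𝓝 y, e z = e' z) :
    C.frameCov x₀ e y = C.frameCov x₀ e' y := by
  rw [frameCov, frameCov, frameDer_congr x₀ he, he.self_of_nhds]

theorem frameCov_add (hy : y ∈ frSet FE E x₀) (he : SmoothSecAt EM FE e y)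
    (he' : SmoothSecAt EM FE e' y) (v : L y) : C.frameCov x₀ (fun z => e z + e' z) y v =
      C.frameCov x₀ e y v + C.frameCov x₀ e' y v := by
  simp only [frameCov_apply, frameDer_add hy he he', LinearMap.add_apply, map_add, add_mul, add_smul,
    Finset.sum_add_distrib]
  abel

theorem frameCov_zero (v : L y) : C.frameCov x₀ (fun _ => 0) y v = 0 := by
  simp only [frameCov_apply, frameDer_zero, LinearMap.zero_apply, map_zero, zero_mul, zero_smul,
    Finset.sum_const_zero, add_zero]

theorem frameCov_sum {ι : Type*} (S : Finset ι) {e : ι → Π x, E x} (hy : y ∈ frSet FE E x₀)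
    (he : ∀ i, SmoothSecAt EM FE (e i) y) (v : L y) :
    C.frameCov x₀ (fun z => ∑ i ∈ S, e i z) y v = ∑ i ∈ S, C.frameCov x₀ (e i) y v := by
  classical
  induction S using Finset.induction_on with
  | empty => simpa using frameCov_zero v
  | insert i S hi ih =>
    simp only [Finset.sum_insert hi]
    rw [frameCov_add hy (he i) (SmoothSecAt.sum fun i _ => he i), ih]

theorem frameCov_smul (hy : y ∈ frSet FE E x₀) {f : M → ℂ}
    (hf : ContMDiffAt 𝓘(ℝ, EM) 𝓘(ℝ, ℂ) ∞ f y) (he : SmoothSecAt EM FE e y) (v : L y) :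
    C.frameCov x₀ (fun z => f z • e z) y v =
      f y • C.frameCov x₀ e y v + cderiv f y (𝓛.cAnchor y v) • e y := by
  simp only [frameCov_apply, frameDer_smul hy hf he, map_smul, smul_eq_mul, smul_add,
    Finset.smul_sum, smul_smul, mul_assoc]
  abel

/-- For holomorphic sections the components are holomorphic, and expansion by the rules of a
holomorphic connection yields the defining formula of `frameCov`. -/
theorem frameCov_eq_cov (hUL : U ≤ frSet FL L x₀) (hUE : U ≤ frSet FE E x₀)
    {l' : HolSec EM FL L U} {e' : HolSec EM FE E U} (hl : ∀ z : U, l z = l'.1 z)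
    (he : ∀ z : U, e z = e'.1 z) (hy : y ∈ U) :
    C.frameCov x₀ e y (l y) = (C.cov U l' e').1 ⟨y, hy⟩ := by
  obtain ⟨c, hc, ec⟩ := l'.exists_eq_sum hUL hl
  obtain ⟨d, hd, ed⟩ := e'.exists_eq_sum hUE he
  have hfr : ∀ i j, C.cov U (HolSec.res hUL (frHol EM FL L x₀ i))
      (HolSec.res hUE (frHol EM FE E x₀ j)) = HolSec.res (le_inf hUL hUE)
        (C.cov _ (HolSec.res inf_le_left (frHol EM FL L x₀ i))
          (HolSec.res inf_le_right (frHol EM FE E x₀ j))) := fun i j =>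
    C.cov_res (le_inf hUL hUE) (HolSec.res inf_le_left (frHol EM FL L x₀ i))
      (HolSec.res inf_le_right (frHol EM FE E x₀ j))
  have key : C.cov U l' e' = _ :=
    (congrArg₂ (fun a b => C.cov U a b) ec ed).trans (C.cov_sum_smul c d _ _)
  rw [← ec] at key
  rw [key, HolSec.add_apply, HolSec.sum_apply, HolSec.sum_apply, frameCov_apply, frameDer_apply]
  simp only [HolSec.sum_apply, hfr, HolSec.smul_apply]
  have e1 : ∀ i, (𝓛.act l' (d i)).1 ⟨y, hy⟩ =
      cderiv (fun z => co FE x₀ i z (e z)) y (𝓛.cAnchor y (l y)) := fun i =>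
    (𝓛.act_apply l' (d i) (hd i) ⟨y, hy⟩).trans (by rw [← hl ⟨y, hy⟩])
  simp only [e1]
  refine congrArg₂ (· + ·) rfl (Finset.sum_congr rfl fun i _ => Finset.sum_congr rfl fun j _ => ?_)
  refine congrArg₂ (· • ·) (congrArg₂ (· * ·) (hd j ⟨y, hy⟩).symm (hc i ⟨y, hy⟩).symm) ?_
  exact HolSec.ext_apply _ (le_inf hUL hUE hy)

theorem frameCov_hol (hL : y ∈ frSet FL L x₀) (hE : y ∈ frSet FE E x₀) {l' : HolSec EM FL L U}
    {e' : HolSec EM FE E U} (hl : ∀ z : U, l z = l'.1 z) (he : ∀ z : U, e z = e'.1 z)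
    (hy : y ∈ U) : C.frameCov x₀ e y (l y) = (C.cov U l' e').1 ⟨y, hy⟩ := by
  have hW : U ⊓ (frSet FL L x₀ ⊓ frSet FE E x₀) ≤ U := inf_le_left
  rw [frameCov_eq_cov (U := U ⊓ (frSet FL L x₀ ⊓ frSet FE E x₀)) (inf_le_right.trans inf_le_left)
    (inf_le_right.trans inf_le_right)
    (l' := HolSec.res hW l') (e' := HolSec.res hW e') (fun z => hl ⟨z, hW z.2⟩)
    (fun z => he ⟨z, hW z.2⟩) ⟨hy, hL, hE⟩, C.cov_res]
  rfl

/-- Expand e by the Leibniz rule and v by linearity in the frames around x₀. On these holomorphic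
frame sections the formula in the frames around x₁ gives the value of the holomorphic connection
itself. -/
theorem frameCov_change (hL₀ : y ∈ frSet FL L x₀) (hE₀ : y ∈ frSet FE E x₀)
    (hL₁ : y ∈ frSet FL L x₁) (hE₁ : y ∈ frSet FE E x₁) (he : SmoothSecAt EM FE e y) (v : L y) :
    C.frameCov x₁ e y v = C.frameCov x₀ e y v := by
  have hf := fun i => (holSecAt_fr (EM := EM) hE₀ i).smoothSecAt
  have hc := (smoothSecAt_iff hE₀).1 he
  have hij : ∀ i j, C.frameCov x₁ (fr FE E x₀ j) y (fr FL L x₀ i y) = C.frCov x₀ i j y := by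
    intro i j
    have hy : y ∈ frSet FL L x₀ ⊓ frSet FE E x₀ := ⟨hL₀, hE₀⟩
    rw [frCov, HolSec.ext_apply _ hy]
    exact frameCov_hol hL₁ hE₁ (fun _ => rfl) (fun _ => rfl) hy
  have e1 : ∀ j, C.frameCov x₁ (fr FE E x₀ j) y v =
      ∑ i, co FL x₀ i y v • C.frCov x₀ i j y := fun j => by
    conv_lhs => rw [← sum_co_smul_fr hL₀ v]
    rw [map_sum]
    simp only [map_smul, hij]
  rw [frameCov_congr (eventually_eq_sum_co_smul_fr hE₀ e),
    frameCov_sum _ hE₁ fun i => (hf i).smul (hc i), frameCov_apply, frameDer_apply, Finset.sum_comm,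
    ← Finset.sum_add_distrib]
  refine Finset.sum_congr rfl fun j _ => ?_
  rw [frameCov_smul hE₁ (hc j) (hf j), e1, add_comm, Finset.smul_sum]
  simp only [smul_smul]

theorem smoothSecAt_frameCov (l : SmoothSec EM FL L) (e : SmoothSec EM FE E)
    (hL : y ∈ frSet FL L x₀) (hE : y ∈ frSet FE E x₀) :
    SmoothSecAt EM FE (fun z => C.frameCov x₀ e.1 z (l.1 z)) y := by
  have h1 := SmoothSecAt.frameDer hE (e.2 y) (𝓛.cAnchor_mem l)
  have h3 : SmoothSecAt EM FE (fun y => ∑ i, ∑ j,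
      (co FE x₀ j y (e.1 y) * co FL x₀ i y (l.1 y)) • C.frCov x₀ i j y) y :=
    SmoothSecAt.sum fun i _ => SmoothSecAt.sum fun j _ => SmoothSecAt.smul
      (((smoothSecAt_iff hE).1 (e.2 y) j).mul_complex ((smoothSecAt_iff hL).1 (l.2 y) i))
      (HolSec.holSecAt_ext _ (show y ∈ frSet FL L x₀ ⊓ frSet FE E x₀ from ⟨hL, hE⟩)).smoothSecAt
  exact (h1.add h3).congr (Filter.Eventually.of_forall fun z => frameCov_apply _ _ _ _ _)

variable (C) in
theorem smoothCov : 𝓛.SmoothCov (FE := FE) (E := E) fun l e x => C.frameCov x e.1 x (l.1 x) where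
  smooth l e x := by
    refine (smoothSecAt_frameCov (C := C) l e (mem_frSet x) (mem_frSet x)).congr ?_
    filter_upwards [(frSet FL L x).isOpen.mem_nhds (mem_frSet x),
      (frSet FE E x).isOpen.mem_nhds (mem_frSet x)] with y h1 h2
    exact frameCov_change h1 h2 (mem_frSet y) (mem_frSet y) (e.2 y) _
  add_left l l' e x := map_add _ (l.1 x) (l'.1 x)
  smul_left f l e x := map_smul _ (f.1 x) (l.1 x)
  add_right l e e' x := frameCov_add (mem_frSet x) (e.2 x) (e'.2 x) _
  leibniz l f e x := frameCov_smul (mem_frSet x) (f.2 x) (e.2 x) _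

-- The cocycle is tensorial in l and e, so both may be taken holomorphic near x. Then ∇_l e is the
-- holomorphic section given by C, and the cocycle, being ∂̄_X(∇_l e), vanishes.
variable (C) in
theorem atiyahForm_smoothCov : C.smoothCov.extendingConnection.atiyahForm = 0 := by
  have h1 : ∀ (X : AntiholFields EM M) (l : SmoothSec EM FL L) (e : SmoothSec EM FE E) (x : M),
      IsHolNear l x → IsHolNear e x →
        (C.smoothCov.extendingConnection.atiyahForm X l e).1 x = 0 := by
    intro X l e x hl he
    rw [atiyahForm_apply_hol _ X hl he]
    refine (dbar_apply_hol ?_).self_of_nhds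
    obtain ⟨W, hxW, hW⟩ := exists_opens_of_eventually (hl.and he)
    let l' : HolSec EM FL L W := HolSec.of l.1 fun z hz => (hW z hz).1
    let e' : HolSec EM FE E W := HolSec.of e.1 fun z hz => (hW z hz).2
    filter_upwards [W.isOpen.mem_nhds hxW] with y hy
    refine (C.cov W l' e').holSecAt_of_eq (fun z => ?_) hy
    rw [SmoothCov.extendingConnection_apply]
    exact frameCov_hol (mem_frSet _) (mem_frSet _) (fun _ => rfl) (fun _ => rfl) z.2
  refine LinearMap.ext fun X => LinearMap.ext fun l => LinearMap.ext fun e =>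
    SmoothSec.eq_of_forall fun x => ?_
  set A := C.smoothCov.extendingConnection.atiyahForm X with hA
  have h2 : ∀ l, IsHolNear l x → ∀ e, (A l e).1 x = 0 := fun l hl e => by
    refine tensorial_eq_zero (x := x) ((SmoothSec.eval x).comp (A l).toAddMonoidHom)
      (fun f e => ?_) (fun e he => h1 X l e x hl he) e
    change (A l (f • e)).1 x = f.1 x • (A l e).1 x
    rw [map_smul]
    rfl
  let φ : SmoothSec EM FL L →+ E x := AddMonoidHom.mk' (fun l => (A l e).1 x) fun l l' => by
    rw [map_add]
    rfl
  refine tensorial_eq_zero φ (fun f l => ?_) (fun l hl => h2 l hl e) l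
  change (A (f • l) e).1 x = f.1 x • (A l e).1 x
  rw [map_smul]
  rfl

end HolConnection

end HolLieAlgebroid

end

noncomputable section

variable {EM : Type*} [NormedAddCommGroup EM] [NormedSpace ℂ EM]
  {M : Type*} [TopologicalSpace M] [ChartedSpace EM M] [IsManifold 𝓘(ℂ, EM) ∞ M]
  {FL : Type*} [NormedAddCommGroup FL] [NormedSpace ℂ FL] {L : M → Type*}
  [TopologicalSpace (TotalSpace FL L)] [∀ x, AddCommGroup (L x)] [∀ x, Module ℂ (L x)]
  [∀ x, TopologicalSpace (L x)] [FiberBundle FL L] [VectorBundle ℂ FL L]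
  {FE : Type*} [NormedAddCommGroup FE] [NormedSpace ℂ FE] {E : M → Type*}
  [TopologicalSpace (TotalSpace FE E)] [∀ x, AddCommGroup (E x)] [∀ x, Module ℂ (E x)]
  [∀ x, TopologicalSpace (E x)] [FiberBundle FE E] [VectorBundle ℂ FE E]
  {U V : Opens M}

namespace HolLieAlgebroid

variable {𝓛 : HolLieAlgebroid EM FL L}

/-! ### Connections and splittings -/

/-- The splitting defined by a connection. -/
def HolConnection.splitting (C : 𝓛.HolConnection FE E) : 𝓛.HolSplitting FE E where
  toHom _ :=
    { toFun := fun l => DerSec.mk l (fun V h => C.cov V (HolSec.res h l))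
        (fun V h f e => C.leibniz V (HolSec.res h l) f e)
        (fun _ _ h h' e => C.cov_res h' (HolSec.res h l) e)
      map_add' := fun l l' => DerSec.ext rfl fun V h e =>
        LinearMap.congr_fun (map_add (C.cov V) (HolSec.res h l) (HolSec.res h l')) e
      map_smul' := fun f l => DerSec.ext rfl fun V h e =>
        C.smul_left V (HolFun.res h f) (HolSec.res h l) e }
  res _ _ := DerSec.ext rfl fun _ _ _ => rfl
  symbol_toHom _ _ := rfl

/-- The connection defined by a splitting. -/
def HolSplitting.connection (s : 𝓛.HolSplitting FE E) : 𝓛.HolConnection FE E :=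
  have hadd : ∀ (U : Opens M) l l' (e : HolSec EM FE E U), DerSec.op (s.toHom U (l + l')) le_rfl e =
      DerSec.op (s.toHom U l) le_rfl e + DerSec.op (s.toHom U l') le_rfl e := fun _ l l' e => by
    rw [map_add]
    rfl
  have hsmul : ∀ (U : Opens M) (f : HolFun EM U) l (e : HolSec EM FE E U),
      DerSec.op (s.toHom U (f • l)) le_rfl e = f • DerSec.op (s.toHom U l) le_rfl e :=
    fun U f l e => by
      rw [map_smul]
      rfl
  { cov := fun U => LinearMap.mk₂ ℂ (fun l e => DerSec.op (s.toHom U l) le_rfl e) (hadd U)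
      (fun c l e => hsmul U (algebraMap ℂ _ c) l e) (fun l e e' => map_add _ e e')
      (fun c l e => map_smul _ c e)
    smul_left := hsmul
    leibniz := fun U l f e => by
      have h := DerSec.op_smul (s.toHom U l) le_rfl f e
      have h2 : (s.toHom U l).1.1 = l := s.symbol_toHom U l
      rw [h2] at h
      exact h
    cov_res := fun {U V} h l e => by
      have h1 := DerSec.op_res (s.toHom U l) le_rfl h e
      refine Eq.trans ?_ h1
      exact congrArg (fun d => DerSec.op d le_rfl (HolSec.res h e)) (s.res h l) }

variable (𝓛 FE E) in
/-- Connections are the same as splittings. -/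
def connectionEquivSplitting : 𝓛.HolConnection FE E ≃ 𝓛.HolSplitting FE E where
  toFun C := C.splitting
  invFun s := s.connection
  left_inv _ := rfl
  right_inv s := by
    -- Compatibility with restriction says that s(l) acts over V ≤ U as s(l|_V) does, so s is
    -- recovered from the action of each s(l) over the full open set of l.
    have h : ∀ U l, s.connection.splitting.toHom U l = s.toHom U l := fun U l =>
      DerSec.ext (s.symbol_toHom U l).symm fun V h e =>
        congrArg (fun d => DerSec.op d le_rfl e) (s.res h l)
    obtain ⟨toHom, res, hs⟩ := s
    have h2 : (HolSplitting.connection ⟨toHom, res, hs⟩).splitting.toHom = toHom :=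
      funext fun U => LinearMap.ext (h U)
    rw [HolSplitting.mk.injEq]
    exact h2

theorem HolConnection.splitting_injective (C : 𝓛.HolConnection FE E) (U : Opens M) :
    Function.Injective (C.splitting.toHom U) :=
  Function.LeftInverse.injective (g := DerSec.symbol U) fun l => C.splitting.symbol_toHom U l

/-- Anchors are preserved automatically, the symbol of s(l) being l. Equality of brackets compares
operators over every V ≤ U, and over V it is flatness for the restricted sections. -/
theorem HolConnection.isFlat_iff (C : 𝓛.HolConnection FE E) :
    C.IsFlat ↔ C.splitting.IsLieAlgebroidMorphism := by
  constructor
  · intro hC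
    refine ⟨fun U l f => rfl, fun U l m => DerSec.ext rfl fun V h e => ?_⟩
    have h1 := hC V (HolSec.res h l) (HolSec.res h m) e
    rw [𝓛.bracket_res] at h1
    exact (sub_eq_zero.1 h1).symm
  · intro hC U l m e
    have h1 := congrArg (fun d => DerSec.op d le_rfl e) (hC.bracket U l m)
    exact sub_eq_zero.2 h1.symm

/-! ### The sequence of sheaves -/

variable [FiniteDimensional ℂ FE] [ContMDiffVectorBundle ∞ FE E 𝓘(ℂ, EM)]

/-- The holomorphic section with constant components in the local frame around `x₀`. -/
def constFrame (x₀ : M) (c : Fin (Module.finrank ℂ FE) → ℂ) : HolSec EM FE E (frSet FE E x₀) :=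
  ∑ i, c i • frHol EM FE E x₀ i

theorem constFrame_apply (x₀ : M) (c : Fin (Module.finrank ℂ FE) → ℂ) (y : frSet FE E x₀) :
    (constFrame (EM := EM) x₀ c).1 y = ∑ i, c i • fr FE E x₀ i y := by
  rw [constFrame, HolSec.sum_apply]
  rfl

/-- A derivation of symbol zero is linear over holomorphic functions. Its value at y therefore
depends only on the components of e at y and on the images of the frame: it acts by an endomorphism
of the fibre. -/
theorem op_apply_eq_sum {d : 𝓛.DerSec FE E U} (hd : d.1.1 = 0) {W : Opens M} (hW : W ≤ U)
    (e : HolSec EM FE E W) {x₀ y : M} (hy : y ∈ W) (hy₀ : y ∈ frSet FE E x₀) :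
    (DerSec.op d hW e).1 ⟨y, hy⟩ = ∑ i, co FE x₀ i y (e.1 ⟨y, hy⟩) •
      (DerSec.op d (show U ⊓ frSet FE E x₀ ≤ U from inf_le_left)
        (HolSec.res inf_le_right (frHol EM FE E x₀ i))).1 ⟨y, hW hy, hy₀⟩ := by
  let W' : Opens M := W ⊓ frSet FE E x₀
  have h1 : W' ≤ W := inf_le_left
  have h2 : W' ≤ frSet FE E x₀ := inf_le_right
  have h3 : W' ≤ U ⊓ frSet FE E x₀ := inf_le_inf_right _ hW
  have hyW : y ∈ W' := ⟨hy, hy₀⟩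
  obtain ⟨c, hc, ec⟩ := (HolSec.res h1 e).exists_eq_sum h2 (s := e.ext) fun z =>
    e.ext_apply (h1 z.2)
  have hsm : ∀ (f : HolFun EM W') s, DerSec.op d (h1.trans hW) (f • s) =
      f • DerSec.op d (h1.trans hW) s := fun f s => by
    rw [DerSec.op_smul, hd, map_zero, act_zero, zero_smul, add_zero]
  have h4 : (DerSec.op d hW e).1 ⟨y, hy⟩ =
      (DerSec.op d (h1.trans hW) (HolSec.res h1 e)).1 ⟨y, hyW⟩ := by
    rw [DerSec.op_res d hW h1]
    rfl
  rw [h4, ec, map_sum, HolSec.sum_apply]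
  refine Finset.sum_congr rfl fun i _ => ?_
  rw [hsm, HolSec.smul_apply, hc, e.ext_apply hy]
  congr 1
  exact congrArg (fun s : HolSec EM FE E W' => s.1 ⟨y, hyW⟩)
    (DerSec.op_res d (show U ⊓ frSet FE E x₀ ≤ U from inf_le_left) h3
      (HolSec.res inf_le_right (frHol EM FE E x₀ i)))

variable [∀ x, IsTopologicalAddGroup (E x)] [∀ x, ContinuousSMul ℂ (E x)]

theorem _root_.ContinuousLinearEquiv.continuous_linearMap {V F : Type*} [AddCommGroup V]
    [Module ℂ V] [TopologicalSpace V] [NormedAddCommGroup F] [NormedSpace ℂ F]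
    [FiniteDimensional ℂ F] (e : V ≃L[ℂ] F) (φ : V →ₗ[ℂ] V) : Continuous φ := by
  have h : Continuous ((e : V →ₗ[ℂ] F) ∘ₗ φ ∘ₗ (e.symm : F →ₗ[ℂ] V)) :=
    LinearMap.continuous_of_finiteDimensional _
  refine (e.symm.continuous.comp (h.comp e.continuous)).congr fun v => ?_
  simp

theorem contMDiffAt_of_apply_basis {u : M → FE →L[ℂ] FE} {x : M}
    (h : ∀ i, ContMDiffAt 𝓘(ℂ, EM) 𝓘(ℂ, FE) ∞ (fun y => u y (Module.finBasis ℂ FE i)) x) :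
    ContMDiffAt 𝓘(ℂ, EM) 𝓘(ℂ, FE →L[ℂ] FE) ∞ u x := by
  have h1 : ∀ i, ContMDiffAt 𝓘(ℂ, EM) 𝓘(ℂ, FE →L[ℂ] FE) ∞ (fun y =>
      ContinuousLinearMap.smulRightL ℂ FE FE
        (LinearMap.toContinuousLinearMap ((Module.finBasis ℂ FE).coord i))
        (u y (Module.finBasis ℂ FE i))) x := fun i =>
    ContMDiffAt.comp (I' := 𝓘(ℂ, FE)) x (ContinuousLinearMap.contMDiff _).contMDiffAt (h i)
  refine (contMDiffAt_finsetSum (t := Finset.univ) fun i _ => h1 i).congr_of_eventuallyEq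
    (Filter.Eventually.of_forall fun y => ?_)
  refine ContinuousLinearMap.ext fun v => ?_
  conv_lhs => rw [← (Module.finBasis ℂ FE).sum_repr v]
  simp only [map_sum, map_smul, sum_apply]
  rfl

/-- A field of endomorphisms is holomorphic if its values on the frame are. -/
theorem holSecAt_hom {φ : Π x, E x →L[ℂ] E x} {x : M}
    (h : ∀ i, HolSecAt EM FE (fun y => φ y (fr FE E x i y)) x) :
    ContMDiffAt 𝓘(ℂ, EM) (𝓘(ℂ, EM).prod 𝓘(ℂ, FE →L[ℂ] FE)) ∞
      (fun y => TotalSpace.mk' (FE →L[ℂ] FE) (E := fun x => E x →L[ℂ] E x) y (φ y)) x := by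
  rw [contMDiffAt_hom_bundle]
  refine ⟨contMDiffAt_id, contMDiffAt_of_apply_basis fun i => ?_⟩
  have h1 := Trivialization.contMDiffAt_section_iff (IB := 𝓘(ℂ, EM)) (n := ∞)
    (s := fun y => φ y (fr FE E x i y)) (trivializationAt FE E x) (x₀ := x) (mem_frSet x)
  refine (h1.1 (h i)).congr_of_eventuallyEq ?_
  filter_upwards [(frSet FE E x).isOpen.mem_nhds (mem_frSet x)] with y hy
  rw [ContinuousLinearMap.inCoordinates_eq hy hy]
  change (trivializationAt FE E x ⟨y, φ y (((trivializationAt FE E x).continuousLinearEquivAt ℂ y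
    hy).symm (Module.finBasis ℂ FE i))⟩).2 = (trivializationAt FE E x ⟨y, φ y (fr FE E x i y)⟩).2
  congr 4
  exact congrFun ((trivializationAt FE E x).symm_continuousLinearEquivAt_eq hy) _

/-- Every vector of the fibre at x is the value of a holomorphic section with constant components
near x, so the derivation determines the endomorphism pointwise. -/
theorem endInclusion_injective (U : Opens M) :
    Function.Injective (𝓛.endInclusion (FE := FE) (E := E) U) := by
  intro φ ψ h
  refine Subtype.ext (funext fun x => ContinuousLinearMap.ext fun v => ?_)
  have hW : U ⊓ frSet FE E x ≤ U := inf_le_left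
  let e : HolSec EM FE E (U ⊓ frSet FE E x) := HolSec.res inf_le_right
    (constFrame (x : M) fun i => co FE (x : M) i (x : M) v)
  have h1 := congrArg (fun d => (DerSec.op d hW e).1 ⟨x, x.2, mem_frSet _⟩) h
  have h2 : e.1 ⟨x, x.2, mem_frSet _⟩ = v :=
    (constFrame_apply _ _ _).trans (sum_co_smul_fr (mem_frSet _) v)
  have h3 : ∀ φ : endSec EM FE E U, (DerSec.op (𝓛.endInclusion U φ) hW e).1 ⟨x, x.2, mem_frSet _⟩ =
      φ.1 x v := fun φ => by rw [← h2]; rfl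
  exact (h3 φ).symm.trans (h1.trans (h3 ψ))

/-- By `op_apply_eq_sum` a derivation of symbol zero is a field of fibre endomorphisms. The field is
holomorphic because it sends the holomorphic frame to the images of the frame under the derivation.
-/
theorem range_endInclusion (U : Opens M) :
    LinearMap.range (𝓛.endInclusion (FE := FE) (E := E) U) =
      LinearMap.ker (DerSec.symbol (𝓛 := 𝓛) (FE := FE) (E := E) U) := by
  refine le_antisymm ?_ fun d hd => ?_
  · rintro _ ⟨φ, rfl⟩
    exact LinearMap.mem_ker.2 rfl
  have hd : d.1.1 = 0 := hd
  -- The image of the i-th frame section at x, for the frame centred at x itself; the frame changes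
  -- with x, and holomorphy is derived afterwards from the frame-free formula `hφ`. Outside U the
  -- value is zero and plays no role.
  let A : Π x : M, Fin (Module.finrank ℂ FE) → E x := fun x i =>
    (DerSec.op d (show U ⊓ frSet FE E x ≤ U from inf_le_left)
      (HolSec.res inf_le_right (frHol EM FE E x i))).ext x
  let φ : Π x : M, E x →L[ℂ] E x := fun x =>
    ⟨∑ i, (co FE x i x).smulRight (A x i), ((trivializationAt FE E x).continuousLinearEquivAt ℂ x
      (mem_baseSet_trivializationAt FE E x)).continuous_linearMap _⟩
  have hφ : ∀ {W : Opens M} (hW : W ≤ U) (e : HolSec EM FE E W) (y : W),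
      (DerSec.op d hW e).1 y = φ y (e.1 y) := by
    intro W hW e y
    rw [op_apply_eq_sum hd hW e y.2 (mem_frSet (y : M))]
    refine Eq.trans ?_ (LinearMap.sum_apply _ _ _).symm
    refine Finset.sum_congr rfl fun i _ => ?_
    refine Eq.trans ?_ (LinearMap.smulRight_apply _ _ _).symm
    refine congrArg₂ (· • ·) rfl ?_
    exact (HolSec.ext_apply _ (show (y : M) ∈ U ⊓ frSet FE E (y : M) from
      ⟨hW y.2, mem_frSet _⟩)).symm
  have hhol : ∀ x ∈ U, ContMDiffAt 𝓘(ℂ, EM) (𝓘(ℂ, EM).prod 𝓘(ℂ, FE →L[ℂ] FE)) ∞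
      (fun y => TotalSpace.mk' (FE →L[ℂ] FE) (E := fun x => E x →L[ℂ] E x) y (φ y)) x := by
    intro x hx
    refine holSecAt_hom fun i => ?_
    have hW : U ⊓ frSet FE E x ≤ U := inf_le_left
    exact HolSec.holSecAt_of_eq
      (DerSec.op d hW (HolSec.res inf_le_right (frHol EM FE E x i)))
      (fun z => (hφ hW (HolSec.res inf_le_right (frHol EM FE E x i)) z).symm) ⟨hx, mem_frSet x⟩
  refine ⟨⟨fun x => φ x, fun x => (contMDiffAt_subtype_iff (U := U) (x := x)).2 (hhol x x.2)⟩, ?_⟩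
  exact DerSec.ext hd.symm fun W hW e => HolSec.eq_of_forall fun y => (hφ hW e y).symm

variable [FiniteDimensional ℂ FL] [ContMDiffVectorBundle ∞ FL L 𝓘(ℂ, EM)] [FiniteDimensional ℂ EM]

/-- The derivative of a holomorphic section along a holomorphic section of `L`, in a local frame,
is holomorphic. -/
theorem holSecAt_frameDer {e : Π x, E x} {l : Π x, L x} {x₀ y : M} (hy : y ∈ frSet FE E x₀)
    (he : HolSecAt EM FE e y) (hl : HolSecAt EM FL l y) :
    HolSecAt EM FE (fun z => frameDer FE x₀ e z (𝓛.cAnchor z (l z))) y := by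
  simp only [frameDer_apply]
  exact HolSecAt.sum fun i _ => HolSecAt.smul (𝓛.contMDiffAt_cderiv hl ((holSecAt_iff hy).1 he i))
    (holSecAt_fr hy i)

/-- Over the domain of one frame of `E`, differentiation of components along ρ(l) is a derivation
with symbol l. Exactness at `𝓛` is local, so this is all that surjectivity requires. -/
theorem exists_derSec (l : HolSec EM FL L U) (x₀ : M) (hU : U ≤ frSet FE E x₀) :
    ∃ d : 𝓛.DerSec FE E U, DerSec.symbol U d = l := by
  have hadd : ∀ {W : Opens M} (e e' : HolSec EM FE E W) {y : M}, y ∈ W →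
      ∀ᶠ z in 𝓝 y, (e + e').ext z = e.ext z + e'.ext z := fun {W} e e' {y} hy => by
    filter_upwards [W.isOpen.mem_nhds hy] with z hz
    rw [HolSec.ext_apply _ hz, HolSec.ext_apply _ hz, HolSec.ext_apply _ hz, HolSec.add_apply]
  have hsmul : ∀ {W : Opens M} (f : HolFun EM W) (e : HolSec EM FE E W) {y : M}, y ∈ W →
      ∀ᶠ z in 𝓝 y, (f • e).ext z = Function.extend Subtype.val f.1 (0 : M → ℂ) z • e.ext z :=
    fun {W} f e {y} hy => by
      filter_upwards [W.isOpen.mem_nhds hy] with z hz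
      have h1 : Function.extend Subtype.val f.1 (0 : M → ℂ) z = f.1 ⟨z, hz⟩ :=
        Subtype.val_injective.extend_apply f.1 _ ⟨z, hz⟩
      rw [HolSec.ext_apply _ hz, HolSec.ext_apply _ hz, HolSec.smul_apply, h1]
  have hleib : ∀ {W : Opens M} (hW : W ≤ U) (f : HolFun EM W) (e : HolSec EM FE E W) (y : W),
      frameDer FE x₀ (f • e).ext y (𝓛.cAnchor y (l.1 ⟨y, hW y.2⟩)) =
        f.1 y • frameDer FE x₀ e.ext y (𝓛.cAnchor y (l.1 ⟨y, hW y.2⟩)) +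
          (𝓛.act (HolSec.res hW l) f).1 y • e.1 y := by
    intro W hW f e y
    have hf := ((contMDiffOn_extend f).contMDiffAt (W.isOpen.mem_nhds y.2)).real_of_complex
    have h1 : ∀ z : W, f.1 z = Function.extend Subtype.val f.1 (0 : M → ℂ) z := fun z =>
      (Subtype.val_injective.extend_apply f.1 _ z).symm
    rw [frameDer_congr x₀ (hsmul f e y.2), frameDer_smul (hU (hW y.2)) hf
      (e.holSecAt_ext y.2).smoothSecAt, ← h1, e.ext_apply y.2, 𝓛.act_apply (HolSec.res hW l) f h1]
    rfl
  have hsmul0 : ∀ {W : Opens M} (hW : W ≤ U) (c : ℂ), 𝓛.act (HolSec.res hW l)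
      (algebraMap ℂ (HolFun EM W) c) = 0 := fun {W} hW c => HolFun.eq_of_forall fun y => by
    rw [𝓛.act_apply _ _ (u := fun _ => c) (fun _ => rfl), cderiv_const]
    rfl
  refine ⟨DerSec.mk l (fun W hW =>
    { toFun := fun e => HolSec.of (fun y => frameDer FE x₀ e.ext y (𝓛.cAnchor y (l.ext y)))
        fun y hy => holSecAt_frameDer (hU (hW hy)) (e.holSecAt_ext hy) (l.holSecAt_ext (hW hy))
      map_add' := fun e e' => HolSec.eq_of_forall fun y => ?_
      map_smul' := fun c e => HolSec.eq_of_forall fun y => ?_ }) (fun W hW f e => ?_)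
      fun W W' hW hW' e => ?_, rfl⟩
  · change frameDer FE x₀ (e + e').ext y _ = frameDer FE x₀ e.ext y _ + frameDer FE x₀ e'.ext y _
    rw [frameDer_congr x₀ (hadd e e' y.2), frameDer_add (hU (hW y.2))
      (e.holSecAt_ext y.2).smoothSecAt (e'.holSecAt_ext y.2).smoothSecAt, LinearMap.add_apply]
  · have h := hleib hW (algebraMap ℂ (HolFun EM W) c) e y
    rw [hsmul0, ← l.ext_apply] at h
    exact h.trans ((congrArg (_ + ·) (zero_smul ℂ _)).trans (add_zero _))
  · refine HolSec.eq_of_forall fun y => ?_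
    have h := hleib hW f e y
    rw [← l.ext_apply] at h
    exact h
  · refine HolSec.eq_of_forall fun y => ?_
    change frameDer FE x₀ (HolSec.res hW' e).ext y _ = frameDer FE x₀ e.ext y _
    rw [frameDer_congr x₀ (e' := e.ext)]
    filter_upwards [W'.isOpen.mem_nhds y.2] with z hz
    rw [HolSec.ext_apply _ hz, e.ext_apply (hW' hz)]
    rfl

end HolLieAlgebroid

end

/-! ### Assembly of the four statements. -/

theorem theorem5p10
    {EM : Type*} [NormedAddCommGroup EM] [NormedSpace ℂ EM] [FiniteDimensional ℂ EM]
    {M : Type*} [TopologicalSpace M] [T2Space M] [ParacompactSpace M] [ChartedSpace EM M]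
    [IsManifold 𝓘(ℂ, EM) ∞ M]
    {FL : Type*} [NormedAddCommGroup FL] [NormedSpace ℂ FL] [FiniteDimensional ℂ FL]
    {L : M → Type*} [TopologicalSpace (TotalSpace FL L)]
    [∀ x, AddCommGroup (L x)] [∀ x, Module ℂ (L x)] [∀ x, TopologicalSpace (L x)]
    [FiberBundle FL L] [VectorBundle ℂ FL L] [ContMDiffVectorBundle ∞ FL L 𝓘(ℂ, EM)]
    {FE : Type*} [NormedAddCommGroup FE] [NormedSpace ℂ FE] [FiniteDimensional ℂ FE]
    {E : M → Type*} [TopologicalSpace (TotalSpace FE E)]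
    [∀ x, AddCommGroup (E x)] [∀ x, Module ℂ (E x)] [∀ x, TopologicalSpace (E x)]
    [∀ x, IsTopologicalAddGroup (E x)] [∀ x, ContinuousSMul ℂ (E x)]
    [FiberBundle FE E] [VectorBundle ℂ FE E] [ContMDiffVectorBundle ∞ FE E 𝓘(ℂ, EM)]
    (𝓛 : HolLieAlgebroid EM FL L) :
    -- the triad `(T^{0,1}M ⋈ L, T^{0,1}M, E)` exists and is unique
    (∃! T : LieAlgebroid.MatchedTriad (SmoothFun EM M) (AntiholFields EM M)
      (SmoothSec EM FL L) (SmoothSec EM FE E), 𝓛.IsAtiyahTriad T) ∧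
    -- its Atiyah class is well defined and is the obstruction to a global holomorphic connection
    (∀ T : LieAlgebroid.MatchedTriad (SmoothFun EM M) (AntiholFields EM M)
      (SmoothSec EM FL L) (SmoothSec EM FE E), 𝓛.IsAtiyahTriad T →
      ∃ α : T.H1, Nonempty T.ExtendingConnection ∧
        (∀ C : T.ExtendingConnection, C.atiyahClass = α) ∧
        (α = 0 ↔ Nonempty (𝓛.HolConnection FE E))) ∧
    -- the sequence `0 → End(𝓔) → D_𝓛(𝓔) → 𝓛 → 0` of sheaves is exact
    ((∀ U : Opens M, Function.Injective (𝓛.endInclusion (FE := FE) (E := E) U)) ∧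
      (∀ U : Opens M, LinearMap.range (𝓛.endInclusion (FE := FE) (E := E) U) =
        LinearMap.ker (HolLieAlgebroid.DerSec.symbol (𝓛 := 𝓛) (FE := FE) (E := E) U)) ∧
      (∀ (U : Opens M) (l : HolSec EM FL L U) (x : M), x ∈ U → ∃ (V : Opens M) (h : V ≤ U),
        x ∈ V ∧ ∃ d : 𝓛.DerSec FE E V, HolLieAlgebroid.DerSec.symbol V d = HolSec.res h l)) ∧
    -- connections are the same as splittings, flat ones are the Lie algebroid morphisms
    (∃ Φ : 𝓛.HolConnection FE E ≃ 𝓛.HolSplitting FE E,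
      (∀ (C : 𝓛.HolConnection FE E) (U V : Opens M) (h : V ≤ U) (l : HolSec EM FL L U)
        (e : HolSec EM FE E V), HolLieAlgebroid.DerSec.op ((Φ C).toHom U l) h e =
          C.cov V (HolSec.res h l) e) ∧
      (∀ (C : 𝓛.HolConnection FE E) (U : Opens M), Function.Injective ((Φ C).toHom U)) ∧
      (∀ C : 𝓛.HolConnection FE E, C.IsFlat ↔ (Φ C).IsLieAlgebroidMorphism)) := by
  refine ⟨⟨𝓛.atiyahTriad FE E, 𝓛.isAtiyahTriad_atiyahTriad, fun T hT => hT.eq⟩, ?_,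
    ⟨HolLieAlgebroid.endInclusion_injective, HolLieAlgebroid.range_endInclusion,
      fun U l x hx => ?_⟩,
    HolLieAlgebroid.connectionEquivSplitting FE E 𝓛, fun _ _ _ _ _ _ => rfl,
    HolLieAlgebroid.HolConnection.splitting_injective, HolLieAlgebroid.HolConnection.isFlat_iff⟩
  · intro T hT
    -- By uniqueness it suffices to treat the constructed triad.
    obtain rfl := hT.eq
    obtain ⟨k, hk⟩ := HolLieAlgebroid.exists_smoothCov FE E 𝓛
    -- The connection glued by the partition of unity represents α; any other extending connection
    -- has the same class.
    refine ⟨hk.extendingConnection.atiyahClass, ⟨hk.extendingConnection⟩,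
      fun C => LieAlgebroid.MatchedTriad.ExtendingConnection.atiyahClass_eq C _, ?_⟩
    rw [LieAlgebroid.MatchedTriad.ExtendingConnection.atiyahClass_eq_zero_iff]
    exact ⟨fun ⟨_, hC⟩ => ⟨HolLieAlgebroid.holConnectionOfAtiyahForm hC⟩,
      fun ⟨C⟩ => ⟨C.smoothCov.extendingConnection, C.atiyahForm_smoothCov⟩⟩
  · exact ⟨U ⊓ frSet FE E x, inf_le_left, ⟨hx, mem_frSet x⟩,
      HolLieAlgebroid.exists_derSec (HolSec.res inf_le_left l) x inf_le_right⟩
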